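/- **Setting.** Let $N,K\ge 1$ be integers, not both equal to $1$. There are $N$ items; item $i\in[N]$ has a known reward $r_i\in(0,1]$ and an unknown preference $v_i\in(0,1]$. When a set (assortment) $S\subseteq[N]$ with $|S|\le K$ is offered to a user (a *pull*), the user chooses $i\in S$ with probability $v_i/(1+\sum_{j\in S}v_j)$ and makes no purchase with probability $1/(1+\sum_{j\in S}v_j)$, independently over the pulls. For $\mathbf w\in[0,\infty)^N$ let $R(S,\mathbf w)=\sum_{i\in S}r_iw_i/(1+\sum_{j\in S}w_j)$. The best assortment $S_{\mathbf v}$ is the maximiser of $R(S,\mathbf v)$ over $|S|\le K$ (of smallest cardinality, if there are several), and $\theta_{\mathbf v}=R(S_{\mathbf v},\mathbf v)$. Let $\eta_i=(r_i-\theta_{\mathbf v})v_i$, and let $\eta^{(j)}$ be the $j$-th largest of these values. For $i\notin S_{\mathbf v}$ put $\Delta_i=\eta^{(K)}-\eta_i$ if $|S_{\mathbf v}|=K$ and $\Delta_i=-\eta_i$ if $|S_{\mathbf v}|<K$; for $i\in S_{\mathbf v}$ put $\Delta_i=\min\{\eta^{(K)}-\eta^{(K+1)},\ \min_{j\in S_{\mathbf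 v}}(r_j-\theta_{\mathbf v})\}$, where the first term is omitted if $K\ge N$. Assume $\Delta_i\ne0$ for all $i$, and let $$H_1=\sum_{i}\frac1{\Delta_i^2},\qquad H_2=\sum_{i}\frac{v_i+1/K}{\Delta_i^2}+\max_i\frac1{\Delta_i^2}.$$ **Algorithm** (input $N$, $K$, $\mathbf r$, $\delta>0$). Put $\epsilon_\tau=2^{-\tau-3}$, $T_{-1}=0$, $T_\tau=\lceil 8\epsilon_\tau^{-2}\ln(16N(\tau+1)^2/\delta)\rceil$, $I_0=[N]$. In round $\tau=0,1,\dots$: split $I_\tau$ arbitrarily (possibly depending on the past) into $\lceil|I_\tau|/K\rceil$ blocks of size at most $K$. On each block $S$ call $T_\tau-T_{\tau-1}$ times the procedure ExploreSet$(S)$, which offers $S$ repeatedly until a no-purchase occurs and returns, for each $i\in S$, the number $f_i$ of times that $i$ was chosen. For $i\in I_\tau$ let $v_i^{(\tau)}$ be the average of the $f_i$ over all calls so far that involved $i$, $a_i=\max\{0,v_i^{(\tau)}-\epsilon_\tau\}$ and $b_i=\min\{v_i^{(\tau)}+\epsilon_\tau,1\}$. Let $\theta_{\mathbf a}$, $\theta_{\mathbf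 b}$ be the maxima of $R(S,\mathbf a)$, $R(S,\mathbf b)$ over $S\subseteq I_\tau$, $|S|\le K$. Let $C$ be the set of all $i\in I_\tau$ for which there is a $\theta\in[\theta_{\mathbf a},\theta_{\mathbf b}]$ such that $\theta<r_i$ and fewer than $K$ items $j\in I_\tau\setminus\{i\}$ satisfy $(r_j-\theta)a_j>(r_i-\theta)b_i$. If $|C|\le K$ and $r_i>R(C,\mathbf b)$ for all $i\in C$, return $C$; otherwise continue with $I_{\tau+1}=C$. **Theorem.** We have $H_2\le3H_1$. There is an implementation of the algorithm (with an exact implementation of the computation of $C$) and an absolute constant $c>0$ such that the following holds for all such $N,K,\mathbf r,\mathbf v$, all $\delta>0$ and every choice of the partitions. With probability at least $1-\delta$ the algorithm stops, returns $S_{\mathbf v}$, uses at most $c\,\Gamma$ pulls, where $$\Gamma=K^2H_2\ln\Big(\frac N\delta\ln(KH_2)\Big),$$ and runs in at most $$c\,\Big(N\Gamma+N^2\ln N\,\ln\frac{K}{\min_i\Delta_i}\Big)$$ steps. Here the running time is counted on a real RAM with unit cost for memory accesses, for arithmetic operations (including logarithm and rounding) and for comparisons; submitting an assortment or writing down a chosen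 partition costs a number of steps linear in its size, and the time for obtaining the users' choices is not counted. -/

import Mathlib

open MeasureTheory ProbabilityTheory

namespace MNL

/-! ### The choice model, the best assortment and the instance complexities -/

/-- Expected reward `R(S, w)` of the assortment `S` under preferences `w`. -/
noncomputable def reward {N : ℕ} (r w : Fin N → ℝ) (S : Finset (Fin N)) : ℝ :=
  (∑ i ∈ S, r i * w i) / (1 + ∑ j ∈ S, w j)

/-- Choice probabilities: `none` is the no-purchase option, whose preference is `1`. -/
noncomputable def choiceProb {N : ℕ} (v : Fin N → ℝ) (S : Finset (Fin N)) : Option (Fin N) → ℝ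
  | none => 1 / (1 + ∑ j ∈ S, v j)
  | some i => if i ∈ S then v i / (1 + ∑ j ∈ S, v j) else 0

/-- The assortments contained in `I` that respect the capacity `K`. -/
def feasible {N : ℕ} (K : ℕ) (I : Finset (Fin N)) : Finset (Finset (Fin N)) :=
  I.powerset.filter fun S => S.card ≤ K

theorem feasible_nonempty {N : ℕ} (K : ℕ) (I : Finset (Fin N)) : (feasible K I).Nonempty :=
  ⟨∅, by simp [feasible]⟩

/-- Optimal expected reward over the feasible assortments contained in `I`. -/
noncomputable def optReward {N : ℕ} (r : Fin N → ℝ) (K : ℕ) (I : Finset (Fin N))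
    (w : Fin N → ℝ) : ℝ :=
  (feasible K I).sup' (feasible_nonempty K I) (reward r w)

/-- `S` maximises the expected reward and has the smallest cardinality among all maximisers. -/
def IsBest {N : ℕ} (r : Fin N → ℝ) (K : ℕ) (v : Fin N → ℝ) (S : Finset (Fin N)) : Prop :=
  S.card ≤ K ∧ reward r v S = optReward r K Finset.univ v ∧
    ∀ S' : Finset (Fin N), S'.card ≤ K → reward r v S' = optReward r K Finset.univ v →
      S.card ≤ S'.card

theorem exists_isBest {N : ℕ} (r : Fin N → ℝ) (K : ℕ) (v : Fin N → ℝ) :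
    ∃ S, IsBest r K v S := by
  obtain ⟨S₀, hS₀, h₀⟩ := Finset.exists_mem_eq_sup' (feasible_nonempty K (Finset.univ)) (reward r v)
  obtain ⟨S, hS, hmin⟩ := Finset.exists_min_image
    ((feasible K Finset.univ).filter fun S => reward r v S = optReward r K Finset.univ v)
    Finset.card ⟨S₀, Finset.mem_filter.2 ⟨hS₀, h₀.symm⟩⟩
  simp only [Finset.mem_filter, feasible, Finset.mem_powerset, Finset.subset_univ, true_and]
    at hS hmin
  exact ⟨S, hS.1, hS.2, fun S' h1 h2 => hmin S' ⟨h1, h2⟩⟩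

/-- The best assortment `S_v`. -/
noncomputable def best {N : ℕ} (r : Fin N → ℝ) (K : ℕ) (v : Fin N → ℝ) : Finset (Fin N) :=
  (exists_isBest r K v).choose

/-- The advantage `η_i = (r_i - θ_v) v_i`. -/
noncomputable def advantage {N : ℕ} (r : Fin N → ℝ) (K : ℕ) (v : Fin N → ℝ) (i : Fin N) : ℝ :=
  (r i - optReward r K Finset.univ v) * v i

/-- The `j`-th largest advantage `η^(j)`, `1 ≤ j ≤ N`. -/
noncomputable def advantageRank {N : ℕ} (r : Fin N → ℝ) (K : ℕ) (v : Fin N → ℝ) (j : ℕ) : ℝ :=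
  (((Finset.univ : Finset (Fin N)).val.map (advantage r K v)).sort (· ≥ ·)).getD (j - 1) 0

/-- The common gap of the items of the best assortment. If `N ≤ K` there is no `(K+1)`-st
advantage, and the minimum is taken over the remaining terms. -/
noncomputable def innerGap {N : ℕ} (r : Fin N → ℝ) (K : ℕ) (v : Fin N → ℝ) : ℝ :=
  if K < N then
    min (advantageRank r K v K - advantageRank r K v (K + 1))
      (⨅ j : {j // j ∈ best r K v}, (r j - optReward r K Finset.univ v))
  else ⨅ j : {j // j ∈ best r K v}, (r j - optReward r K Finset.univ v)

/-- The reward gap `Δ_i`. -/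
noncomputable def gap {N : ℕ} (r : Fin N → ℝ) (K : ℕ) (v : Fin N → ℝ) (i : Fin N) : ℝ :=
  if i ∈ best r K v then innerGap r K v
  else if (best r K v).card = K then advantageRank r K v K - advantage r K v i
  else - advantage r K v i

noncomputable def H₁ {N : ℕ} (r : Fin N → ℝ) (K : ℕ) (v : Fin N → ℝ) : ℝ :=
  ∑ i, 1 / gap r K v i ^ 2

noncomputable def H₂ {N : ℕ} (r : Fin N → ℝ) (K : ℕ) (v : Fin N → ℝ) : ℝ :=
  (∑ i, (v i + 1 / K) / gap r K v i ^ 2) + ⨆ i, 1 / gap r K v i ^ 2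

/-- `Γ = K² H₂ ln ((N/δ) ln (K H₂))`. -/
noncomputable def pullBound {N : ℕ} (r : Fin N → ℝ) (K : ℕ) (v : Fin N → ℝ) (δ : ℝ) : ℝ :=
  (K : ℝ) ^ 2 * H₂ r K v * Real.log ((N / δ) * Real.log (K * H₂ r K v))

/-- `N Γ + N² ln N ln (K / min_i Δ_i)`. -/
noncomputable def timeBound {N : ℕ} (r : Fin N → ℝ) (K : ℕ) (v : Fin N → ℝ) (δ : ℝ) : ℝ :=
  N * pullBound r K v δ + (N : ℝ) ^ 2 * Real.log N * Real.log (K / ⨅ i, gap r K v i)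

/-- MNL feedback on a probability space: `X t S` is the choice that the user of the `t`-th pull
makes when offered `S`. Different pulls are independent, and each choice from an assortment that
respects the capacity follows the MNL model. (Nothing is assumed on the joint law of the choices
of one user from different assortments, since only one of them is observed.) -/
structure IsFeedback {N : ℕ} {Ω : Type*} [MeasurableSpace Ω] (μ : Measure Ω) (K : ℕ)
    (v : Fin N → ℝ) (X : ℕ → Finset (Fin N) → Ω → Option (Fin N)) : Prop where
  measurable : ∀ t S x, MeasurableSet {ω | X t S ω = x}
  indep : iIndepFun (m := fun _ : ℕ => (⊤ : MeasurableSpace (Finset (Fin N) → Option (Fin N))))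
    (fun t ω S => X t S ω) μ
  law : ∀ t S x, S.card ≤ K → μ {ω | X t S ω = x} = ENNReal.ofReal (choiceProb v S x)

/-! ### The pruning rule -/

/-- Items of `I` that are among the `K` items with the largest values `(r_i - θ) w_i` and satisfy
`r_i > θ`. An item qualifies when fewer than `K` items have a strictly larger value. -/
noncomputable def top {N : ℕ} (r : Fin N → ℝ) (K : ℕ) (I : Finset (Fin N)) (w : Fin N → ℝ)
    (θ : ℝ) : Finset (Fin N) :=
  I.filter fun i => θ < r i ∧
    (I.filter fun j => (r i - θ) * w i < (r j - θ) * w j).card < K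

open Classical in
/-- The pruning rule: keep `i` if it is a top item for some `θ` in `[θ_a, θ_b]`, when item `i` has
preference `b i` and every other item `j` has preference `a j`. -/
noncomputable def prune {N : ℕ} (r : Fin N → ℝ) (K : ℕ) (I : Finset (Fin N)) (a b : Fin N → ℝ) :
    Finset (Fin N) :=
  I.filter fun i => ∃ θ : ℝ, optReward r K I a ≤ θ ∧ θ ≤ optReward r K I b ∧
    i ∈ top r K I (Function.update a i (b i)) θ

/-! ### Computations with a step count

The model is the unit-cost real RAM: reading or writing a memory cell (an array entry, or a cell of
a linked list), an arithmetic operation on real or integer numbers (including logarithm and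
rounding), and a comparison each cost one step. Arrays indexed by the items are functions on
`Fin N`. -/

/-- A value together with the number of steps spent on computing it. -/
structure Timed (α : Type) where
  val : α
  cost : ℕ

instance : Monad Timed where
  pure x := ⟨x, 0⟩
  bind x f := ⟨(f x.val).val, x.cost + (f x.val).cost⟩

/-- Evaluation of an expression made of (at most) `k` elementary operations. -/
def step {α : Type} (k : ℕ) (x : α) : Timed α := ⟨x, k⟩

/-- Traversal of a list, from its end. -/
def foldT {α β : Type} (f : α → β → Timed β) (init : β) : List α → Timed β
  | [] => step 1 init
  | x :: l => do
      let y ← foldT f init l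
      let y ← f x y
      step 2 y

def filterT {α : Type} (p : α → Timed Bool) (l : List α) : Timed (List α) :=
  foldT (fun x acc => do if ← p x then step 2 (x :: acc) else step 1 acc) [] l

def takeT {α : Type} : ℕ → List α → Timed (List α)
  | 0, _ => step 1 []
  | _ + 1, [] => step 2 []
  | k + 1, x :: l => do
      let l' ← takeT k l
      step 4 (x :: l')

/-- Distributes a list alternately over two lists. -/
def splitT {α : Type} : List α → Timed (List α × List α)
  | [] => step 1 ([], [])
  | [x] => step 2 ([x], [])
  | x :: y :: l => do
      let s ← splitT l
      step 6 (x :: s.1, y :: s.2)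

theorem splitT_length {α : Type} : ∀ l : List α,
    (splitT l).val.1.length + (splitT l).val.2.length = l.length
  | [] => rfl
  | [_] => rfl
  | _ :: _ :: l => by
      have h := splitT_length l
      simp only [splitT, bind, step, List.length_cons]
      omega

def mergeT {α : Type} (le : α → α → Timed Bool) : List α → List α → Timed (List α)
  | [], ys => step 2 ys
  | x :: xs, [] => step 2 (x :: xs)
  | x :: xs, y :: ys => do
      if ← le x y then
        let l ← mergeT le xs (y :: ys)
        step 5 (x :: l)
      else
        let l ← mergeT le (x :: xs) ys
        step 5 (y :: l)
termination_by xs ys => xs.length + ys.length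

/-- Merge sort. -/
def sortT {α : Type} (le : α → α → Timed Bool) : List α → Timed (List α)
  | [] => step 1 []
  | [x] => step 2 [x]
  | x :: y :: l => do
      let s := splitT l
      step (s.cost + 6) ()
      let xs ← sortT le (x :: s.val.1)
      let ys ← sortT le (y :: s.val.2)
      mergeT le xs ys
termination_by l => l.length
decreasing_by
  all_goals
    have h := splitT_length l
    simp only [List.length_cons]
    omega

/-- Bisection in a sorted list: shrinks `(lo, hi)` to an interval without list elements inside,
where `ok` holds at the left end and fails at the right end. -/
def searchT (ok : ℝ → Timed Bool) (lo hi : ℝ) (l : List ℝ) : Timed (ℝ × ℝ) :=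
  match h : l.drop (l.length / 2) with
  | [] => step 3 (lo, hi)
  | x :: l₂ => do
      step (4 * l.length + 4) ()
      if ← ok x then searchT ok x hi l₂ else searchT ok lo x (l.take (l.length / 2))
termination_by l.length
decreasing_by
  all_goals
    have h' := congrArg List.length h
    simp only [List.length_drop, List.length_cons, List.length_take] at h' ⊢
    omega

/-- Computes the expected reward of the items of a list. -/
noncomputable def rewardT {N : ℕ} (r w : Fin N → ℝ) (S : List (Fin N)) : Timed ℝ := do
  let s ← foldT (fun i (s : ℝ × ℝ) => step 8 (s.1 + r i * w i, s.2 + w i)) (0, 1) S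
  step 3 (s.1 / s.2)

/-- Expected reward of (up to) `K` items with the largest positive values `(r_i - θ) w_i`. -/
noncomputable def topRewardT {N : ℕ} (r : Fin N → ℝ) (K : ℕ) (I : List (Fin N)) (w : Fin N → ℝ)
    (θ : ℝ) : Timed ℝ := do
  let J ← filterT (fun i => step 2 (decide (θ < r i))) I
  let J ← sortT (fun i j => step 9 (decide ((r j - θ) * w j ≤ (r i - θ) * w i))) J
  let J ← takeT K J
  rewardT r w J

/-- Optimal expected reward: the values `(r_i - θ) w_i` change their order or sign only at the
listed break points, between which the optimum is located by bisection. -/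
noncomputable def optRewardT {N : ℕ} (r : Fin N → ℝ) (K : ℕ) (I : List (Fin N))
    (w : Fin N → ℝ) : Timed ℝ := do
  let P ← foldT (fun i acc =>
      foldT (fun j acc => step 14
        (if w i = w j then acc else (r i * w i - r j * w j) / (w i - w j) :: acc))
        (r i :: acc) I) [] I
  let P ← sortT (fun x y => step 1 (decide (x ≤ y))) P
  let q ← searchT (fun θ => do
    let x ← topRewardT r K I w θ
    step 1 (decide (θ ≤ x))) 0 2 P
  let θ ← step 4 ((q.1 + q.2) / 2)
  topRewardT r K I w θ

/-- Sweep over events `(x, d)` sorted by position: a negative `d` lowers the count from position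
`x` on (inclusively), a positive `d` raises it after position `x`. Reports whether the count drops
below `K` at an event position in `[lo, hi]` that is smaller than `ρ`. -/
noncomputable def sweepT (K : ℕ) (lo hi ρ : ℝ) : ℤ → List (ℝ × ℤ) → Timed Bool
  | _, [] => step 1 false
  | c, e :: es => do
      let c ← step 4 (c + min e.2 0)
      if ← step 8 (decide (lo ≤ e.1 ∧ e.1 ≤ hi ∧ e.1 < ρ ∧ c < K)) then step 1 true
      else
        let c ← step 4 (c + max e.2 0)
        sweepT K lo hi ρ c es

/-- Decides whether item `i` survives: the values `θ` for which item `j` is strictly preferred to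
`i` are given by the linear inequality `θ (a j - b i) < r j * a j - r i * b i`, and a sweep finds
out whether fewer than `K` of them hold for some admissible `θ`. -/
noncomputable def surviveT {N : ℕ} (r : Fin N → ℝ) (K : ℕ) (I : List (Fin N)) (a b : Fin N → ℝ)
    (lo hi : ℝ) (i : Fin N) : Timed Bool := do
  let s ← foldT (fun j (s : ℤ × List (ℝ × ℤ)) => step 30
      (let p := a j - b i
       let q := r j * a j - r i * b i
       if j = i then s
       else if p = 0 then (if 0 < q then (s.1 + 1, s.2) else s)
       else if 0 < p then (s.1 + 1, (q / p, -1) :: s.2)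
       else (s.1, (q / p, 1) :: s.2)))
    (0, [(lo, 0)]) I
  let es ← sortT (fun e e' : ℝ × ℤ =>
    step 7 (decide (e.1 < e'.1 ∨ (e.1 = e'.1 ∧ e.2 ≤ e'.2)))) s.2
  sweepT K lo hi (r i) s.1 es

/-- The implementation of the pruning rule. -/
noncomputable def pruneT {N : ℕ} (r : Fin N → ℝ) (K : ℕ) (I : List (Fin N)) (a b : Fin N → ℝ) :
    Timed (List (Fin N)) := do
  let lo ← optRewardT r K I a
  let hi ← optRewardT r K I b
  filterT (fun i => surviveT r K I a b lo hi i) I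

/-! ### The algorithm -/

/-- What an execution has done so far: the observed choices, latest first, and the number of
elementary steps. -/
structure Ledger (N : ℕ) where
  hist : List (Option (Fin N))
  time : ℕ

/-- Number of pulls. -/
def Ledger.pulls {N : ℕ} (s : Ledger N) : ℕ := s.hist.length

/-- Executions: they keep a ledger. Each unbounded loop is given a maximal number `fuel` of
iterations, and `none` means that some loop has not stopped within it; a result `some _` does not
depend on `fuel`. -/
abbrev Exec (N : ℕ) := StateT (Ledger N) Option

/-- Performs a timed computation and charges its steps. -/
def perform {N : ℕ} {α : Type} (x : Timed α) : Exec N α :=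
  fun s => some (x.val, { s with time := s.time + x.cost })

/-- Offers the assortment `S` to the next user and observes the choice. Here `env t S` is the choice
of the user of pull `t` from `S`; writing down `S` costs `S.length + 1` steps. -/
def pull {N : ℕ} (env : ℕ → Finset (Fin N) → Option (Fin N)) (S : List (Fin N)) :
    Exec N (Option (Fin N)) :=
  fun s => some (env s.pulls S.toFinset,
    { hist := env s.pulls S.toFinset :: s.hist, time := s.time + (S.length + 1) })

/-- Pulls `S` until a no-purchase occurs, counting how often each item of `S` is chosen. -/
def exploreLoop {N : ℕ} (env : ℕ → Finset (Fin N) → Option (Fin N)) (S : List (Fin N)) :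
    ℕ → (Fin N → ℕ) → Exec N (Fin N → ℕ)
  | 0, _ => fun _ => none
  | fuel + 1, f => do
      match ← pull env S with
      | none => perform (step 1 f)
      | some x =>
          let f ← perform (step (2 * S.length + 4)
            (if x ∈ S then Function.update f x (f x + 1) else f))
          exploreLoop env S fuel f

/-- One exploration of the set `S`: the empirical preferences start at `0`. -/
def exploreSet {N : ℕ} (fuel : ℕ) (env : ℕ → Finset (Fin N) → Option (Fin N))
    (S : List (Fin N)) : Exec N (Fin N → ℕ) := do
  let f ← perform (step (S.length + 1) (fun _ => 0))
  exploreLoop env S fuel f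

/-- For each item, the sum of the empirical preferences returned by the explorations that involved
it, and the number of these explorations. -/
structure Stats (N : ℕ) where
  sum : Fin N → ℕ
  calls : Fin N → ℕ

/-- Explores `S` the given number of times. -/
def exploreTimes {N : ℕ} (fuel : ℕ) (env : ℕ → Finset (Fin N) → Option (Fin N))
    (S : List (Fin N)) : ℕ → Stats N → Exec N (Stats N)
  | 0, st => perform (step 1 st)
  | n + 1, st => do
      let f ← exploreSet fuel env S
      let st ← perform (foldT (fun i (st : Stats N) => step 8
        { sum := Function.update st.sum i (st.sum i + f i)
          calls := Function.update st.calls i (st.calls i + 1) }) st S)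
      let st ← perform (step 2 st)
      exploreTimes fuel env S n st

/-- Explores each block of a partition `n` times. -/
def exploreBlocks {N : ℕ} (fuel : ℕ) (env : ℕ → Finset (Fin N) → Option (Fin N)) (n : ℕ) :
    List (List (Fin N)) → Stats N → Exec N (Stats N)
  | [], st => perform (step 1 st)
  | S :: Ss, st => do
      let st ← exploreTimes fuel env S n st
      let st ← perform (step 2 st)
      exploreBlocks fuel env n Ss st

/-- The accuracy `ε_τ = 2^(-τ-3)`. -/
noncomputable def accuracy (τ : ℕ) : ℝ := (1 / 2) ^ (τ + 3)

/-- `T_τ = ⌈(8 / ε_τ²) ln (16 N (τ+1)² / δ)⌉`. -/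
noncomputable def schedule (N : ℕ) (δ : ℝ) (τ : ℕ) : ℕ :=
  ⌈8 / accuracy τ ^ 2 * Real.log (16 * N * ((τ : ℝ) + 1) ^ 2 / δ)⌉₊

/-- `T_τ - T_{τ-1}`, with `T_{-1} = 0`. -/
noncomputable def newCalls (N : ℕ) (δ : ℝ) : ℕ → ℕ
  | 0 => schedule N δ 0
  | τ + 1 => schedule N δ (τ + 1) - schedule N δ τ

/-- A way to choose the partitions: given the choices observed so far and the surviving items `I`,
it splits `I` into `⌈|I| / K⌉` blocks of size at most `K`. -/
def IsPartitionRule {N : ℕ} (K : ℕ)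
    (part : List (Option (Fin N)) → List (Fin N) → List (List (Fin N))) : Prop :=
  ∀ h I, I.Nodup → (part h I).length = ⌈(I.length : ℝ) / K⌉₊ ∧
    (∀ B ∈ part h I, B.length ≤ K) ∧ (part h I).flatten.Perm I

/-- The rounds `τ, τ + 1, …` of the algorithm, with surviving items `I`. Writing down the chosen
partition costs a constant number of steps per item and per block. -/
noncomputable def rounds {N : ℕ} (fuel : ℕ) (env : ℕ → Finset (Fin N) → Option (Fin N))
    (part : List (Option (Fin N)) → List (Fin N) → List (List (Fin N)))
    (r : Fin N → ℝ) (K : ℕ) (δ : ℝ) :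
    ℕ → ℕ → List (Fin N) → Stats N → Exec N (List (Fin N))
  | 0, _, _, _ => fun _ => none
  | k + 1, τ, I, st => do
      let ε ← perform (step 2 (accuracy τ))
      let n ← perform (step 20 (newCalls N δ τ))
      let s ← get
      let Ss ← perform
        (step (2 * I.length + 2 * (part s.hist I).length + 2) (part s.hist I))
      let st ← exploreBlocks fuel env n Ss st
      let ab ← perform (foldT (fun i (ab : (Fin N → ℝ) × (Fin N → ℝ)) => step 12
          (Function.update ab.1 i (max 0 ((st.sum i : ℝ) / st.calls i - ε)),
           Function.update ab.2 i (min ((st.sum i : ℝ) / st.calls i + ε) 1)))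
        ((fun _ => 0), (fun _ => 0)) I)
      let C ← perform (pruneT r K I ab.1 ab.2)
      let R ← perform (rewardT r ab.2 C)
      let above ← perform (foldT (fun i t => step 3 (decide (R < r i) && t)) true C)
      let done ← perform (step (C.length + 2) (decide (C.length ≤ K) && above))
      if done then return C
      else rounds fuel env part r K δ k (τ + 1) C st

/-- The whole algorithm, on the items `0, …, N - 1`. -/
noncomputable def algorithm {N : ℕ} (fuel : ℕ) (env : ℕ → Finset (Fin N) → Option (Fin N))
    (part : List (Option (Fin N)) → List (Fin N) → List (List (Fin N)))
    (r : Fin N → ℝ) (K : ℕ) (δ : ℝ) : Exec N (List (Fin N)) := do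
  let I ← perform (step (2 * N + 1) (List.finRange N))
  let st ← perform (step (2 * N + 1) { sum := fun _ => 0, calls := fun _ => 0 })
  rounds fuel env part r K δ fuel 0 I st

/-- On the feedback `env`, the algorithm stops and returns the items of `C`, and `s` is the ledger
of the whole execution. -/
def Returns {N : ℕ} (env : ℕ → Finset (Fin N) → Option (Fin N))
    (part : List (Option (Fin N)) → List (Fin N) → List (List (Fin N)))
    (r : Fin N → ℝ) (K : ℕ) (δ : ℝ) (C : List (Fin N)) (s : Ledger N) : Prop :=
  ∃ fuel, (algorithm fuel env part r K δ).run { hist := [], time := 0 } = some (C, s)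

end MNL

/-
For `y` near `1`, and whatever assortments are offered, `y ^ f * (1 + v_i * (1 - y)) ^ q` is a
martingale, where `f` counts the choices of item `i` and `q` the no-purchases while `i` is offered.
At the exploration numbers `q = T_τ`, the weights with `y = exp (± ε_τ / 4)` are large if the
empirical preference of `i` is off by more than `ε_τ`; divided by `16 N (τ + 1)² / δ` and summed
over rounds, items and both signs they start below `δ`. Hence with probability `1 - δ` all
empirical preferences are accurate in all rounds.

On this event `a ≤ v ≤ b`, so that `θ_a ≤ θ_v ≤ θ_b`, and `θ = θ_v` witnesses that no item of `S_v`
is pruned. Moreover `θ_b - θ_a` and the errors of the `(r_i - θ) w_i` are `O(K ε_τ)`, and therefore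
an item outside `S_v` survives only if its gap is `O(K ε_τ)`, while round `τ + 1` is entered only
if some gap is `O(K ε_τ)`. An exploration of a block takes one no-purchase and `f_i` choices of
each item `i`; charging `i` with `f_i` and the share `1 / K` of the no-purchase gives about
`T_τ (v_i + 1 / K)` for the last round `τ` of item `i`, of order `K² (v_i + 1 / K) / Δ_i²` up to the
logarithm. The blocks that are not full are paid for by the maximum in `H₂`.

The optimal reward is the largest `θ` that is at most the sum of the `K` largest positive parts
`((r_i - θ) w_i)⁺`, and the greedy choice behind this sum changes only at the `O(N²)` points where
two of these values agree or one vanishes; these are sorted once and then bisected. Survival of an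
item is a question on the number of linear inequalities in `θ` that hold simultaneously, which a
sweep over their sorted zeros answers. A round thus takes `O(N² log N)` steps apart from the pulls.
-/

namespace MNL

namespace Timed

variable {α β : Type}

@[simp]
theorem val_bind (x : Timed α) (f : α → Timed β) : (x >>= f).val = (f x.val).val := rfl

@[simp]
theorem cost_bind (x : Timed α) (f : α → Timed β) :
    (x >>= f).cost = x.cost + (f x.val).cost := rfl

end Timed

section ListProcedures

variable {α β : Type}

@[simp]
theorem val_step (k : ℕ) (x : α) : (step k x).val = x := rfl

@[simp]
theorem cost_step (k : ℕ) (x : α) : (step k x).cost = k := rfl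

theorem foldT_val (f : α → β → Timed β) (init : β) (l : List α) :
    (foldT f init l).val = l.foldr (fun x y => (f x y).val) init := by
  induction l with
  | nil => rfl
  | cons x l ih => simp [foldT, ih]

theorem foldT_cost_le (f : α → β → Timed β) (init : β) {l : List α} {c : ℕ}
    (hc : ∀ x ∈ l, ∀ y, (f x y).cost ≤ c) : (foldT f init l).cost ≤ (c + 2) * l.length + 1 := by
  induction l with
  | nil => simp [foldT]
  | cons x l ih =>
    have hl := ih fun x hx => hc x (List.mem_cons_of_mem _ hx)
    have hx := hc x List.mem_cons_self (foldT f init l).val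
    simp only [foldT, Timed.cost_bind, cost_step, List.length_cons]
    linarith

theorem filterT_val (p : α → Timed Bool) (l : List α) :
    (filterT p l).val = l.filter fun x => (p x).val := by
  rw [filterT, foldT_val]
  induction l with
  | nil => rfl
  | cons x l ih =>
    rw [List.foldr_cons, ih]
    cases h : (p x).val <;> simp [h]

theorem filterT_cost_le {p : α → Timed Bool} {l : List α} {c : ℕ}
    (hc : ∀ x ∈ l, (p x).cost ≤ c) : (filterT p l).cost ≤ (c + 4) * l.length + 1 := by
  refine foldT_cost_le (c := c + 2) _ _ fun x hx y => ?_
  have := hc x hx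
  cases h : (p x).val <;> simp [h] <;> omega

theorem takeT_val : ∀ (k : ℕ) (l : List α), (takeT k l).val = l.take k
  | 0, _ => by simp [takeT]
  | _ + 1, [] => by simp [takeT]
  | k + 1, x :: l => by simp [takeT, takeT_val k l]

theorem takeT_cost_le : ∀ (k : ℕ) (l : List α), (takeT k l).cost ≤ 4 * l.length + 2
  | 0, _ => by simp [takeT]
  | _ + 1, [] => by simp [takeT]
  | k + 1, x :: l => by
    have := takeT_cost_le k l
    simp only [takeT, Timed.cost_bind, cost_step, List.length_cons]
    omega

theorem splitT_perm : ∀ l : List α, ((splitT l).val.1 ++ (splitT l).val.2).Perm l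
  | [] => by simp [splitT]
  | [x] => by simp [splitT]
  | x :: y :: l => (List.perm_middle.trans ((splitT_perm l).cons y)).cons x

theorem length_splitT_fst : ∀ l : List α, (splitT l).val.1.length = (l.length + 1) / 2
  | [] => by simp [splitT]
  | [x] => by simp [splitT]
  | x :: y :: l => by
    have := length_splitT_fst l
    simp only [splitT, Timed.val_bind, val_step, List.length_cons]
    omega

theorem splitT_cost_le : ∀ l : List α, (splitT l).cost ≤ 3 * l.length + 1
  | [] => by simp [splitT]
  | [x] => by simp [splitT]
  | x :: y :: l => by
    have := splitT_cost_le l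
    simp only [splitT, Timed.cost_bind, cost_step, List.length_cons]
    omega

variable (le : α → α → Timed Bool)

theorem mergeT_val (xs ys : List α) :
    (mergeT le xs ys).val = xs.merge ys fun x y => (le x y).val := by
  fun_induction mergeT le xs ys with
  | case1 ys => simp
  | case2 x xs => simp
  | case3 x xs y ys ih₁ ih₂ => cases h : (le x y).val <;> simp [h, ih₁, ih₂]

theorem mergeT_cost_le {c : ℕ} (hc : ∀ x y, (le x y).cost ≤ c) (xs ys : List α) :
    (mergeT le xs ys).cost ≤ (c + 5) * (xs.length + ys.length) + 2 := by
  fun_induction mergeT le xs ys with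
  | case1 ys => simp
  | case2 x xs => simp
  | case3 x xs y ys ih₁ ih₂ =>
    have := hc x y
    cases h : (le x y).val <;>
      simp only [Timed.cost_bind, h, if_true, if_false, cost_step, Bool.false_eq_true,
        List.length_cons] at ih₁ ih₂ ⊢ <;> linarith

theorem sortT_perm (l : List α) : (sortT le l).val.Perm l := by
  fun_induction sortT le l with
  | case1 => simp
  | case2 x => simp
  | case3 x y l s ih₁ ih₂ =>
    simp only [Timed.val_bind, mergeT_val]
    refine (List.merge_perm_append _).trans ((ih₁.append ih₂).trans ?_)
    exact (List.perm_middle.trans ((splitT_perm l).cons y)).cons x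

theorem sortT_pairwise {R : α → α → Prop} (hle : ∀ x y, (le x y).val = true ↔ R x y)
    (htotal : ∀ x y, R x y ∨ R y x) (htrans : ∀ x y z, R x y → R y z → R x z) (l : List α) :
    (sortT le l).val.Pairwise R := by
  simp only [← hle] at htotal htrans
  refine List.Pairwise.imp (fun {x y} => (hle x y).1) ?_
  fun_induction sortT le l with
  | case1 => simp
  | case2 x => simp
  | case3 x y l s ih₁ ih₂ =>
    simp only [Timed.val_bind, mergeT_val]
    exact List.pairwise_merge htrans (fun x y => by simpa using htotal x y) _ _ ih₁ ih₂

theorem clog_two_add_two (n : ℕ) : Nat.clog 2 (n + 2) = Nat.clog 2 ((n + 1) / 2 + 1) + 1 := by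
  rw [Nat.clog_of_two_le one_lt_two (by omega)]
  congr 2
  omega

theorem sortT_cost_le {c : ℕ} (hc : ∀ x y, (le x y).cost ≤ c) (l : List α) :
    (sortT le l).cost ≤ (c + 11) * (l.length * Nat.clog 2 l.length) + 2 * l.length + 1 := by
  fun_induction sortT le l with
  | case1 => simp
  | case2 x => simp
  | case3 x y l s ih₁ ih₂ =>
    have hfst := length_splitT_fst l
    have hsplit := splitT_cost_le l
    have hmerge :=
      mergeT_cost_le le hc (sortT le (x :: s.val.1)).val (sortT le (y :: s.val.2)).val
    rw [(sortT_perm le _).length_eq, (sortT_perm le _).length_eq] at hmerge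
    simp only [Timed.cost_bind, cost_step, List.length_cons, s] at ih₁ ih₂ hmerge ⊢
    set m := (splitT l).val.1.length
    set k := (splitT l).val.2.length
    have hlen : m + k = l.length := splitT_length l
    have hclog : Nat.clog 2 (l.length + 1 + 1) = Nat.clog 2 (m + 1) + 1 := by
      rw [hfst]
      exact clog_two_add_two _
    have hsnd : (c + 11) * ((k + 1) * Nat.clog 2 (k + 1)) ≤
        (c + 11) * ((k + 1) * Nat.clog 2 (m + 1)) := by
      gcongr
      omega
    rw [hclog, ← hlen]
    rw [← hlen] at hsplit
    linarith

end ListProcedures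

section Bisection

variable (ok : ℝ → Timed Bool)

theorem searchT_cost_le {c : ℕ} (hc : ∀ x, (ok x).cost ≤ c) (lo hi : ℝ) (l : List ℝ) :
    (searchT ok lo hi l).cost ≤
      8 * l.length + (c + 4) * Nat.clog 2 (l.length + 1) + 3 := by
  fun_induction searchT ok lo hi l with
  | case1 => simp
  | case2 _ _ l x l₂ h ih₁ ih₂ =>
    have hlen := congrArg List.length h
    simp only [List.length_drop, List.length_cons] at hlen
    have hhalf (m : ℕ) (hm : m ≤ l.length / 2) :
        8 * m + (c + 4) * Nat.clog 2 (m + 1) + (c + 4) ≤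
          4 * l.length + (c + 4) * Nat.clog 2 (l.length + 1) := by
      obtain ⟨n, hn⟩ : ∃ n, l.length = n + 1 := ⟨l.length - 1, by omega⟩
      have hclog : Nat.clog 2 (m + 1) + 1 ≤ Nat.clog 2 (l.length + 1) := by
        rw [hn, clog_two_add_two, ← hn]
        gcongr
      have := Nat.mul_le_mul_left (c + 4) hclog
      rw [Nat.mul_add] at this
      omega
    have hx := hc x
    cases hok : (ok x).val
    · have := hhalf (l.take (l.length / 2)).length (by simp)
      simp only [Timed.cost_bind, cost_step, hok, if_false, Bool.false_eq_true]
      omega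
    · have := hhalf l₂.length (by omega)
      simp only [Timed.cost_bind, cost_step, hok, if_true]
      omega

theorem searchT_fst_mem (lo hi : ℝ) (l : List ℝ) : (searchT ok lo hi l).val.1 ∈ lo :: l := by
  fun_induction searchT ok lo hi l with
  | case1 => simp
  | case2 lo _ l x l₂ h ih₁ ih₂ =>
    have hsub : x :: l₂ ⊆ l := h ▸ List.drop_subset _ _
    cases hok : (ok x).val
    · simpa [hok] using List.cons_subset_cons lo (List.take_subset _ _) ih₂
    · simpa [hok] using List.mem_cons_of_mem lo (hsub ih₁)

theorem searchT_snd_mem (lo hi : ℝ) (l : List ℝ) : (searchT ok lo hi l).val.2 ∈ hi :: l := by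
  fun_induction searchT ok lo hi l with
  | case1 => simp
  | case2 _ hi l x l₂ h ih₁ ih₂ =>
    have hsub : x :: l₂ ⊆ l := h ▸ List.drop_subset _ _
    cases hok : (ok x).val
    · have : x :: l.take (l.length / 2) ⊆ l :=
        List.cons_subset.2 ⟨hsub List.mem_cons_self, List.take_subset _ _⟩
      simpa [hok] using List.mem_cons_of_mem hi (this ih₂)
    · have : hi :: l₂ ⊆ hi :: l := List.cons_subset_cons hi (List.subset_of_cons_subset hsub)
      simpa [hok] using this ih₁

theorem searchT_brackets {ok : ℝ → Timed Bool} {θ : ℝ} (hok : ∀ x, (ok x).val = true ↔ x ≤ θ)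
    {lo hi : ℝ} (hlo : lo ≤ θ) (hhi : θ < hi) (l : List ℝ) :
    (searchT ok lo hi l).val.1 ≤ θ ∧ θ < (searchT ok lo hi l).val.2 := by
  fun_induction searchT ok lo hi l with
  | case1 => exact ⟨hlo, hhi⟩
  | case2 lo hi _ x l₂ _ ih₁ ih₂ =>
    rcases le_or_gt x θ with hx | hx
    · simpa [(hok x).2 hx] using ih₁ hx hhi
    · simpa [Bool.eq_false_iff.2 (mt (hok x).1 hx.not_ge)] using ih₂ hlo hx

theorem searchT_separates (lo hi : ℝ) {l : List ℝ} (hl : l.Pairwise (· ≤ ·)) :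
    ∀ x ∈ l, x ≤ (searchT ok lo hi l).val.1 ∨ (searchT ok lo hi l).val.2 ≤ x := by
  fun_induction searchT ok lo hi l with
  | case1 lo hi l h =>
    have hlen := congrArg List.length h
    rw [List.length_drop, List.length_nil] at hlen
    simp [List.eq_nil_of_length_eq_zero (l := l) (by omega)]
  | case2 lo hi l x l₂ h ih₁ ih₂ =>
    intro z hz
    rw [← List.take_append_drop (l.length / 2) l, h] at hl hz
    obtain ⟨hleft, hright, hcross⟩ := List.pairwise_append.1 hl
    obtain ⟨hxl, hl₂⟩ := List.pairwise_cons.1 hright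
    cases hok : (ok x).val
    · simp only [Timed.val_bind, hok, if_false, Bool.false_eq_true]
      rcases List.mem_append.1 hz with hz | hz
      · exact ih₂ hleft z hz
      · have hxz : x ≤ z := (List.mem_cons.1 hz).elim (fun h => h.ge) (hxl z)
        refine .inr (le_trans ?_ hxz)
        rcases List.mem_cons.1 (searchT_snd_mem ok lo x (l.take (l.length / 2))) with h | h
        · exact h.le
        · exact hcross _ h x List.mem_cons_self
    · simp only [Timed.val_bind, hok, if_true]
      rcases List.mem_append.1 hz with hz | hz
      · refine .inl ((hcross z hz x List.mem_cons_self).trans ?_)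
        rcases List.mem_cons.1 (searchT_fst_mem ok x hi l₂) with h | h
        · exact h.ge
        · exact hxl _ h
      · rcases List.mem_cons.1 hz with rfl | hz
        · left
          rcases List.mem_cons.1 (searchT_fst_mem ok z hi l₂) with h | h
          · exact h.ge
          · exact hxl _ h
        · exact ih₁ hl₂ z hz

end Bisection

section Sweep

/-- The change of the count of `sweepT` that the event `e` has caused by the time the sweep is at
position `θ`. In the lexicographic order this is the full change of `e` if `e ≤ (θ, 0)`, and no
change otherwise. -/
noncomputable def eventCount (θ : ℝ) (e : ℝ × ℤ) : ℤ :=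
  if toLex e ≤ toLex (θ, 0) then e.2 else 0

theorem eventCount_le_snd {θ : ℝ} {e : ℝ × ℤ} (h : e.1 ≤ θ) : eventCount θ e ≤ e.2 := by
  rw [eventCount]
  split_ifs with hlex
  · exact le_rfl
  · rw [Prod.Lex.toLex_le_toLex, not_or, not_and] at hlex
    exact (not_le.1 (hlex.2 (h.eq_or_lt.resolve_right hlex.1))).le

theorem eventCount_nonpos {θ : ℝ} {e : ℝ × ℤ} (h : θ ≤ e.1) : eventCount θ e ≤ 0 := by
  rw [eventCount]
  split_ifs with hlex
  · exact ((Prod.Lex.toLex_le_toLex.1 hlex).resolve_left h.not_gt).2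
  · exact le_rfl

theorem eventCount_fst (e : ℝ × ℤ) : eventCount e.1 e = min e.2 0 := by
  have hiff : toLex e ≤ toLex (e.1, 0) ↔ e.2 ≤ 0 := by simp [Prod.Lex.toLex_le_toLex]
  simp only [eventCount, hiff, min_def]

theorem sum_map_eventCount_le {e : ℝ × ℤ} {l₁ l₂ : List (ℝ × ℤ)} (h₁ : ∀ x ∈ l₁, x.1 ≤ e.1)
    (h₂ : ∀ x ∈ l₂, e.1 ≤ x.1) :
    ((l₁ ++ e :: l₂).map (eventCount e.1)).sum ≤ (l₁.map Prod.snd).sum + min e.2 0 := by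
  have before : (l₁.map (eventCount e.1)).sum ≤ (l₁.map Prod.snd).sum :=
    List.sum_le_sum fun x hx => eventCount_le_snd (h₁ x hx)
  have after : (l₂.map (eventCount e.1)).sum ≤ (l₂.map fun _ => (0 : ℤ)).sum :=
    List.sum_le_sum fun x hx => eventCount_nonpos (h₂ x hx)
  simp only [List.map_append, List.map_cons, List.sum_append, List.sum_cons, List.map_const',
    List.sum_replicate, smul_zero, eventCount_fst] at after ⊢
  linarith

theorem exists_eq_append_of_pairwise {α : Type*} {R : α → α → Prop} {p : α → Prop}
    (hp : ∀ x y, R x y → p y → p x) {l : List α} (hl : l.Pairwise R) :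
    ∃ l₁ l₂, l = l₁ ++ l₂ ∧ (∀ x ∈ l₁, p x) ∧ ∀ x ∈ l₂, ¬p x := by
  induction l with
  | nil => exact ⟨[], [], by simp⟩
  | cons a l ih =>
    obtain ⟨ha, hl⟩ := List.pairwise_cons.1 hl
    by_cases h : p a
    · obtain ⟨l₁, l₂, rfl, h₁, h₂⟩ := ih hl
      exact ⟨a :: l₁, l₂, rfl, List.forall_mem_cons.2 ⟨h, h₁⟩, h₂⟩
    · exact ⟨[], a :: l, rfl, by simp,
        List.forall_mem_cons.2 ⟨h, fun x hx => mt (hp a x (ha x hx)) h⟩⟩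

theorem exists_sum_le_sum_map_eventCount {lo θ : ℝ} (hθ : lo ≤ θ) {es : List (ℝ × ℤ)}
    (hes : es.Pairwise fun e e' => toLex e ≤ toLex e') (hlo : (lo, 0) ∈ es) :
    ∃ l₁ e l₂, es = l₁ ++ e :: l₂ ∧ lo ≤ e.1 ∧ e.1 ≤ θ ∧
      (l₁.map Prod.snd).sum + min e.2 0 ≤ (es.map (eventCount θ)).sum := by
  obtain ⟨l, l₂, rfl, hl, hl₂⟩ := exists_eq_append_of_pairwise
    (p := fun e => toLex e ≤ toLex (θ, 0)) (fun _ _ h h' => h.trans h') hes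
  have hmem : (lo, 0) ∈ l := (List.mem_append.1 hlo).resolve_right fun h =>
    hl₂ _ h (Prod.Lex.toLex_le_toLex.2 (hθ.lt_or_eq.imp_right fun h => ⟨h, le_rfl⟩))
  obtain ⟨l₁, e, rfl⟩ : ∃ l₁ e, l = l₁ ++ [e] := (List.eq_nil_or_concat l).resolve_left
    (List.ne_nil_of_mem hmem) |>.imp fun _ => by simp
  have hle : toLex (lo, 0) ≤ toLex e := by
    rcases List.mem_append.1 hmem with h | h
    · exact (List.pairwise_append.1 (List.pairwise_append.1 hes).1).2.2 _ h e
        (List.mem_singleton_self e)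
    · rw [List.mem_singleton.1 h]
  have fst_mono {x y : ℝ × ℤ} (h : toLex x ≤ toLex y) : x.1 ≤ y.1 :=
    Prod.Lex.monotone_fst _ _ h
  refine ⟨l₁, e, l₂, by simp, fst_mono hle, fst_mono (hl e (by simp)), ?_⟩
  have before : (l₁ ++ [e]).map (eventCount θ) = (l₁ ++ [e]).map Prod.snd :=
    List.map_congr_left fun x hx => if_pos (hl x hx)
  have after : l₂.map (eventCount θ) = l₂.map fun _ => 0 :=
    List.map_congr_left fun x hx => if_neg (hl₂ x hx)
  rw [List.map_append, before, after]
  simp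

theorem sweepT_eq_true_iff_exists_append (K : ℕ) (lo hi ρ : ℝ) (c : ℤ) (es : List (ℝ × ℤ)) :
    (sweepT K lo hi ρ c es).val = true ↔ ∃ l₁ e l₂, es = l₁ ++ e :: l₂ ∧ lo ≤ e.1 ∧ e.1 ≤ hi ∧
      e.1 < ρ ∧ c + (l₁.map Prod.snd).sum + min e.2 0 < K := by
  induction es generalizing c with
  | nil => simp [sweepT]
  | cons e es ih =>
    simp only [sweepT, Timed.val_bind, val_step]
    by_cases h : lo ≤ e.1 ∧ e.1 ≤ hi ∧ e.1 < ρ ∧ c + min e.2 0 < K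
    · simp only [h, and_self, decide_true, if_true, val_step, true_iff]
      exact ⟨[], e, es, rfl, h.1, h.2.1, h.2.2.1, by simpa using h.2.2.2⟩
    · simp only [h, decide_false, Bool.false_eq_true, if_false, Timed.val_bind, val_step, ih]
      have hc (s : ℤ) : c + min e.2 0 + max e.2 0 + s = c + (e.2 + s) := by
        rw [add_assoc c, min_add_max, add_zero, add_assoc]
      constructor
      · rintro ⟨l₁, e', l₂, rfl, h₁, h₂, h₃, h₄⟩
        exact ⟨e :: l₁, e', l₂, rfl, h₁, h₂, h₃, by simpa [hc] using h₄⟩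
      · rintro ⟨l₁, e', l₂, heq, h₁, h₂, h₃, h₄⟩
        rcases List.cons_eq_append_iff.1 heq with ⟨rfl, heq⟩ | ⟨l₁, rfl, rfl⟩
        · obtain ⟨rfl, rfl⟩ := List.cons.inj heq
          exact absurd ⟨h₁, h₂, h₃, by simpa using h₄⟩ h
        · exact ⟨l₁, e', l₂, rfl, h₁, h₂, h₃, by simpa [hc] using h₄⟩

theorem sweepT_eq_true_iff (K : ℕ) {lo : ℝ} (hi ρ : ℝ) (c : ℤ) {es : List (ℝ × ℤ)}
    (hes : es.Pairwise fun e e' => toLex e ≤ toLex e') (hlo : (lo, 0) ∈ es) :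
    (sweepT K lo hi ρ c es).val = true ↔
      ∃ θ, lo ≤ θ ∧ θ ≤ hi ∧ θ < ρ ∧ c + (es.map (eventCount θ)).sum < K := by
  rw [sweepT_eq_true_iff_exists_append]
  constructor
  · rintro ⟨l₁, e, l₂, rfl, h₁, h₂, h₃, h₄⟩
    obtain ⟨-, hright, hcross⟩ := List.pairwise_append.1 hes
    have := sum_map_eventCount_le (e := e)
      (fun x hx => Prod.Lex.monotone_fst _ _ (hcross x hx e List.mem_cons_self))
      (fun x hx => Prod.Lex.monotone_fst _ _ ((List.pairwise_cons.1 hright).1 x hx))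
    exact ⟨e.1, h₁, h₂, h₃, by linarith⟩
  · rintro ⟨θ, h₁, h₂, h₃, h₄⟩
    obtain ⟨l₁, e, l₂, heq, hloe, heθ, hsum⟩ := exists_sum_le_sum_map_eventCount h₁ hes hlo
    exact ⟨l₁, e, l₂, heq, hloe, heθ.trans h₂, heθ.trans_lt h₃, by linarith⟩

theorem sweepT_cost_le (K : ℕ) (lo hi ρ : ℝ) (c : ℤ) (es : List (ℝ × ℤ)) :
    (sweepT K lo hi ρ c es).cost ≤ 16 * es.length + 1 := by
  induction es generalizing c with
  | nil => simp [sweepT]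
  | cons e es ih =>
    have := ih (c + min e.2 0 + max e.2 0)
    simp only [sweepT, Timed.cost_bind, cost_step, val_step, List.length_cons]
    by_cases h : lo ≤ e.1 ∧ e.1 ≤ hi ∧ e.1 < ρ ∧ c + min e.2 0 < K
    · simp only [h, and_self, decide_true, if_true, cost_step]
      omega
    · simp only [h, decide_false, Bool.false_eq_true, if_false, Timed.cost_bind, cost_step,
        val_step]
      omega

end Sweep

/-! ### Optimal rewards and the pruning rule -/

section Greedy

variable {ι : Type*} {K : ℕ} {I S : Finset ι} {g : ι → ℝ}

/-- `S` consists of the items of `I` with the `K` largest values of `g`, as far as these are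
positive: such a set maximises the sum of `g`. Items with value zero may be present or absent. -/
structure IsGreedy (K : ℕ) (I : Finset ι) (g : ι → ℝ) (S : Finset ι) : Prop where
  subset : S ⊆ I
  card_le : S.card ≤ K
  nonneg : ∀ i ∈ S, 0 ≤ g i
  nonpos_or_le : ∀ i ∈ I, i ∉ S → g i ≤ 0 ∨ (S.card = K ∧ ∀ j ∈ S, g i ≤ g j)

theorem card_sdiff_le_card_sdiff [DecidableEq ι] {s t : Finset ι} (h : s.card ≤ t.card) :
    (s \ t).card ≤ (t \ s).card := by
  have hst := Finset.card_sdiff_add_card_inter s t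
  have hts := Finset.card_sdiff_add_card_inter t s
  rw [Finset.inter_comm] at hts
  omega

theorem IsGreedy.sum_sdiff_le [DecidableEq ι] (h : IsGreedy K I g S) {S' : Finset ι} (hI : S' ⊆ I)
    (hK : S'.card ≤ K) : ∑ i ∈ S' \ S, g i ≤ ∑ i ∈ S \ S', g i := by
  have hnonneg : ∀ i ∈ S \ S', 0 ≤ g i := fun i hi => h.nonneg i (Finset.mem_sdiff.1 hi).1
  by_cases hneg : ∀ i ∈ S' \ S, g i ≤ 0
  · exact (Finset.sum_nonpos hneg).trans (Finset.sum_nonneg hnonneg)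
  · push Not at hneg
    obtain ⟨i₀, hi₀, hpos⟩ := hneg
    have hi₀' := Finset.mem_sdiff.1 hi₀
    have hSK := ((h.nonpos_or_le i₀ (hI hi₀'.1) hi₀'.2).resolve_left hpos.not_ge).1
    have hcard := card_sdiff_le_card_sdiff (hK.trans_eq hSK.symm)
    obtain ⟨m, hm, hmin⟩ := Finset.exists_min_image (S \ S') g
      (Finset.card_pos.1 ((Finset.card_pos.2 ⟨i₀, hi₀⟩).trans_le hcard))
    have hle : ∀ i ∈ S' \ S, g i ≤ g m := fun i hi => by
      rw [Finset.mem_sdiff] at hi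
      rcases h.nonpos_or_le i (hI hi.1) hi.2 with hi | ⟨-, hi⟩
      · exact hi.trans (hnonneg m hm)
      · exact hi m (Finset.mem_sdiff.1 hm).1
    calc ∑ i ∈ S' \ S, g i
      _ ≤ (S' \ S).card • g m := Finset.sum_le_card_nsmul _ _ _ hle
      _ ≤ (S \ S').card • g m := nsmul_le_nsmul_left (hnonneg m hm) hcard
      _ ≤ ∑ i ∈ S \ S', g i := Finset.card_nsmul_le_sum _ _ _ hmin

theorem IsGreedy.sum_le (h : IsGreedy K I g S) {S' : Finset ι} (hI : S' ⊆ I)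
    (hK : S'.card ≤ K) : ∑ i ∈ S', g i ≤ ∑ i ∈ S, g i := by
  classical
  rw [← Finset.sum_inter_add_sum_sdiff S' S, ← Finset.sum_inter_add_sum_sdiff S S',
    Finset.inter_comm S']
  exact add_le_add_right (h.sum_sdiff_le hI hK) _

theorem isGreedy_toFinset_take [DecidableEq ι] {J : List ι} (hJ : J.Nodup)
    (hsort : J.Pairwise fun i j => g j ≤ g i) (hJI : ∀ i ∈ J, i ∈ I) (hnonneg : ∀ i ∈ J, 0 ≤ g i)
    (hpos : ∀ i ∈ I, 0 < g i → i ∈ J) : IsGreedy K I g (J.take K).toFinset where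
  subset i hi := hJI i (List.mem_of_mem_take (List.mem_toFinset.1 hi))
  card_le := (List.toFinset_card_le _).trans (List.length_take_le _ _)
  nonneg i hi := hnonneg i (List.mem_of_mem_take (List.mem_toFinset.1 hi))
  nonpos_or_le i hi hiS := by
    refine or_iff_not_imp_left.2 fun hg => ?_
    rw [← List.take_append_drop K J, List.pairwise_append] at hsort
    have hdrop : i ∈ J.drop K := by
      have hiJ := hpos i hi (not_le.1 hg)
      rw [← List.take_append_drop K J, List.mem_append] at hiJ
      exact hiJ.resolve_left fun h => hiS (List.mem_toFinset.2 h)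
    have hK : K < J.length := by
      have := List.length_pos_of_mem hdrop
      rw [List.length_drop] at this
      omega
    refine ⟨?_, fun j hj => hsort.2.2 j (List.mem_toFinset.1 hj) i hdrop⟩
    rw [List.toFinset_card_of_nodup (hJ.sublist (List.take_sublist _ _)), List.length_take,
      min_eq_left hK.le]

end Greedy

section Reward

variable {N K : ℕ} {r w : Fin N → ℝ} {I S : Finset (Fin N)} {θ : ℝ}

theorem one_add_sum_pos (hw : ∀ i, 0 ≤ w i) (S : Finset (Fin N)) : 0 < 1 + ∑ j ∈ S, w j :=
  add_pos_of_pos_of_nonneg one_pos (Finset.sum_nonneg fun i _ => hw i)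

theorem lt_reward_iff (hw : ∀ i, 0 ≤ w i) :
    θ < reward r w S ↔ θ < ∑ i ∈ S, (r i - θ) * w i := by
  rw [reward, lt_div_iff₀ (one_add_sum_pos hw S)]
  simp only [sub_mul, Finset.sum_sub_distrib, ← Finset.mul_sum]
  rw [mul_add, mul_one, lt_sub_iff_add_lt]

theorem reward_le_iff (hw : ∀ i, 0 ≤ w i) :
    reward r w S ≤ θ ↔ ∑ i ∈ S, (r i - θ) * w i ≤ θ := by
  rw [← not_lt, ← not_lt, lt_reward_iff hw]

theorem le_reward_iff (hw : ∀ i, 0 ≤ w i) :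
    θ ≤ reward r w S ↔ θ ≤ ∑ i ∈ S, (r i - θ) * w i := by
  rw [reward, le_div_iff₀ (one_add_sum_pos hw S)]
  simp only [sub_mul, Finset.sum_sub_distrib, ← Finset.mul_sum]
  rw [mul_add, mul_one, le_sub_iff_add_le]

theorem sum_sub_reward_mul (hw : ∀ i, 0 ≤ w i) :
    ∑ i ∈ S, (r i - reward r w S) * w i = reward r w S :=
  le_antisymm ((reward_le_iff hw).1 le_rfl) ((le_reward_iff hw).1 le_rfl)

theorem mem_feasible : S ∈ feasible K I ↔ S ⊆ I ∧ S.card ≤ K := by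
  simp [feasible]

theorem reward_le_optReward (h : S ⊆ I) (hK : S.card ≤ K) :
    reward r w S ≤ optReward r K I w :=
  Finset.le_sup' (reward r w) (mem_feasible.2 ⟨h, hK⟩)

theorem exists_reward_eq_optReward (r w : Fin N → ℝ) (K : ℕ) (I : Finset (Fin N)) :
    ∃ S ⊆ I, S.card ≤ K ∧ reward r w S = optReward r K I w := by
  obtain ⟨S, hS, h⟩ := Finset.exists_mem_eq_sup' (feasible_nonempty K I) (reward r w)
  exact ⟨S, (mem_feasible.1 hS).1, (mem_feasible.1 hS).2, h.symm⟩

theorem optReward_nonneg (r w : Fin N → ℝ) (K : ℕ) (I : Finset (Fin N)) :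
    0 ≤ optReward r K I w := by
  have := reward_le_optReward (r := r) (w := w) (K := K) I.empty_subset (by simp)
  simpa only [reward, Finset.sum_empty, zero_div] using this

theorem reward_lt_one (hr : ∀ i, r i ≤ 1) (hw : ∀ i, 0 ≤ w i) : reward r w S < 1 := by
  rw [reward, div_lt_one (one_add_sum_pos hw S)]
  have := Finset.sum_le_sum fun i (_ : i ∈ S) => mul_le_of_le_one_left (hw i) (hr i)
  linarith

theorem optReward_lt_one (hr : ∀ i, r i ≤ 1) (hw : ∀ i, 0 ≤ w i) : optReward r K I w < 1 := by
  obtain ⟨S, -, -, h⟩ := exists_reward_eq_optReward r w K I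
  exact h ▸ reward_lt_one hr hw

theorem sum_le_optReward (hw : ∀ i, 0 ≤ w i) (h : S ⊆ I) (hK : S.card ≤ K) :
    ∑ i ∈ S, (r i - optReward r K I w) * w i ≤ optReward r K I w :=
  (reward_le_iff hw).1 (reward_le_optReward h hK)

theorem le_optReward (hw : ∀ i, 0 ≤ w i) (h : S ⊆ I) (hK : S.card ≤ K)
    (hθ : θ ≤ ∑ i ∈ S, (r i - θ) * w i) : θ ≤ optReward r K I w :=
  ((le_reward_iff hw).2 hθ).trans (reward_le_optReward h hK)

theorem IsGreedy.le_reward_iff_le_optReward (hw : ∀ i, 0 ≤ w i)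
    (h : IsGreedy K I (fun i => (r i - θ) * w i) S) :
    θ ≤ reward r w S ↔ θ ≤ optReward r K I w := by
  refine ⟨fun hθ => hθ.trans (reward_le_optReward h.subset h.card_le), fun hθ => ?_⟩
  obtain ⟨S', hS', hK, hopt⟩ := exists_reward_eq_optReward r w K I
  rw [← hopt, le_reward_iff hw] at hθ
  exact (le_reward_iff hw).2 (hθ.trans (h.sum_le hS' hK))

theorem IsGreedy.reward_eq (hw : ∀ i, 0 ≤ w i)
    (h : IsGreedy K I (fun i => (r i - optReward r K I w) * w i) S) :
    reward r w S = optReward r K I w :=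
  le_antisymm (reward_le_optReward h.subset h.card_le)
    ((h.le_reward_iff_le_optReward hw).2 le_rfl)

theorem sub_mul_nonneg_of_notMem_Ioo {lo hi x θ θ' d : ℝ} (hx : x ≤ lo ∨ hi ≤ x)
    (hθ : θ ∈ Set.Ioo lo hi) (hθ' : θ' ∈ Set.Icc lo hi) (h : 0 ≤ (x - θ) * d) :
    0 ≤ (x - θ') * d := by
  rcases hx with hx | hx
  · exact mul_nonneg_of_nonpos_of_nonpos (by linarith [hθ'.1])
      (nonpos_of_mul_nonneg_right h (by linarith [hθ.1]))
  · exact mul_nonneg (by linarith [hθ'.2])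
      (nonneg_of_mul_nonneg_right h (by linarith [hθ.2]))

theorem sub_mul_sub_sub_mul {x y a b θ : ℝ} (h : a ≠ b) :
    (x - θ) * a - (y - θ) * b = ((x * a - y * b) / (a - b) - θ) * (a - b) := by
  linear_combination -(div_mul_cancel₀ (x * a - y * b) (sub_ne_zero.2 h))

theorem IsGreedy.of_no_breakpoint {lo hi θ' : ℝ} (h : IsGreedy K I (fun i => (r i - θ) * w i) S)
    (hθ : θ ∈ Set.Ioo lo hi) (hθ' : θ' ∈ Set.Icc lo hi) (hr : ∀ i ∈ I, r i ≤ lo ∨ hi ≤ r i)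
    (hcross : ∀ i ∈ I, ∀ j ∈ I, w i ≠ w j → (r i * w i - r j * w j) / (w i - w j) ≤ lo ∨
      hi ≤ (r i * w i - r j * w j) / (w i - w j)) :
    IsGreedy K I (fun i => (r i - θ') * w i) S where
  subset := h.subset
  card_le := h.card_le
  nonneg i hi := sub_mul_nonneg_of_notMem_Ioo (hr i (h.subset hi)) hθ hθ' (h.nonneg i hi)
  nonpos_or_le i hi hiS := by
    refine (h.nonpos_or_le i hi hiS).imp (fun hle => ?_) fun ⟨hK, hle⟩ => ⟨hK, fun j hj => ?_⟩
    · rw [← neg_nonneg, ← mul_neg] at hle ⊢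
      exact sub_mul_nonneg_of_notMem_Ioo (hr i hi) hθ hθ' hle
    · have hij := hle j hj
      rw [← sub_nonneg] at hij ⊢
      by_cases hw : w j = w i
      · rw [hw, ← sub_mul, sub_sub_sub_cancel_right] at hij ⊢
        exact hij
      · rw [sub_mul_sub_sub_mul hw] at hij ⊢
        exact sub_mul_nonneg_of_notMem_Ioo (hcross j (h.subset hj) i hi hw) hθ hθ' hij

end Reward

section OptReward

variable {N K : ℕ} {r w : Fin N → ℝ} {I : List (Fin N)}

theorem foldr_add_mul_eq_sum (r w : Fin N → ℝ) : ∀ {S : List (Fin N)}, S.Nodup →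
    S.foldr (fun i (s : ℝ × ℝ) => (s.1 + r i * w i, s.2 + w i)) (0, 1) =
      (∑ i ∈ S.toFinset, r i * w i, 1 + ∑ i ∈ S.toFinset, w i)
  | [], _ => by simp
  | i :: S, hS => by
    have hi : i ∉ S.toFinset := by simpa using (List.nodup_cons.1 hS).1
    rw [List.foldr_cons, foldr_add_mul_eq_sum r w (List.nodup_cons.1 hS).2, List.toFinset_cons,
      Finset.sum_insert hi, Finset.sum_insert hi]
    ext <;> simp only <;> ring

theorem rewardT_val (r w : Fin N → ℝ) {S : List (Fin N)} (hS : S.Nodup) :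
    (rewardT r w S).val = reward r w S.toFinset := by
  simp only [rewardT, Timed.val_bind, foldT_val, val_step, foldr_add_mul_eq_sum r w hS, reward]

theorem rewardT_cost_le (r w : Fin N → ℝ) (S : List (Fin N)) :
    (rewardT r w S).cost ≤ 10 * S.length + 4 := by
  have := foldT_cost_le (c := 8) (l := S)
    (fun i (s : ℝ × ℝ) => step 8 (s.1 + r i * w i, s.2 + w i)) (0, 1) fun _ _ _ => le_rfl
  simp only [rewardT, Timed.cost_bind, cost_step]
  omega

theorem exists_isGreedy_topRewardT (hw : ∀ i, 0 ≤ w i) (hI : I.Nodup) (θ : ℝ) :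
    ∃ S, IsGreedy K I.toFinset (fun i => (r i - θ) * w i) S ∧
      (topRewardT r K I w θ).val = reward r w S := by
  set le : Fin N → Fin N → Timed Bool := fun i j =>
    step 9 (decide ((r j - θ) * w j ≤ (r i - θ) * w i))
  set J := (sortT le (I.filter fun i => decide (θ < r i))).val
  have hperm : J.Perm (I.filter fun i => decide (θ < r i)) := sortT_perm _ _
  have hnodup : J.Nodup := hperm.nodup_iff.2 (hI.filter _)
  have hmem : ∀ i, i ∈ J ↔ i ∈ I ∧ θ < r i := fun i => by simp [hperm.mem_iff]
  have hsort : J.Pairwise fun i j => (r j - θ) * w j ≤ (r i - θ) * w i :=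
    sortT_pairwise le (fun _ _ => decide_eq_true_iff) (fun _ _ => le_total _ _)
      (fun _ _ _ hij hjk => hjk.trans hij) _
  refine ⟨(J.take K).toFinset, isGreedy_toFinset_take hnodup hsort
    (fun i hi => List.mem_toFinset.2 ((hmem i).1 hi).1)
    (fun i hi => mul_nonneg (sub_pos.2 ((hmem i).1 hi).2).le (hw i))
    (fun i hi hpos => (hmem i).2 ⟨List.mem_toFinset.1 hi,
      sub_pos.1 (pos_of_mul_pos_left hpos (hw i))⟩), ?_⟩
  simp only [topRewardT, Timed.val_bind, filterT_val, val_step, takeT_val]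
  exact rewardT_val r w (hnodup.sublist (List.take_sublist _ _))

theorem topRewardT_cost_le (r : Fin N → ℝ) (K : ℕ) (I : List (Fin N)) (w : Fin N → ℝ) (θ : ℝ) :
    (topRewardT r K I w θ).cost ≤ 20 * (I.length * Nat.clog 2 I.length) + 22 * I.length + 10 := by
  set le : Fin N → Fin N → Timed Bool := fun i j =>
    step 9 (decide ((r j - θ) * w j ≤ (r i - θ) * w i)) with hle
  simp only [topRewardT, Timed.cost_bind, filterT_val, takeT_val, ← hle]
  have hfilter := filterT_cost_le (c := 2) (l := I) (p := fun i => step 2 (decide (θ < r i)))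
    fun _ _ => le_rfl
  set J := I.filter fun i => (step 2 (decide (θ < r i))).val
  have hsort := sortT_cost_le (c := 9) le (fun _ _ => le_rfl) J
  have htake := takeT_cost_le K (sortT le J).val
  have hreward := rewardT_cost_le r w ((sortT le J).val.take K)
  have htake_len := List.length_take_le' K (sortT le J).val
  have hsort_len := (sortT_perm le J).length_eq
  have hJ : J.length ≤ I.length := List.length_filter_le _ _
  have hlog : J.length * Nat.clog 2 J.length ≤ I.length * Nat.clog 2 I.length :=
    Nat.mul_le_mul hJ (Nat.clog_mono_right _ hJ)
  omega

theorem topRewardT_cost_le_of_length_le (hN : 1 ≤ N) (hI : I.length ≤ N) (r : Fin N → ℝ) (K : ℕ)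
    (w : Fin N → ℝ) (θ : ℝ) :
    (topRewardT r K I w θ).cost ≤ 32 * (N * (Nat.clog 2 N + 1)) := by
  have hlog : I.length * Nat.clog 2 I.length ≤ N * Nat.clog 2 N :=
    Nat.mul_le_mul hI (Nat.clog_mono_right _ hI)
  have := topRewardT_cost_le r K I w θ
  rw [mul_add_one]
  omega

/-- The values of `θ` at which the greedy set for `(r_i - θ) w_i` may change: the rewards `r_i`,
where a value changes its sign, and the points where the values of two items are equal. -/
noncomputable def breakpoints (r w : Fin N → ℝ) (I : List (Fin N)) : List ℝ :=
  I.flatMap fun i => (I.filter (w i ≠ w ·)).map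
    (fun j => (r i * w i - r j * w j) / (w i - w j)) ++ [r i]

theorem mem_breakpoints {x : ℝ} : x ∈ breakpoints r w I ↔
    ∃ i ∈ I, x = r i ∨ ∃ j ∈ I, w i ≠ w j ∧ x = (r i * w i - r j * w j) / (w i - w j) := by
  simp only [breakpoints, List.mem_flatMap, List.mem_append, List.mem_map, List.mem_filter,
    List.mem_singleton, decide_eq_true_eq, and_assoc, eq_comm (a := x), or_comm (b := r _ = x)]

theorem length_breakpoints_le (r w : Fin N → ℝ) (I : List (Fin N)) :
    (breakpoints r w I).length ≤ I.length * (I.length + 1) := by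
  rw [breakpoints, List.length_flatMap]
  refine (List.sum_le_card_nsmul _ (I.length + 1) ?_).trans_eq (by simp)
  simp only [List.forall_mem_map, List.length_append, List.length_map, List.length_singleton]
  exact fun i _ => Nat.succ_le_succ (List.length_filter_le _ _)

theorem foldr_ite_cons {α β : Type*} (p : α → Prop) [DecidablePred p] (f : α → β) (init : List β)
    (l : List α) : l.foldr (fun x acc => if p x then acc else f x :: acc) init =
      (l.filter (¬p ·)).map f ++ init := by
  induction l with
  | nil => rfl
  | cons x l ih => by_cases hx : p x <;> simp [hx, ih]

theorem foldr_append_cons {α β : Type*} (f : α → List β) (g : α → β) (l : List α) :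
    l.foldr (fun x acc => f x ++ g x :: acc) [] = l.flatMap fun x => f x ++ [g x] := by
  induction l with
  | nil => rfl
  | cons x l ih => simp [ih]

theorem breakpoints_eq_foldr (r w : Fin N → ℝ) (I : List (Fin N)) :
    I.foldr (fun i acc => I.foldr (fun j acc =>
      if w i = w j then acc else (r i * w i - r j * w j) / (w i - w j) :: acc) (r i :: acc)) [] =
      breakpoints r w I := by
  simp only [foldr_ite_cons, foldr_append_cons, breakpoints, ne_eq]

/-- The comparison of a trial value `θ` with the optimal reward that guides the bisection in
`optRewardT`. -/
noncomputable def leTopRewardT (r : Fin N → ℝ) (K : ℕ) (I : List (Fin N)) (w : Fin N → ℝ)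
    (θ : ℝ) : Timed Bool := do
  let x ← topRewardT r K I w θ
  step 1 (decide (θ ≤ x))

theorem leTopRewardT_val (hw : ∀ i, 0 ≤ w i) (hI : I.Nodup) (θ : ℝ) :
    (leTopRewardT r K I w θ).val = true ↔ θ ≤ optReward r K I.toFinset w := by
  obtain ⟨S, hS, hval⟩ := exists_isGreedy_topRewardT (r := r) (K := K) hw hI θ
  simp only [leTopRewardT, Timed.val_bind, val_step, decide_eq_true_eq, hval]
  exact hS.le_reward_iff_le_optReward hw

theorem optRewardT_val_eq_topRewardT (r : Fin N → ℝ) (K : ℕ) (I : List (Fin N))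
    (w : Fin N → ℝ) :
    let P := (sortT (fun x y => step 1 (decide (x ≤ y))) (breakpoints r w I)).val
    let q := (searchT (leTopRewardT r K I w) 0 2 P).val
    (optRewardT r K I w).val = (topRewardT r K I w ((q.1 + q.2) / 2)).val := by
  simp only [← breakpoints_eq_foldr, optRewardT, Timed.val_bind, foldT_val, val_step]
  rfl

theorem optRewardT_val (hw : ∀ i, 0 ≤ w i) (hr : ∀ i, r i ≤ 1) (hI : I.Nodup) :
    (optRewardT r K I w).val = optReward r K I.toFinset w := by
  set le : ℝ → ℝ → Timed Bool := fun x y => step 1 (decide (x ≤ y))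
  set P := (sortT le (breakpoints r w I)).val
  set q := (searchT (leTopRewardT r K I w) 0 2 P).val
  have hmem : ∀ x, x ∈ P ↔ x ∈ breakpoints r w I := fun x => (sortT_perm _ _).mem_iff
  have hsep : ∀ x ∈ P, x ≤ q.1 ∨ q.2 ≤ x := searchT_separates _ _ _
    (sortT_pairwise le (fun _ _ => decide_eq_true_iff) le_total (fun _ _ _ => le_trans) _)
  have hopt : q.1 ≤ optReward r K I.toFinset w ∧ optReward r K I.toFinset w < q.2 :=
    searchT_brackets (leTopRewardT_val hw hI) (optReward_nonneg _ _ _ _)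
      ((optReward_lt_one hr hw).trans one_lt_two) P
  obtain ⟨S, hS, hval⟩ := exists_isGreedy_topRewardT (r := r) (K := K) hw hI ((q.1 + q.2) / 2)
  rw [optRewardT_val_eq_topRewardT, hval]
  refine (hS.of_no_breakpoint ⟨by linarith, by linarith⟩ ⟨hopt.1, hopt.2.le⟩ (fun i hi => ?_)
    fun i hi j hj hij => ?_).reward_eq hw
  · exact hsep _ ((hmem _).2 (mem_breakpoints.2 ⟨i, List.mem_toFinset.1 hi, Or.inl rfl⟩))
  · exact hsep _ ((hmem _).2 (mem_breakpoints.2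
      ⟨i, List.mem_toFinset.1 hi, Or.inr ⟨j, List.mem_toFinset.1 hj, hij, rfl⟩⟩))

end OptReward

section Prune

variable {N K : ℕ} {r a b : Fin N → ℝ} {I : List (Fin N)}

/-- The count at `θ = -∞` and the sweep events that record for which `θ` the linear inequality
`θ * p < q` holds. -/
noncomputable def linearEvents (p q : ℝ) : ℤ × List (ℝ × ℤ) :=
  if p = 0 then (if 0 < q then (1, []) else (0, []))
  else if 0 < p then (1, [(q / p, -1)])
  else (0, [(q / p, 1)])

theorem eventCount_neg_one (θ x : ℝ) : eventCount θ (x, -1) = if x ≤ θ then -1 else 0 := by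
  simp [eventCount, Prod.Lex.toLex_le_toLex, ← le_iff_lt_or_eq]

theorem eventCount_one (θ x : ℝ) : eventCount θ (x, 1) = if x < θ then 1 else 0 := by
  simp [eventCount, Prod.Lex.toLex_le_toLex]

theorem linearEvents_count (θ p q : ℝ) :
    (linearEvents p q).1 + ((linearEvents p q).2.map (eventCount θ)).sum =
      if θ * p < q then 1 else 0 := by
  rw [linearEvents]
  rcases lt_trichotomy p 0 with hp | rfl | hp
  · simp [hp.ne, hp.not_gt, eventCount_one, div_lt_iff_of_neg hp]
  · rw [if_pos rfl, mul_zero]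
    split_ifs <;> rfl
  · simp only [hp.ne', hp, if_false, if_true, List.map_cons, List.map_nil, List.sum_singleton,
      eventCount_neg_one, ← lt_div_iff₀ hp, ← not_lt]
    split_ifs <;> simp

theorem length_linearEvents_le (p q : ℝ) : (linearEvents p q).2.length ≤ 1 := by
  rw [linearEvents]
  split_ifs <;> simp

/-- The initial count and the events of the sweep for item `i`. -/
noncomputable def events (r a b : Fin N → ℝ) (lo : ℝ) (i : Fin N) (I : List (Fin N)) :
    ℤ × List (ℝ × ℤ) :=
  I.foldr (fun j s => if j = i then s else
    ((linearEvents (a j - b i) (r j * a j - r i * b i)).1 + s.1,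
      (linearEvents (a j - b i) (r j * a j - r i * b i)).2 ++ s.2)) (0, [(lo, 0)])

theorem mem_events (r a b : Fin N → ℝ) (lo : ℝ) (i : Fin N) (I : List (Fin N)) :
    (lo, 0) ∈ (events r a b lo i I).2 := by
  induction I with
  | nil => simp [events]
  | cons j I ih =>
    rw [events, List.foldr_cons, ← events]
    split_ifs
    · exact ih
    · exact List.mem_append_right _ ih

theorem length_events_le (r a b : Fin N → ℝ) (lo : ℝ) (i : Fin N) (I : List (Fin N)) :
    (events r a b lo i I).2.length ≤ I.length + 1 := by
  induction I with
  | nil => simp [events]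
  | cons j I ih =>
    have hj := length_linearEvents_le (a j - b i) (r j * a j - r i * b i)
    rw [events, List.foldr_cons, ← events]
    split_ifs <;> simp only [List.length_append, List.length_cons] <;> omega

theorem events_count (r a b : Fin N → ℝ) (lo θ : ℝ) (i : Fin N) {I : List (Fin N)}
    (hI : I.Nodup) :
    (events r a b lo i I).1 + ((events r a b lo i I).2.map (eventCount θ)).sum =
      ((I.toFinset.filter fun j => (r i - θ) * Function.update a i (b i) i <
        (r j - θ) * Function.update a i (b i) j).card : ℤ) := by
  induction I with
  | nil => simp [events, eventCount]
  | cons j I ih =>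
    obtain ⟨hj, hI⟩ := List.nodup_cons.1 hI
    specialize ih hI
    rw [Finset.natCast_card_filter] at ih ⊢
    rw [events, List.foldr_cons, ← events, List.toFinset_cons,
      Finset.sum_insert (by simpa using hj), ← ih]
    by_cases hji : j = i
    · simp [hji]
    · have hiff : (r i - θ) * b i < (r j - θ) * a j ↔
          θ * (a j - b i) < r j * a j - r i * b i := by
        constructor <;> intro h <;> linarith
      simp only [hji, if_false, Function.update_self, Function.update_of_ne hji, hiff,
        ← linearEvents_count, List.map_append, List.sum_append]
      ring

/-- The order in which `surviveT` sorts the events. -/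
noncomputable def eventLeT (e e' : ℝ × ℤ) : Timed Bool :=
  step 7 (decide (e.1 < e'.1 ∨ (e.1 = e'.1 ∧ e.2 ≤ e'.2)))

theorem eventLeT_val (e e' : ℝ × ℤ) : (eventLeT e e').val = true ↔ toLex e ≤ toLex e' := by
  rw [Prod.Lex.toLex_le_toLex, eventLeT, val_step, decide_eq_true_iff]

theorem surviveT_eq (r : Fin N → ℝ) (K : ℕ) (I : List (Fin N)) (a b : Fin N → ℝ) (lo hi : ℝ)
    (i : Fin N) : surviveT r K I a b lo hi i = (do
      let s ← foldT (fun j s => step 30 (if j = i then s else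
        ((linearEvents (a j - b i) (r j * a j - r i * b i)).1 + s.1,
          (linearEvents (a j - b i) (r j * a j - r i * b i)).2 ++ s.2))) (0, [(lo, 0)]) I
      let es ← sortT eventLeT s.2
      sweepT K lo hi (r i) s.1 es) := by
  rw [surviveT]
  congr! with j s <;>
  · simp only [linearEvents]
    split_ifs <;> simp [add_comm]

theorem surviveT_val (r : Fin N → ℝ) (K : ℕ) (a b : Fin N → ℝ) (lo hi : ℝ) (hI : I.Nodup)
    {i : Fin N} (hi' : i ∈ I) : (surviveT r K I a b lo hi i).val = true ↔
      ∃ θ, lo ≤ θ ∧ θ ≤ hi ∧ i ∈ top r K I.toFinset (Function.update a i (b i)) θ := by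
  set es := (sortT eventLeT (events r a b lo i I).2).val
  have hperm : es.Perm (events r a b lo i I).2 := sortT_perm _ _
  have hsort : es.Pairwise fun e e' => toLex e ≤ toLex e' :=
    sortT_pairwise _ eventLeT_val (fun _ _ => le_total _ _) (fun _ _ _ => le_trans) _
  have hval : (surviveT r K I a b lo hi i).val =
      (sweepT K lo hi (r i) (events r a b lo i I).1 es).val := by
    simp only [surviveT_eq, Timed.val_bind, foldT_val, val_step]
    rfl
  rw [hval, sweepT_eq_true_iff K hi (r i) _ hsort (hperm.mem_iff.2 (mem_events r a b lo i I))]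
  refine exists_congr fun θ => and_congr_right fun _ => and_congr_right fun _ => ?_
  rw [(hperm.map _).sum_eq, events_count r a b lo θ i hI, top, Finset.mem_filter,
    List.mem_toFinset]
  simp only [hi', true_and, Nat.cast_lt]

theorem pruneT_val (hr : ∀ i, r i ≤ 1) (ha : ∀ i, 0 ≤ a i) (hb : ∀ i, 0 ≤ b i) (hI : I.Nodup) :
    (pruneT r K I a b).val.toFinset = prune r K I.toFinset a b := by
  ext i
  simp only [pruneT, Timed.val_bind, filterT_val, optRewardT_val ha hr hI,
    optRewardT_val hb hr hI, List.mem_toFinset, List.mem_filter, prune, Finset.mem_filter]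
  exact and_congr_right fun hi => surviveT_val r K a b _ _ hI hi

theorem nodup_pruneT (hI : I.Nodup) : (pruneT r K I a b).val.Nodup := by
  simp only [pruneT, Timed.val_bind, filterT_val]
  exact hI.filter _

end Prune

section PruneCost

variable {N : ℕ} {I : List (Fin N)}

theorem clog_two_lt_self {n : ℕ} (hn : 1 ≤ n) : Nat.clog 2 n < n := by
  have : n ≤ 2 ^ (n - 1) := Nat.le_of_pred_lt (n - 1).lt_two_pow_self
  have := Nat.clog_le_of_le_pow this
  omega

theorem clog_two_succ_le {m n : ℕ} (hn : 1 ≤ n) (h : m ≤ 2 * n ^ 2) :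
    Nat.clog 2 (m + 1) ≤ 2 * (Nat.clog 2 n + 1) := by
  refine Nat.clog_le_of_le_pow ?_
  calc m + 1
    _ ≤ (n * 2) ^ 2 := by nlinarith
    _ ≤ (2 ^ Nat.clog 2 n * 2) ^ 2 := by gcongr; exact Nat.le_pow_clog one_lt_two n
    _ = 2 ^ (2 * (Nat.clog 2 n + 1)) := by rw [pow_mul', ← pow_succ]

theorem length_breakpoints_le_sq (hN : 1 ≤ N) (hI : I.length ≤ N) (r w : Fin N → ℝ) :
    (breakpoints r w I).length ≤ 2 * N ^ 2 := by
  have := (length_breakpoints_le r w I).trans (Nat.mul_le_mul hI (Nat.add_le_add_right hI 1))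
  nlinarith

theorem foldT_breakpoints_cost_le (hN : 1 ≤ N) (hI : I.length ≤ N) (r w : Fin N → ℝ) :
    (foldT (fun i acc => foldT (fun j acc => step 14
      (if w i = w j then acc else (r i * w i - r j * w j) / (w i - w j) :: acc))
      (r i :: acc) I) [] I).cost ≤ 20 * N ^ 2 := by
  refine (foldT_cost_le (c := 16 * N + 1) _ _ fun i _ acc => ?_).trans (by nlinarith)
  refine (foldT_cost_le (c := 14) _ _ fun _ _ _ => le_rfl).trans ?_
  omega

theorem sortT_breakpoints_cost_le (hN : 1 ≤ N) (hI : I.length ≤ N) (r w : Fin N → ℝ) :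
    (sortT (fun x y : ℝ => step 1 (decide (x ≤ y))) (breakpoints r w I)).cost ≤
      53 * (N ^ 2 * (Nat.clog 2 N + 1)) := by
  have hsort := sortT_cost_le (c := 1) (le := fun x y : ℝ => step 1 (decide (x ≤ y)))
    (fun _ _ => le_rfl) (breakpoints r w I)
  have hlen := length_breakpoints_le_sq hN hI r w
  have hclog := (Nat.clog_mono_right 2 (breakpoints r w I).length.le_succ).trans
    (clog_two_succ_le hN hlen)
  have hmul := Nat.mul_le_mul hlen hclog
  nlinarith

theorem leTopRewardT_cost_le (hN : 1 ≤ N) (hI : I.length ≤ N) (r : Fin N → ℝ) (K : ℕ)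
    (w : Fin N → ℝ) (θ : ℝ) :
    (leTopRewardT r K I w θ).cost ≤ 32 * (N * (Nat.clog 2 N + 1)) + 1 := by
  have := topRewardT_cost_le_of_length_le hN hI r K w θ
  simp only [leTopRewardT, Timed.cost_bind, cost_step]
  omega

theorem searchT_breakpoints_cost_le (hN : 1 ≤ N) (r : Fin N → ℝ) (K : ℕ)
    (hI : I.length ≤ N) (w : Fin N → ℝ) {P : List ℝ} (hP : P.length ≤ 2 * N ^ 2) :
    (searchT (leTopRewardT r K I w) 0 2 P).cost ≤ 93 * (N ^ 2 * (Nat.clog 2 N + 1)) := by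
  have hsearch := searchT_cost_le _ (leTopRewardT_cost_le hN hI r K w) 0 2 P
  have hclog := clog_two_succ_le hN hP
  have hlog := clog_two_lt_self hN
  set q := Nat.clog 2 N + 1
  calc _ ≤ 8 * (2 * N ^ 2) + (32 * (N * q) + 5) * (2 * q) + 3 := hsearch.trans (by gcongr)
    _ ≤ 8 * (2 * N ^ 2) + (32 * (N * N) + 5 * N) * (2 * q) + 3 := by
        gcongr
        · exact hlog
        · omega
    _ ≤ 93 * (N ^ 2 * q) := by
        have hq : 1 ≤ q := Nat.le_add_left 1 _
        have hsq : N ^ 2 ≤ N ^ 2 * q := Nat.le_mul_of_pos_right _ hq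
        have hpos : 1 ≤ N ^ 2 := Nat.one_le_pow 2 N hN
        have hmul : N * q ≤ N ^ 2 * q := Nat.mul_le_mul_right q (Nat.le_self_pow two_ne_zero N)
        have hexpand : (32 * (N * N) + 5 * N) * (2 * q) = 64 * (N ^ 2 * q) + 10 * (N * q) := by
          ring
        omega

theorem optRewardT_cost_le (hN : 1 ≤ N) (hI : I.length ≤ N) (r : Fin N → ℝ) (K : ℕ)
    (w : Fin N → ℝ) : (optRewardT r K I w).cost ≤ 250 * (N ^ 2 * (Nat.clog 2 N + 1)) := by
  set P := sortT (fun x y => step 1 (decide (x ≤ y))) (breakpoints r w I) with hP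
  set q := searchT (leTopRewardT r K I w) 0 2 P.val with hq
  have hcost : (optRewardT r K I w).cost = (foldT (fun i acc => foldT (fun j acc => step 14
      (if w i = w j then acc else (r i * w i - r j * w j) / (w i - w j) :: acc))
      (r i :: acc) I) [] I).cost + (P.cost + (q.cost + (4 +
      (topRewardT r K I w ((q.val.1 + q.val.2) / 2)).cost))) := by
    simp only [hq, hP, ← breakpoints_eq_foldr, optRewardT, Timed.cost_bind, foldT_val, val_step]
    rfl
  have hfold := foldT_breakpoints_cost_le hN hI r w
  have hsort := sortT_breakpoints_cost_le hN hI r w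
  have hsearch := searchT_breakpoints_cost_le hN r K hI w (P := P.val)
    ((sortT_perm (fun x y : ℝ => step 1 (decide (x ≤ y))) _).length_eq.trans_le
      (length_breakpoints_le_sq hN hI r w))
  have htop := topRewardT_cost_le_of_length_le hN hI r K w ((q.val.1 + q.val.2) / 2)
  rw [hcost]
  nlinarith

theorem surviveT_cost_le (hN : 1 ≤ N) (hI : I.length ≤ N) (r : Fin N → ℝ) (K : ℕ)
    (a b : Fin N → ℝ) (lo hi : ℝ) (i : Fin N) :
    (surviveT r K I a b lo hi i).cost ≤ 200 * (N * (Nat.clog 2 N + 1)) := by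
  set count : Fin N → ℤ × List (ℝ × ℤ) → Timed (ℤ × List (ℝ × ℤ)) := fun j s =>
    step 30 (if j = i then s else
      ((linearEvents (a j - b i) (r j * a j - r i * b i)).1 + s.1,
        (linearEvents (a j - b i) (r j * a j - r i * b i)).2 ++ s.2)) with hcount
  have hcost : (surviveT r K I a b lo hi i).cost = (foldT count (0, [(lo, 0)]) I).cost +
      ((sortT eventLeT (events r a b lo i I).2).cost + (sweepT K lo hi (r i)
        (events r a b lo i I).1 (sortT eventLeT (events r a b lo i I).2).val).cost) := by
    simp only [surviveT_eq, hcount, Timed.cost_bind, foldT_val, val_step, events]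
  have hfold := foldT_cost_le (c := 30) (l := I) count (0, [(lo, 0)]) fun _ _ _ => le_rfl
  have hlen := (length_events_le r a b lo i I).trans (Nat.add_le_add_right hI 1)
  set es := (events r a b lo i I).2
  have hclog : Nat.clog 2 es.length ≤ Nat.clog 2 N + 1 := by
    refine Nat.clog_le_of_le_pow (hlen.trans ?_)
    have : N ≤ 2 ^ Nat.clog 2 N := Nat.le_pow_clog one_lt_two N
    rw [pow_succ]
    omega
  have hsort := sortT_cost_le eventLeT (c := 7) (fun _ _ => le_rfl) es
  have hsweep := sweepT_cost_le K lo hi (r i) (events r a b lo i I).1 (sortT eventLeT es).val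
  rw [(sortT_perm _ _).length_eq] at hsweep
  have hmul := Nat.mul_le_mul hlen hclog
  rw [hcost]
  nlinarith

theorem pruneT_cost_le (hN : 1 ≤ N) (hI : I.length ≤ N) (r : Fin N → ℝ) (K : ℕ)
    (a b : Fin N → ℝ) : (pruneT r K I a b).cost ≤ 750 * (N ^ 2 * (Nat.clog 2 N + 1)) := by
  simp only [pruneT, Timed.cost_bind]
  have hlo := optRewardT_cost_le hN hI r K a
  have hhi := optRewardT_cost_le hN hI r K b
  have hfilter := filterT_cost_le (l := I) fun i _ => surviveT_cost_le hN hI r K a b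
    (optRewardT r K I a).val (optRewardT r K I b).val i
  nlinarith

end PruneCost

/-! ### The best assortment and the gaps -/

theorem succ_le_countP_getElem_le {α : Type*} [LinearOrder α] {l : List α}
    (hl : l.Pairwise (· ≥ ·)) {n : ℕ} (hn : n < l.length) :
    n + 1 ≤ l.countP fun x => decide (l[n] ≤ x) := by
  have htake : (l.take (n + 1)).countP (fun x => decide (l[n] ≤ x)) = (l.take (n + 1)).length := by
    refine List.countP_eq_length.2 fun x hx => ?_
    obtain ⟨m, hm, rfl⟩ := List.mem_take_iff_getElem.1 hx
    rw [decide_eq_true_eq]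
    rcases eq_or_ne m n with rfl | hmn
    · exact le_rfl
    · exact List.pairwise_iff_getElem.1 hl m n _ hn (by omega)
  have hle := (List.take_sublist (n + 1) l).countP_le (p := fun x => decide (l[n] ≤ x))
  rw [htake, List.length_take] at hle
  omega

theorem countP_getElem_lt_le {α : Type*} [LinearOrder α] {l : List α}
    (hl : l.Pairwise (· ≥ ·)) {n : ℕ} (hn : n < l.length) :
    (l.countP fun x => decide (l[n] < x)) ≤ n := by
  have hdrop : (l.drop n).countP (fun x => decide (l[n] < x)) = 0 := by
    refine List.countP_eq_zero.2 fun x hx => ?_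
    obtain ⟨m, hm, rfl⟩ := List.mem_drop_iff_getElem.1 hx
    rw [decide_eq_true_eq, not_lt]
    rcases Nat.eq_zero_or_pos m with rfl | hm'
    · simp
    · exact List.pairwise_iff_getElem.1 hl n (n + m) hn _ (by omega)
  calc l.countP _ = (l.take n).countP _ + (l.drop n).countP _ := by
        rw [← List.countP_append, List.take_append_drop]
    _ ≤ n := by
        rw [hdrop, add_zero]
        exact List.countP_le_length.trans (List.length_take_le n l)

section Rank

variable {N K : ℕ} (r v : Fin N → ℝ) {j : ℕ}

/-- All advantages in decreasing order; the `j`-th largest one is the entry with index `j - 1`. -/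
noncomputable def sortedAdvantages (r : Fin N → ℝ) (K : ℕ) (v : Fin N → ℝ) : List ℝ :=
  ((Finset.univ : Finset (Fin N)).val.map (advantage r K v)).sort (· ≥ ·)

theorem pairwise_sortedAdvantages : (sortedAdvantages r K v).Pairwise (· ≥ ·) :=
  Multiset.pairwise_sort _ _

theorem length_sortedAdvantages : (sortedAdvantages r K v).length = N := by
  simp [sortedAdvantages]

theorem countP_sortedAdvantages (p : ℝ → Prop) [DecidablePred p] :
    (sortedAdvantages r K v).countP (fun x => decide (p x)) =
      (Finset.univ.filter fun i => p (advantage r K v i)).card := by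
  rw [sortedAdvantages, ← Multiset.coe_countP, Multiset.sort_eq, Multiset.countP_map]
  simp [Finset.card_def]

theorem sub_one_lt_length_sortedAdvantages (hj : 1 ≤ j) (hjN : j ≤ N) :
    j - 1 < (sortedAdvantages r K v).length := by
  rw [length_sortedAdvantages]
  omega

theorem advantageRank_eq_getElem (hj : 1 ≤ j) (hjN : j ≤ N) : advantageRank r K v j =
    (sortedAdvantages r K v)[j - 1]'(sub_one_lt_length_sortedAdvantages r v hj hjN) :=
  List.getD_eq_getElem ..

theorem le_card_advantageRank_le (hj : 1 ≤ j) (hjN : j ≤ N) :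
    j ≤ (Finset.univ.filter fun i => advantageRank r K v j ≤ advantage r K v i).card := by
  have := succ_le_countP_getElem_le (pairwise_sortedAdvantages r v (K := K))
    (sub_one_lt_length_sortedAdvantages r v hj hjN)
  rw [← countP_sortedAdvantages r v fun x => _ ≤ x, advantageRank_eq_getElem r v hj hjN]
  omega

theorem card_advantageRank_lt (hj : 1 ≤ j) (hjN : j ≤ N) :
    (Finset.univ.filter fun i => advantageRank r K v j < advantage r K v i).card < j := by
  have := countP_getElem_lt_le (pairwise_sortedAdvantages r v (K := K))
    (sub_one_lt_length_sortedAdvantages r v hj hjN)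
  rw [← countP_sortedAdvantages r v fun x => _ < x, advantageRank_eq_getElem r v hj hjN]
  omega

theorem advantageRank_succ_le (hj : 1 ≤ j) (hjN : j + 1 ≤ N) :
    advantageRank r K v (j + 1) ≤ advantageRank r K v j := by
  rw [advantageRank_eq_getElem r v hj (by omega), advantageRank_eq_getElem r v (by omega) hjN]
  exact List.pairwise_iff_getElem.1 (pairwise_sortedAdvantages r v) _ _ _ _ (by omega)

theorem exists_advantageRank_eq (hj : 1 ≤ j) (hjN : j ≤ N) :
    ∃ i, advantageRank r K v j = advantage r K v i := by
  have hmem := List.getElem_mem (sub_one_lt_length_sortedAdvantages r v (K := K) hj hjN)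
  rw [← advantageRank_eq_getElem r v hj hjN,
    sortedAdvantages, Multiset.mem_sort, Multiset.mem_map] at hmem
  obtain ⟨i, -, hi⟩ := hmem
  exact ⟨i, hi.symm⟩

end Rank

section Best

variable {N K : ℕ} {r v : Fin N → ℝ} {i j : Fin N}

theorem isBest_best (r : Fin N → ℝ) (K : ℕ) (v : Fin N → ℝ) : IsBest r K v (best r K v) :=
  (exists_isBest r K v).choose_spec

theorem sum_best (hv : ∀ i, 0 ≤ v i) :
    ∑ i ∈ best r K v, advantage r K v i = optReward r K Finset.univ v := by
  have hsum := sum_sub_reward_mul (r := r) (S := best r K v) hv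
  rwa [(isBest_best r K v).2.1] at hsum

theorem sum_advantage_le (hv : ∀ i, 0 ≤ v i) {S : Finset (Fin N)} (hS : S.card ≤ K) :
    ∑ i ∈ S, advantage r K v i ≤ optReward r K Finset.univ v :=
  sum_le_optReward hv (Finset.subset_univ S) hS

theorem lt_of_mem_best (hv : ∀ i, 0 ≤ v i) (hi : i ∈ best r K v) :
    optReward r K Finset.univ v < r i := by
  by_contra hr
  have hneg : advantage r K v i ≤ 0 := mul_nonpos_of_nonpos_of_nonneg (by linarith) (hv i)
  have hsum := sum_best (r := r) (K := K) hv
  rw [← Finset.add_sum_erase _ _ hi] at hsum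
  obtain ⟨hcard, -, hmin⟩ := isBest_best r K v
  have hlt := Finset.card_erase_lt_of_mem hi
  have hle : optReward r K Finset.univ v ≤ reward r v ((best r K v).erase i) :=
    (le_reward_iff hv).2 (by change _ ≤ ∑ i ∈ _, advantage r K v i; linarith)
  have hK : ((best r K v).erase i).card ≤ K := hlt.le.trans hcard
  exact hlt.not_ge
    (hmin _ hK (le_antisymm (reward_le_optReward (Finset.subset_univ _) hK) hle))

theorem advantage_le_of_mem_best (hv : ∀ i, 0 ≤ v i) (hi : i ∈ best r K v)
    (hj : j ∉ best r K v) : advantage r K v j ≤ advantage r K v i := by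
  have hj' : j ∉ (best r K v).erase i := fun h => hj (Finset.mem_of_mem_erase h)
  have hcard : (insert j ((best r K v).erase i)).card ≤ K := by
    rw [Finset.card_insert_of_notMem hj', Finset.card_erase_add_one hi]
    exact (isBest_best r K v).1
  have hle := sum_advantage_le (r := r) hv hcard
  rw [Finset.sum_insert hj', ← sum_best hv, ← Finset.add_sum_erase _ _ hi] at hle
  linarith

theorem advantage_nonpos_of_card_lt (hv : ∀ i, 0 ≤ v i) (hK : (best r K v).card < K)
    (hj : j ∉ best r K v) : advantage r K v j ≤ 0 := by
  have hle := sum_advantage_le (r := r) (S := insert j (best r K v)) hv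
    ((Finset.card_insert_of_notMem hj).trans_le hK)
  rw [Finset.sum_insert hj, ← sum_best hv] at hle
  linarith

theorem card_best_le : (best r K v).card ≤ N :=
  (Finset.card_le_univ _).trans_eq (Fintype.card_fin N)

theorem advantageRank_le_of_mem_best (hv : ∀ i, 0 ≤ v i) (hK : (best r K v).card = K)
    (hi : i ∈ best r K v) : advantageRank r K v K ≤ advantage r K v i := by
  by_contra hlt
  have hrank := le_card_advantageRank_le (K := K) r v (hK ▸ Finset.card_pos.2 ⟨i, hi⟩)
    (hK ▸ card_best_le)
  have hsub : (Finset.univ.filter fun i => advantageRank r K v K ≤ advantage r K v i) ⊆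
      (best r K v).erase i := by
    intro j hj
    have hj := (Finset.mem_filter.1 hj).2
    refine Finset.mem_erase.2 ⟨fun h => hlt (h ▸ hj), ?_⟩
    by_contra hjB
    exact hlt (hj.trans (advantage_le_of_mem_best hv hi hjB))
  have := (Finset.card_le_card hsub).trans_lt (Finset.card_erase_lt_of_mem hi)
  omega

theorem lt_of_notMem_best (hK : (best r K v).card = K) (hj : j ∉ best r K v) : K < N := by
  have hlt := Finset.card_lt_univ_of_notMem hj
  rwa [hK, Fintype.card_fin] at hlt

theorem advantage_le_advantageRank (hv : ∀ i, 0 ≤ v i) (hK : (best r K v).card = K)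
    (hj : j ∉ best r K v) : advantage r K v j ≤ advantageRank r K v (K + 1) := by
  by_contra! hlt
  have hrank := card_advantageRank_lt (K := K) r v (Nat.le_add_left 1 K) (lt_of_notMem_best hK hj)
  have hsub : insert j (best r K v) ⊆
      Finset.univ.filter fun i => advantageRank r K v (K + 1) < advantage r K v i := by
    intro i hi
    refine Finset.mem_filter.2 ⟨Finset.mem_univ i, ?_⟩
    rcases Finset.mem_insert.1 hi with rfl | hi
    · exact hlt
    · exact hlt.trans_le (advantage_le_of_mem_best hv hi hj)
  have hcard := Finset.card_le_card hsub
  rw [Finset.card_insert_of_notMem hj] at hcard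
  omega

theorem gap_of_mem_best (hi : i ∈ best r K v) : gap r K v i = innerGap r K v := if_pos hi

theorem innerGap_le_of_mem_best (hi : i ∈ best r K v) :
    innerGap r K v ≤ r i - optReward r K Finset.univ v := by
  have hinf := ciInf_le (f := fun j : {j // j ∈ best r K v} => r j - optReward r K Finset.univ v)
    (Set.finite_range _).bddBelow ⟨i, hi⟩
  rw [innerGap]
  split_ifs
  · exact (min_le_right _ _).trans hinf
  · exact hinf

end Best

/-- The standing assumptions on an instance. -/
structure Regular {N : ℕ} (K : ℕ) (r v : Fin N → ℝ) : Prop where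
  two_le : 2 ≤ N * K
  r_pos : ∀ i, 0 < r i
  r_le_one : ∀ i, r i ≤ 1
  v_pos : ∀ i, 0 < v i
  v_le_one : ∀ i, v i ≤ 1
  gap_ne_zero : ∀ i, gap r K v i ≠ 0

namespace Regular

variable {N K : ℕ} {r v : Fin N → ℝ}

theorem one_le_N (h : Regular K r v) : 1 ≤ N :=
  Nat.pos_of_mul_pos_right (two_pos.trans_le h.two_le)

theorem one_le_K (h : Regular K r v) : 1 ≤ K :=
  Nat.pos_of_mul_pos_left (two_pos.trans_le h.two_le)

theorem v_nonneg (h : Regular K r v) (i : Fin N) : 0 ≤ v i := (h.v_pos i).le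

theorem optReward_pos (h : Regular K r v) : 0 < optReward r K Finset.univ v := by
  let i : Fin N := ⟨0, h.one_le_N⟩
  refine lt_of_lt_of_le ?_ (reward_le_optReward (S := {i}) (Finset.subset_univ _) h.one_le_K)
  have := h.r_pos i
  have := h.v_pos i
  simp only [reward, Finset.sum_singleton]
  positivity

theorem best_nonempty (h : Regular K r v) : (best r K v).Nonempty := by
  refine Finset.nonempty_of_sum_ne_zero (f := advantage r K v) ?_
  rw [sum_best h.v_nonneg]
  exact h.optReward_pos.ne'

theorem optReward_mul_le (h : Regular K r v) : optReward r K Finset.univ v * (1 + K) ≤ K := by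
  obtain ⟨S, -, hS, hopt⟩ := exists_reward_eq_optReward r v K Finset.univ
  have hsum : ∑ i ∈ S, v i ≤ K :=
    (Finset.sum_le_card_nsmul S v 1 fun i _ => h.v_le_one i).trans (by simpa using hS)
  have hrsum : ∑ i ∈ S, r i * v i ≤ ∑ i ∈ S, v i :=
    Finset.sum_le_sum fun i _ => mul_le_of_le_one_left (h.v_nonneg i) (h.r_le_one i)
  rw [← hopt, reward, div_mul_eq_mul_div, div_le_iff₀ (one_add_sum_pos h.v_nonneg S)]
  nlinarith

theorem neg_optReward_le_advantage (h : Regular K r v) (i : Fin N) :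
    -optReward r K Finset.univ v ≤ advantage r K v i := by
  have := h.r_pos i
  have := h.v_pos i
  have := h.v_le_one i
  have := h.optReward_pos
  rw [advantage]
  nlinarith

theorem iInf_pos (h : Regular K r v) :
    0 < ⨅ j : {j // j ∈ best r K v}, (r j - optReward r K Finset.univ v) := by
  have : Nonempty {j // j ∈ best r K v} := h.best_nonempty.to_subtype
  obtain ⟨j, hj⟩ := exists_eq_ciInf_of_finite
    (f := fun j : {j // j ∈ best r K v} => r j - optReward r K Finset.univ v)
  rw [← hj]
  exact sub_pos.2 (lt_of_mem_best h.v_nonneg j.2)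

theorem innerGap_nonneg (h : Regular K r v) : 0 ≤ innerGap r K v := by
  rw [innerGap]
  split_ifs with hK
  · exact le_min (sub_nonneg.2 (advantageRank_succ_le r v h.one_le_K hK)) h.iInf_pos.le
  · exact h.iInf_pos.le

theorem gap_pos (h : Regular K r v) (i : Fin N) : 0 < gap r K v i := by
  refine lt_of_le_of_ne ?_ (h.gap_ne_zero i).symm
  rw [gap]
  split_ifs with hi hK
  · exact h.innerGap_nonneg
  · exact sub_nonneg.2 ((advantage_le_advantageRank h.v_nonneg hK hi).trans
      (advantageRank_succ_le r v h.one_le_K (lt_of_notMem_best hK hi)))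
  · exact neg_nonneg.2
      (advantage_nonpos_of_card_lt h.v_nonneg (lt_of_le_of_ne (isBest_best r K v).1 hK) hi)

theorem innerGap_le_gap (h : Regular K r v) (hK : (best r K v).card = K) (i : Fin N) :
    innerGap r K v ≤ gap r K v i := by
  by_cases hi : i ∈ best r K v
  · rw [gap_of_mem_best hi]
  · rw [gap, if_neg hi, if_pos hK, innerGap, if_pos (lt_of_notMem_best hK hi)]
    exact (min_le_left _ _).trans
      (sub_le_sub_left (advantage_le_advantageRank h.v_nonneg hK hi) _)

theorem advantageRank_mul_le (h : Regular K r v) (hK : (best r K v).card = K) :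
    advantageRank r K v K * K ≤ optReward r K Finset.univ v := by
  have hsum := Finset.card_nsmul_le_sum (best r K v) (advantage r K v) (advantageRank r K v K)
    fun i hi => advantageRank_le_of_mem_best h.v_nonneg hK hi
  rwa [sum_best h.v_nonneg, nsmul_eq_mul, hK, mul_comm] at hsum

theorem gap_le_one (h : Regular K r v) (i : Fin N) : gap r K v i ≤ 1 := by
  have hpos := h.optReward_pos
  have hlt := optReward_lt_one (K := K) (I := Finset.univ) h.r_le_one h.v_nonneg
  have hadv := h.neg_optReward_le_advantage i
  by_cases hi : i ∈ best r K v
  · rw [gap_of_mem_best hi]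
    linarith [innerGap_le_of_mem_best hi, h.r_le_one i]
  · rw [gap, if_neg hi]
    split_ifs with hK
    · have hrank := h.advantageRank_mul_le hK
      have hopt := h.optReward_mul_le
      have hK0 : (0 : ℝ) < K := Nat.cast_pos.2 h.one_le_K
      have : advantageRank r K v K + optReward r K Finset.univ v ≤ 1 :=
        le_of_mul_le_mul_right (by linarith) hK0
      linarith
    · linarith

theorem exists_gap_le_two_thirds (h : Regular K r v) (hK : K = 1) : ∃ i, gap r K v i ≤ 2 / 3 := by
  have hcard : (best r K v).card = 1 :=
    le_antisymm (hK ▸ (isBest_best r K v).1) h.best_nonempty.card_pos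
  obtain ⟨i, hB⟩ := Finset.card_eq_one.1 hcard
  have hi : i ∈ best r K v := hB ▸ Finset.mem_singleton_self i
  have hN : K < N := by
    have := h.two_le
    rw [hK] at this ⊢
    omega
  have hsum : (r i - optReward r K Finset.univ v) * v i = optReward r K Finset.univ v := by
    have := sum_best (r := r) (K := K) h.v_nonneg
    rwa [hB, Finset.sum_singleton] at this
  obtain ⟨j, hj⟩ := exists_advantageRank_eq (K := K) r v (Nat.le_add_left 1 K) hN
  have hrank := advantageRank_le_of_mem_best h.v_nonneg (hcard.trans hK.symm) hi
  have hinner : innerGap r K v ≤ advantageRank r K v K - advantageRank r K v (K + 1) := by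
    rw [innerGap, if_pos hN]
    exact min_le_left _ _
  -- The bounds `1 - θ` and `η^(1) - η^(2) ≤ 2 θ` on the gap cannot both exceed `2 / 3`.
  refine ⟨i, ?_⟩
  rw [gap_of_mem_best hi]
  have hadv : advantage r K v i = optReward r K Finset.univ v := hsum
  linarith [innerGap_le_of_mem_best hi, h.neg_optReward_le_advantage j, h.r_le_one i]

end Regular

section Complexity

variable {N K : ℕ} {r v : Fin N → ℝ}

theorem one_div_gap_sq_le_iSup (r : Fin N → ℝ) (K : ℕ) (v : Fin N → ℝ) (i : Fin N) :
    1 / gap r K v i ^ 2 ≤ ⨆ i, 1 / gap r K v i ^ 2 :=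
  le_ciSup (f := fun i => 1 / gap r K v i ^ 2) (Set.finite_range _).bddAbove i

namespace Regular

theorem H₂_le_three_mul_H₁ (h : Regular K r v) : H₂ r K v ≤ 3 * H₁ r K v := by
  have : Nonempty (Fin N) := ⟨⟨0, h.one_le_N⟩⟩
  have hsum : (∑ i, (v i + 1 / K) / gap r K v i ^ 2) ≤ 2 * H₁ r K v := by
    rw [H₁, Finset.mul_sum]
    refine Finset.sum_le_sum fun i _ => ?_
    have hK : (1 : ℝ) / K ≤ 1 := div_le_one_of_le₀ (mod_cast h.one_le_K) (Nat.cast_nonneg K)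
    rw [mul_one_div]
    gcongr
    linarith [h.v_le_one i]
  have hsup : (⨆ i, 1 / gap r K v i ^ 2) ≤ H₁ r K v :=
    ciSup_le fun i => Finset.single_le_sum (f := fun i => 1 / gap r K v i ^ 2)
      (fun j _ => by positivity) (Finset.mem_univ i)
  rw [H₂]
  linarith

theorem sum_add_le_H₂ (h : Regular K r v) (S : Finset (Fin N)) (i : Fin N) :
    (∑ j ∈ S, v j / gap r K v j ^ 2) + 1 / gap r K v i ^ 2 ≤ H₂ r K v := by
  refine add_le_add ?_ (one_div_gap_sq_le_iSup r K v i)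
  calc ∑ j ∈ S, v j / gap r K v j ^ 2 ≤ ∑ j, v j / gap r K v j ^ 2 :=
        Finset.sum_le_sum_of_subset_of_nonneg (Finset.subset_univ _) fun j _ _ =>
          div_nonneg (h.v_nonneg j) (sq_nonneg _)
    _ ≤ ∑ j, (v j + 1 / K) / gap r K v j ^ 2 := by
        gcongr
        simp

theorem one_le_one_div_gap_sq (h : Regular K r v) (i : Fin N) : 1 ≤ 1 / gap r K v i ^ 2 :=
  one_le_one_div (pow_pos (h.gap_pos i) 2) (pow_le_one₀ (h.gap_pos i).le (h.gap_le_one i))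

theorem one_div_gap_le (h : Regular K r v) (i : Fin N) :
    1 / gap r K v i ≤ 1 / gap r K v i ^ 2 :=
  one_div_le_one_div_of_le (pow_pos (h.gap_pos i) 2)
    (pow_le_of_le_one (h.gap_pos i).le (h.gap_le_one i) two_ne_zero)

theorem one_add_sum_le_H₂ (h : Regular K r v) (S : Finset (Fin N)) :
    1 + ∑ j ∈ S, v j ≤ H₂ r K v := by
  have hsum : ∑ j ∈ S, v j ≤ ∑ j ∈ S, v j / gap r K v j ^ 2 :=
    Finset.sum_le_sum fun j _ => by
      rw [div_eq_mul_one_div]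
      exact le_mul_of_one_le_right (h.v_nonneg j) (h.one_le_one_div_gap_sq j)
  linarith [h.sum_add_le_H₂ S ⟨0, h.one_le_N⟩, h.one_le_one_div_gap_sq ⟨0, h.one_le_N⟩]

theorem one_div_gap_sq_le_H₂ (h : Regular K r v) (i : Fin N) : 1 / gap r K v i ^ 2 ≤ H₂ r K v := by
  simpa using h.sum_add_le_H₂ ∅ i

theorem three_le_mul_H₂ (h : Regular K r v) : 3 ≤ K * H₂ r K v := by
  have hK : (0 : ℝ) < K := Nat.cast_pos.2 h.one_le_K
  have hsup := (h.one_le_one_div_gap_sq ⟨0, h.one_le_N⟩).trans (one_div_gap_sq_le_iSup r K v _)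
  have hsum : (N : ℝ) / K ≤ ∑ i, (v i + 1 / K) / gap r K v i ^ 2 := by
    calc (N : ℝ) / K = ∑ _i : Fin N, 1 / (K : ℝ) := by simp [div_eq_mul_inv]
      _ ≤ _ := Finset.sum_le_sum fun i _ => by
        rw [div_eq_mul_one_div (v i + 1 / K)]
        exact (le_add_of_nonneg_left (h.v_nonneg i)).trans (le_mul_of_one_le_right
          (add_nonneg (h.v_nonneg i) (by positivity)) (h.one_le_one_div_gap_sq i))
  have hNK : (3 : ℝ) ≤ N + K := by
    have : 3 ≤ N + K := by nlinarith [h.two_le, sq_nonneg ((N : ℤ) - K)]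
    exact_mod_cast this
  calc (3 : ℝ) ≤ K * (N / K + 1) := by rwa [mul_add, mul_div_cancel₀ _ hK.ne', mul_one]
    _ ≤ K * H₂ r K v := by rw [H₂]; gcongr

end Regular

end Complexity

/-! ### Pruning with confidence bounds -/

theorem sum_le_mul_of_card_le {ι : Type*} {S : Finset ι} {K : ℕ} {f : ι → ℝ} {c : ℝ}
    (hc : 0 ≤ c) (hS : S.card ≤ K) (hf : ∀ i ∈ S, f i ≤ c) : ∑ i ∈ S, f i ≤ K * c :=
  (Finset.sum_le_card_nsmul S f c hf).trans <| by
    rw [nsmul_eq_mul]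
    gcongr

section Prune

variable {N K : ℕ} {r v a b : Fin N → ℝ} {I : Finset (Fin N)} {ε : ℝ} {i : Fin N}

theorem mem_prune : i ∈ prune r K I a b ↔ i ∈ I ∧ ∃ θ : ℝ, optReward r K I a ≤ θ ∧
    θ ≤ optReward r K I b ∧ i ∈ top r K I (Function.update a i (b i)) θ := by
  classical
  exact Finset.mem_filter

theorem optReward_of_best_subset (hI : best r K v ⊆ I) :
    optReward r K I v = optReward r K Finset.univ v := by
  obtain ⟨hcard, hbest, -⟩ := isBest_best r K v
  refine le_antisymm ?_ (hbest ▸ reward_le_optReward hI hcard)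
  obtain ⟨S, -, hS, hopt⟩ := exists_reward_eq_optReward r v K I
  exact hopt ▸ reward_le_optReward (Finset.subset_univ _) hS

theorem optReward_mono {w w' : Fin N → ℝ} (hw : ∀ i, 0 ≤ w i) (hw' : ∀ i, 0 ≤ w' i)
    (hle : ∀ i ∈ I, w i ≤ w' i) : optReward r K I w ≤ optReward r K I w' := by
  obtain ⟨S, hS, hK, hopt⟩ := exists_reward_eq_optReward r w K I
  rw [← hopt]
  set θ := reward r w S
  -- Items with reward below `θ` are dropped; raising the weights of the others helps.
  refine le_optReward (S := S.filter fun i => θ ≤ r i) hw' ((Finset.filter_subset _ _).trans hS)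
    ((Finset.card_filter_le _ _).trans hK) ?_
  have hdrop : ∑ i ∈ S.filter (fun i => ¬ θ ≤ r i), (r i - θ) * w i ≤ 0 :=
    Finset.sum_nonpos fun i hi => mul_nonpos_of_nonpos_of_nonneg
      (by linarith [(Finset.mem_filter.1 hi).2]) (hw i)
  calc θ = ∑ i ∈ S, (r i - θ) * w i := (sum_sub_reward_mul hw).symm
    _ ≤ ∑ i ∈ S.filter (fun i => θ ≤ r i), (r i - θ) * w i := by
      rw [← Finset.sum_filter_add_sum_filter_not S fun i => θ ≤ r i]
      linarith
    _ ≤ ∑ i ∈ S.filter (fun i => θ ≤ r i), (r i - θ) * w' i :=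
      Finset.sum_le_sum fun i hi => by
        rw [Finset.mem_filter] at hi
        exact mul_le_mul_of_nonneg_left (hle i (hS hi.1)) (sub_nonneg.2 hi.2)

/-- The bounds `a`, `b` enclose the preferences of the surviving items up to the accuracy `ε`, and
no item of the best assortment has been lost: the state in which a round of the algorithm
prunes. -/
structure Encloses (K : ℕ) (r v : Fin N → ℝ) (I : Finset (Fin N)) (a b : Fin N → ℝ) (ε : ℝ) :
    Prop where
  best_subset : best r K v ⊆ I
  nonneg_left : ∀ i, 0 ≤ a i
  nonneg_right : ∀ i, 0 ≤ b i
  left_le : ∀ i ∈ I, a i ≤ v i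
  le_right : ∀ i ∈ I, v i ≤ b i
  le_left_add : ∀ i ∈ I, v i ≤ a i + 2 * ε
  right_le_add : ∀ i ∈ I, b i ≤ v i + 2 * ε

namespace Encloses

theorem eps_nonneg (h : Regular K r v) (e : Encloses K r v I a b ε) : 0 ≤ ε := by
  obtain ⟨i, hi⟩ := h.best_nonempty
  linarith [e.le_right i (e.best_subset hi), e.right_le_add i (e.best_subset hi)]

theorem eps_le_mul (h : Regular K r v) (e : Encloses K r v I a b ε) : ε ≤ K * ε :=
  le_mul_of_one_le_left (e.eps_nonneg h) (mod_cast h.one_le_K)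

theorem sum_left_nonneg (e : Encloses K r v I a b ε) (S : Finset (Fin N)) : 0 ≤ ∑ i ∈ S, a i :=
  Finset.sum_nonneg fun i _ => e.nonneg_left i

theorem optReward_left_le (h : Regular K r v) (e : Encloses K r v I a b ε) :
    optReward r K I a ≤ optReward r K Finset.univ v := by
  rw [← optReward_of_best_subset e.best_subset]
  exact optReward_mono e.nonneg_left h.v_nonneg e.left_le

theorem le_optReward_right (h : Regular K r v) (e : Encloses K r v I a b ε) :
    optReward r K Finset.univ v ≤ optReward r K I b := by
  rw [← optReward_of_best_subset e.best_subset]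
  exact optReward_mono h.v_nonneg e.nonneg_right e.le_right

theorem sub_optReward_left_mul_le (h : Regular K r v) (e : Encloses K r v I a b ε) :
    (optReward r K Finset.univ v - optReward r K I a) * (1 + ∑ i ∈ best r K v, a i) ≤
      2 * K * ε := by
  set θ := optReward r K Finset.univ v
  set B := best r K v
  have hcard := (isBest_best r K v).1
  have hpos := one_add_sum_pos e.nonneg_left B
  have hle : reward r a B ≤ optReward r K I a := reward_le_optReward e.best_subset hcard
  have hsum : ∑ i ∈ B, (r i - θ) * v i = θ := sum_best h.v_nonneg
  have hdiff : (θ - reward r a B) * (1 + ∑ i ∈ B, a i) = ∑ i ∈ B, (r i - θ) * (v i - a i) := by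
    rw [sub_mul, reward, div_mul_cancel₀ _ hpos.ne']
    simp only [mul_sub, Finset.sum_sub_distrib, hsum]
    simp only [sub_mul, Finset.sum_sub_distrib, ← Finset.mul_sum]
    ring
  have hterm : ∀ i ∈ B, (r i - θ) * (v i - a i) ≤ 2 * ε := fun i hi => by
    have hI := e.best_subset hi
    have := lt_of_mem_best h.v_nonneg hi
    have := h.r_le_one i
    have := h.optReward_pos
    have := e.left_le i hI
    have := e.le_left_add i hI
    nlinarith
  have hbound := sum_le_mul_of_card_le (by linarith [e.eps_nonneg h]) hcard hterm
  nlinarith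

theorem sub_optReward_left_le (h : Regular K r v) (e : Encloses K r v I a b ε) :
    optReward r K Finset.univ v - optReward r K I a ≤ 2 * K * ε :=
  (le_mul_of_one_le_right (sub_nonneg.2 (e.optReward_left_le h))
    (by linarith [e.sum_left_nonneg (best r K v)])).trans (e.sub_optReward_left_mul_le h)

theorem optReward_right_sub_le (h : Regular K r v) (e : Encloses K r v I a b ε) :
    optReward r K I b - optReward r K Finset.univ v ≤ 2 * K * ε := by
  obtain ⟨S, hS, hK, hopt⟩ := exists_reward_eq_optReward r b K I
  have hlt := optReward_lt_one (K := K) (I := I) h.r_le_one e.nonneg_right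
  have hnonneg := optReward_nonneg r b K I
  set θ := optReward r K I b
  have hsum : ∑ i ∈ S, (r i - θ) * b i = θ := hopt ▸ sum_sub_reward_mul e.nonneg_right
  have hterm : ∀ i ∈ S, (r i - θ) * b i - (r i - θ) * v i ≤ 2 * ε := fun i hi => by
    have := h.r_le_one i
    have := e.le_right i (hS hi)
    have := e.right_le_add i (hS hi)
    have : 0 ≤ (1 - (r i - θ)) * (b i - v i) := mul_nonneg (by linarith) (by linarith)
    nlinarith
  have hdiff := sum_le_mul_of_card_le (by linarith [e.eps_nonneg h]) hK hterm
  rw [Finset.sum_sub_distrib] at hdiff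
  have hKε : 0 ≤ 2 * K * ε := by have := e.eps_nonneg h; positivity
  have hshift : ∑ i ∈ S, (r i - θ) * v i ≤ ∑ i ∈ S, (r i - (θ - 2 * K * ε)) * v i :=
    Finset.sum_le_sum fun i _ => mul_le_mul_of_nonneg_right (by linarith) (h.v_nonneg i)
  have hle : θ - 2 * K * ε ≤ optReward r K Finset.univ v :=
    le_optReward h.v_nonneg (Finset.subset_univ S) hK (by linarith)
  linarith

theorem best_subset_prune (h : Regular K r v) (e : Encloses K r v I a b ε) :
    best r K v ⊆ prune r K I a b := by
  intro i hi
  set θ := optReward r K Finset.univ v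
  have hri := lt_of_mem_best h.v_nonneg hi
  refine mem_prune.2 ⟨e.best_subset hi, θ, e.optReward_left_le h, e.le_optReward_right h,
    Finset.mem_filter.2 ⟨e.best_subset hi, hri, ?_⟩⟩
  have hsub : (I.filter fun j => (r i - θ) * Function.update a i (b i) i <
      (r j - θ) * Function.update a i (b i) j) ⊆ (best r K v).erase i := by
    intro j hj
    obtain ⟨hjI, hlt⟩ := Finset.mem_filter.1 hj
    have hji : j ≠ i := fun hji => lt_irrefl _ (hji ▸ hlt)
    rw [Function.update_self, Function.update_of_ne hji] at hlt
    refine Finset.mem_erase.2 ⟨hji, ?_⟩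
    by_contra hjB
    have hadv : (r j - θ) * v j ≤ (r i - θ) * v i := advantage_le_of_mem_best h.v_nonneg hi hjB
    have hb := mul_le_mul_of_nonneg_left (e.le_right i (e.best_subset hi)) (sub_nonneg.2 hri.le)
    have hpos : 0 < (r j - θ) * a j :=
      (mul_nonneg (sub_nonneg.2 hri.le) (e.nonneg_right i)).trans_lt hlt
    have ha := mul_le_mul_of_nonneg_left (e.left_le j hjI)
      (pos_of_mul_pos_left hpos (e.nonneg_left j)).le
    linarith
  calc _ ≤ ((best r K v).erase i).card := Finset.card_le_card hsub
    _ < (best r K v).card := Finset.card_erase_lt_of_mem hi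
    _ ≤ K := (isBest_best r K v).1

theorem prune_eq_best (h : Regular K r v) (e : Encloses K r v I a b ε)
    (hcard : (prune r K I a b).card ≤ K)
    (habove : ∀ i ∈ prune r K I a b, reward r b (prune r K I a b) < r i) :
    prune r K I a b = best r K v := by
  set C := prune r K I a b
  have hBC : best r K v ⊆ C := e.best_subset_prune h
  have hCI : C ⊆ I := fun i hi => (mem_prune.1 hi).1
  set θ' := reward r b C
  have hnonneg : ∀ i ∈ C, 0 ≤ r i - θ' := fun i hi => sub_nonneg.2 (habove i hi).le
  have hθ : optReward r K Finset.univ v ≤ θ' := by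
    rw [← (isBest_best r K v).2.1, reward_le_iff h.v_nonneg]
    calc ∑ i ∈ best r K v, (r i - θ') * v i ≤ ∑ i ∈ C, (r i - θ') * v i :=
          Finset.sum_le_sum_of_subset_of_nonneg hBC fun i hi _ =>
            mul_nonneg (hnonneg i hi) (h.v_nonneg i)
      _ ≤ ∑ i ∈ C, (r i - θ') * b i := Finset.sum_le_sum fun i hi =>
            mul_le_mul_of_nonneg_left (e.le_right i (hCI hi)) (hnonneg i hi)
      _ = θ' := sum_sub_reward_mul e.nonneg_right
  refine (Finset.Subset.antisymm hBC fun i hi => ?_).symm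
  by_contra hiB
  have hlt : (best r K v).card < K :=
    (Finset.card_lt_card ((Finset.ssubset_iff_of_subset hBC).2 ⟨i, hi, hiB⟩)).trans_le hcard
  have hpos : 0 < advantage r K v i := mul_pos (by linarith [habove i hi]) (h.v_pos i)
  exact hpos.not_ge (advantage_nonpos_of_card_lt h.v_nonneg hlt hiB)

theorem sub_mul_right_le (h : Regular K r v) (e : Encloses K r v I a b ε) (hi : i ∈ I) {θ : ℝ}
    (hθ : 0 ≤ θ) (hle : optReward r K Finset.univ v - θ ≤ 2 * K * ε) :
    (r i - θ) * b i ≤ advantage r K v i + 4 * K * ε := by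
  have hb : (r i - θ) * (b i - v i) ≤ 1 * (2 * ε) :=
    mul_le_mul (by linarith [h.r_le_one i]) (by linarith [e.right_le_add i hi])
      (by linarith [e.le_right i hi]) zero_le_one
  have hv : (optReward r K Finset.univ v - θ) * v i ≤ 2 * K * ε := by
    have hKε : 0 ≤ 2 * K * ε := by have := e.eps_nonneg h; positivity
    exact (mul_le_mul_of_nonneg_right hle (h.v_nonneg i)).trans
      (mul_le_of_le_one_right hKε (h.v_le_one i))
  have hε := e.eps_le_mul h
  rw [advantage]
  linarith

theorem advantage_le_sub_mul_left_add (h : Regular K r v) (e : Encloses K r v I a b ε)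
    (hi : i ∈ best r K v) {θ : ℝ} (hle : θ - optReward r K Finset.univ v ≤ 2 * K * ε) :
    advantage r K v i ≤ (r i - θ) * a i + 4 * K * ε := by
  have hiI := e.best_subset hi
  have hv : (r i - optReward r K Finset.univ v) * (v i - a i) ≤ 1 * (2 * ε) :=
    mul_le_mul (by linarith [h.r_le_one i, h.optReward_pos]) (by linarith [e.le_left_add i hiI])
      (by linarith [e.left_le i hiI]) zero_le_one
  have ha : (θ - optReward r K Finset.univ v) * a i ≤ 2 * K * ε := by
    have hKε : 0 ≤ 2 * K * ε := by have := e.eps_nonneg h; positivity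
    exact (mul_le_mul_of_nonneg_right hle (e.nonneg_left i)).trans
      (mul_le_of_le_one_right hKε ((e.left_le i hiI).trans (h.v_le_one i)))
  have hε := e.eps_le_mul h
  rw [advantage]
  linarith

theorem gap_le_of_mem_prune_of_card_eq (h : Regular K r v) (e : Encloses K r v I a b ε)
    (hcard : (best r K v).card = K) (hi : i ∈ prune r K I a b) (hiB : i ∉ best r K v) :
    gap r K v i ≤ 8 * K * ε := by
  obtain ⟨hiI, θ, hlo, hhi, htop⟩ := mem_prune.1 hi
  obtain ⟨-, -, hcount⟩ := Finset.mem_filter.1 htop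
  have hleft := e.sub_optReward_left_le h
  have hright := e.optReward_right_sub_le h
  by_contra! hlt
  rw [gap, if_neg hiB, if_pos hcard] at hlt
  have hup := e.sub_mul_right_le h hiI ((optReward_nonneg r a K I).trans hlo) (by linarith)
  have hsub : best r K v ⊆ I.filter fun j => (r i - θ) * Function.update a i (b i) i <
      (r j - θ) * Function.update a i (b i) j := by
    intro j hj
    have hji : j ≠ i := fun hji => hiB (hji ▸ hj)
    rw [Finset.mem_filter, Function.update_self, Function.update_of_ne hji]
    have hlow := e.advantage_le_sub_mul_left_add h hj (θ := θ) (by linarith)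
    have hrank := advantageRank_le_of_mem_best h.v_nonneg hcard hj
    exact ⟨e.best_subset hj, by linarith⟩
  exact hcount.not_ge (hcard.symm.trans_le (Finset.card_le_card hsub))

theorem gap_mul_le_of_mem_prune (h : Regular K r v) (e : Encloses K r v I a b ε)
    (hcard : (best r K v).card ≠ K) (hi : i ∈ prune r K I a b) (hiB : i ∉ best r K v) :
    gap r K v i * (1 + ∑ j ∈ best r K v, a j) ≤ 2 * K * ε := by
  obtain ⟨-, θ, hlo, -, htop⟩ := mem_prune.1 hi
  obtain ⟨-, hri, -⟩ := Finset.mem_filter.1 htop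
  refine le_trans (mul_le_mul_of_nonneg_right ?_ (one_add_sum_pos e.nonneg_left _).le)
    (e.sub_optReward_left_mul_le h)
  have hgap : gap r K v i = (optReward r K Finset.univ v - r i) * v i := by
    rw [gap, if_neg hiB, if_neg hcard, advantage, ← neg_mul, neg_sub]
  have hpos : 0 < optReward r K Finset.univ v - r i :=
    pos_of_mul_pos_left (hgap ▸ h.gap_pos i) (h.v_nonneg i)
  calc gap r K v i ≤ optReward r K Finset.univ v - r i :=
        hgap.trans_le (mul_le_of_le_one_right hpos.le (h.v_le_one i))
    _ ≤ optReward r K Finset.univ v - optReward r K I a := by linarith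

theorem gap_le_of_mem_prune (h : Regular K r v) (e : Encloses K r v I a b ε)
    (hi : i ∈ prune r K I a b) (hiB : i ∉ best r K v) : gap r K v i ≤ 8 * K * ε := by
  by_cases hcard : (best r K v).card = K
  · exact e.gap_le_of_mem_prune_of_card_eq h hcard hi hiB
  · have hmul := e.gap_mul_le_of_mem_prune h hcard hi hiB
    have hle : gap r K v i ≤ gap r K v i * (1 + ∑ j ∈ best r K v, a j) :=
      le_mul_of_one_le_right (h.gap_pos i).le (by linarith [e.sum_left_nonneg (best r K v)])
    linarith [e.eps_nonneg h, e.eps_le_mul h]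

theorem exists_mem_prune_or_innerGap_le (h : Regular K r v) (e : Encloses K r v I a b ε)
    (hcont : ¬ ((prune r K I a b).card ≤ K ∧
      ∀ i ∈ prune r K I a b, reward r b (prune r K I a b) < r i)) :
    (∃ i ∈ prune r K I a b, i ∉ best r K v) ∨ innerGap r K v ≤ 2 * K * ε := by
  refine or_iff_not_imp_left.2 fun hex => ?_
  push Not at hex
  obtain ⟨hcard, -⟩ := isBest_best r K v
  rw [Finset.Subset.antisymm hex (e.best_subset_prune h)] at hcont
  push Not at hcont
  obtain ⟨i, hi, hle⟩ := hcont hcard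
  have hreward : reward r b (best r K v) ≤ optReward r K I b :=
    reward_le_optReward e.best_subset hcard
  linarith [innerGap_le_of_mem_best hi, e.optReward_right_sub_le h]

theorem exists_gap_le (h : Regular K r v) (e : Encloses K r v I a b ε)
    (hcont : ¬ ((prune r K I a b).card ≤ K ∧
      ∀ i ∈ prune r K I a b, reward r b (prune r K I a b) < r i)) :
    ∃ i, gap r K v i ≤ 8 * K * ε := by
  rcases e.exists_mem_prune_or_innerGap_le h hcont with ⟨i, hi, hiB⟩ | hinner
  · exact ⟨i, e.gap_le_of_mem_prune h hi hiB⟩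
  · obtain ⟨i, hi⟩ := h.best_nonempty
    refine ⟨i, ?_⟩
    rw [gap_of_mem_best hi]
    linarith [e.eps_nonneg h, e.eps_le_mul h]

end Encloses

theorem Regular.H₂_nonneg (h : Regular K r v) : 0 ≤ H₂ r K v :=
  (add_nonneg zero_le_one (Finset.sum_nonneg fun j _ => h.v_nonneg j)).trans
    (h.one_add_sum_le_H₂ ∅)

theorem Regular.one_add_sum_best_le_mul_innerGap_sq (h : Regular K r v) :
    1 + ∑ i ∈ best r K v, v i ≤ H₂ r K v * innerGap r K v ^ 2 := by
  obtain ⟨i, hi⟩ := h.best_nonempty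
  have hpos : 0 < innerGap r K v := gap_of_mem_best hi ▸ h.gap_pos i
  have hH := h.sum_add_le_H₂ (best r K v) i
  rw [Finset.sum_congr rfl fun j hj => by rw [gap_of_mem_best hj], gap_of_mem_best hi,
    ← Finset.sum_div, ← add_div, div_le_iff₀ (by positivity)] at hH
  linarith

theorem Regular.one_add_sum_le_mul_sq (h : Regular K r v) (S : Finset (Fin N)) (i : Fin N) :
    1 + ∑ j ∈ S, v j ≤ H₂ r K v * (gap r K v i * (1 + ∑ j ∈ S, v j)) ^ 2 := by
  have hV : 1 ≤ 1 + ∑ j ∈ S, v j :=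
    le_add_of_nonneg_right (Finset.sum_nonneg fun j _ => h.v_nonneg j)
  have hgap := (div_le_iff₀ (pow_pos (h.gap_pos i) 2)).1 (h.one_div_gap_sq_le_H₂ i)
  rw [mul_pow, ← mul_assoc]
  exact (le_self_pow₀ hV two_ne_zero).trans (le_mul_of_one_le_left (by positivity) hgap)

namespace Encloses

theorem sum_best_le_sum_left_add (h : Regular K r v) (e : Encloses K r v I a b ε) :
    ∑ j ∈ best r K v, v j ≤ ∑ j ∈ best r K v, a j + 2 * K * ε := by
  have hsum := sum_le_mul_of_card_le (f := fun j => v j - a j) (by linarith [e.eps_nonneg h])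
    (isBest_best r K v).1 fun j hj => sub_le_iff_le_add'.2 (e.le_left_add j (e.best_subset hj))
  rw [Finset.sum_sub_distrib] at hsum
  linarith

theorem one_add_sum_best_le_of_card_ne (h : Regular K r v) (e : Encloses K r v I a b ε)
    (hcard : (best r K v).card ≠ K) (hi : i ∈ prune r K I a b) (hiB : i ∉ best r K v) :
    1 + ∑ j ∈ best r K v, v j ≤ H₂ r K v * (4 * K * ε) ^ 2 := by
  have hH := h.H₂_nonneg
  rcases le_or_gt (4 * K * ε) 1 with hsmall | hbig
  · refine (h.one_add_sum_le_mul_sq (best r K v) i).trans ?_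
    have hgap := h.gap_pos i
    have hV : 0 ≤ ∑ j ∈ best r K v, v j := Finset.sum_nonneg fun j _ => h.v_nonneg j
    have hle : gap r K v i * (1 + ∑ j ∈ best r K v, v j) ≤ 4 * K * ε := by
      nlinarith [e.gap_mul_le_of_mem_prune h hcard hi hiB, e.sum_best_le_sum_left_add h]
    gcongr
  · exact (h.one_add_sum_le_H₂ _).trans (le_mul_of_one_le_right hH (one_le_pow₀ hbig.le))

theorem one_add_sum_best_le (h : Regular K r v) (e : Encloses K r v I a b ε)
    (hcont : ¬ ((prune r K I a b).card ≤ K ∧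
      ∀ i ∈ prune r K I a b, reward r b (prune r K I a b) < r i)) :
    1 + ∑ i ∈ best r K v, v i ≤ H₂ r K v * (8 * K * ε) ^ 2 := by
  have hε := e.eps_nonneg h
  have hH := h.H₂_nonneg
  have hinner : innerGap r K v ≤ 8 * K * ε →
      1 + ∑ i ∈ best r K v, v i ≤ H₂ r K v * (8 * K * ε) ^ 2 := fun hle => by
    have := h.innerGap_nonneg
    exact h.one_add_sum_best_le_mul_innerGap_sq.trans (by gcongr)
  rcases e.exists_mem_prune_or_innerGap_le h hcont with ⟨i, hi, hiB⟩ | hle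
  · by_cases hcard : (best r K v).card = K
    · exact hinner
        ((h.innerGap_le_gap hcard i).trans (e.gap_le_of_mem_prune_of_card_eq h hcard hi hiB))
    · refine (e.one_add_sum_best_le_of_card_ne h hcard hi hiB).trans ?_
      gcongr
      norm_num
  · exact hinner (by linarith [e.eps_le_mul h])

end Encloses

end Prune

/-! ### A supermartingale bound for the choices of the users -/

/-- Feedback: `env t S` is the choice of the user of pull `t` from the assortment `S`. -/
abbrev Feedback (N : ℕ) := ℕ → Finset (Fin N) → Option (Fin N)

/-- The statistics of an execution that determine the empirical preferences: how often each item
was chosen, and how many no-purchases occurred while it was offered. -/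
structure Counts (N : ℕ) where
  chosen : Fin N → ℕ
  quits : Fin N → ℕ

/-- The counts after the choice `x` from the assortment `S`. -/
def Counts.next {N : ℕ} (k : Counts N) (S : Finset (Fin N)) : Option (Fin N) → Counts N
  | none => { k with quits := fun i => k.quits i + if i ∈ S then 1 else 0 }
  | some x => { k with chosen := Function.update k.chosen x (k.chosen x + 1) }

/-- `Wins K Good Q t k m`: the program `m`, which reads its feedback from pull `t` on with initial
counts `k` and offers at most `K` items at a time, arrives at a result with property `Q` or at
counts that are not `Good`, whatever the users choose. -/
inductive Wins {N : ℕ} {β : Type} (K : ℕ) (Good : Counts N → Prop)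
    (Q : ℕ → Counts N → β → Prop) : ℕ → Counts N → (Feedback N → Option β) → Prop
  | ret {t : ℕ} {k : Counts N} {b : β} (hb : Q t k b) : Wins K Good Q t k fun _ => some b
  | bad {t : ℕ} {k : Counts N} {m : Feedback N → Option β} (hk : ¬ Good k) :
      Wins K Good Q t k m
  | ask {t : ℕ} {k : Counts N} (S : Finset (Fin N)) (hS : S.card ≤ K)
      {m : Option (Fin N) → Feedback N → Option β}
      (hm : ∀ x, (∀ i, x = some i → i ∈ S) → Wins K Good Q (t + 1) (k.next S x) (m x)) :
      Wins K Good Q t k fun env => m (env t S) env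

section Cylinder

variable {N : ℕ} {Ω : Type*} {X : ℕ → Finset (Fin N) → Ω → Option (Fin N)}

/-- The event that the first `t` users behave as prescribed by `B`, where a behaviour is a function
from assortments to choices. -/
def cylinder (X : ℕ → Finset (Fin N) → Ω → Option (Fin N))
    (B : ℕ → Set (Finset (Fin N) → Option (Fin N))) (t : ℕ) : Set Ω :=
  ⋂ n ∈ Finset.range t, (fun ω S => X n S ω) ⁻¹' B n

theorem cylinder_update (B : ℕ → Set (Finset (Fin N) → Option (Fin N))) (t : ℕ)
    (A : Set (Finset (Fin N) → Option (Fin N))) :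
    cylinder X (Function.update B t A) (t + 1) =
      cylinder X B t ∩ (fun ω S => X t S ω) ⁻¹' A := by
  have hpast : cylinder X (Function.update B t A) t = cylinder X B t :=
    Set.iInter₂_congr fun n hn => by
      rw [Function.update_of_ne (Finset.mem_range.1 hn).ne]
  rw [← hpast, cylinder, Finset.range_add_one, Finset.set_biInter_insert, Function.update_self,
    Set.inter_comm]
  rfl

end Cylinder

section Probability

variable {N K : ℕ} {Ω : Type*} [MeasurableSpace Ω] {μ : Measure Ω}
  {v : Fin N → ℝ} {X : ℕ → Finset (Fin N) → Ω → Option (Fin N)}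

theorem measure_cylinder (hX : IsFeedback μ K v X)
    (B : ℕ → Set (Finset (Fin N) → Option (Fin N))) (t : ℕ) :
    μ (cylinder X B t) = ∏ n ∈ Finset.range t, μ ((fun ω S => X n S ω) ⁻¹' B n) :=
  hX.indep.measure_inter_preimage_eq_mul (Finset.range t) fun _ _ => trivial

theorem measure_cylinder_update (hX : IsFeedback μ K v X)
    (B : ℕ → Set (Finset (Fin N) → Option (Fin N))) (t : ℕ) {S : Finset (Fin N)}
    (hS : S.card ≤ K) (x : Option (Fin N)) :
    μ (cylinder X (Function.update B t {f | f S = x}) (t + 1)) =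
      μ (cylinder X B t) * ENNReal.ofReal (choiceProb v S x) := by
  rw [measure_cylinder hX, Finset.prod_range_succ, Function.update_self, measure_cylinder hX,
    ← hX.law t S x hS]
  congr 1
  refine Finset.prod_congr rfl fun n hn => ?_
  rw [Function.update_of_ne (Finset.mem_range.1 hn).ne]

theorem choiceProb_nonneg (hv : ∀ i, 0 ≤ v i) (S : Finset (Fin N)) (x : Option (Fin N)) :
    0 ≤ choiceProb v S x := by
  have hpos := one_add_sum_pos hv S
  cases x with
  | none => exact (one_div_pos.2 hpos).le
  | some i =>
    simp only [choiceProb]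
    split_ifs
    · exact div_nonneg (hv i) hpos.le
    · exact le_rfl

theorem choiceProb_some_of_notMem (v : Fin N → ℝ) {S : Finset (Fin N)} {i : Fin N} (hi : i ∉ S) :
    choiceProb v S (some i) = 0 :=
  if_neg hi

theorem measure_cylinder_inter_le (B : ℕ → Set (Finset (Fin N) → Option (Fin N))) (t : ℕ)
    (S : Finset (Fin N)) (F : Option (Fin N) → Set Ω) :
    μ (cylinder X B t ∩ {ω | ω ∈ F (X t S ω)}) ≤
      ∑ x, μ (cylinder X (Function.update B t {f | f S = x}) (t + 1) ∩ F x) := by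
  refine (measure_mono fun ω hω => ?_).trans (measure_iUnion_fintype_le _ _)
  rw [Set.mem_iUnion]
  refine ⟨X t S ω, ?_, hω.2⟩
  rw [cylinder_update]
  exact ⟨hω.1, rfl⟩

end Probability

namespace Wins

section Programs

variable {N K : ℕ} {β γ : Type} {Good : Counts N → Prop} {Q : ℕ → Counts N → β → Prop}
  {t : ℕ} {k : Counts N} {m : Feedback N → Option β}

theorem bind {Q' : ℕ → Counts N → γ → Prop} {g : Feedback N → β → Option γ}
    (hm : Wins K Good Q t k m)
    (hg : ∀ t' k' b, Q t' k' b → Wins K Good Q' t' k' fun env => g env b) :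
    Wins K Good Q' t k fun env => (m env).bind (g env) := by
  induction hm with
  | ret hb => exact hg _ _ _ hb
  | bad hk => exact .bad hk
  | ask S hS _ ih => exact .ask S hS (m := fun x env => (_ : Option β).bind (g env)) ih

theorem mono {Q' : ℕ → Counts N → β → Prop} (hm : Wins K Good Q t k m)
    (hQ : ∀ t k b, Q t k b → Q' t k b) : Wins K Good Q' t k m := by
  induction hm with
  | ret hb => exact .ret (hQ _ _ _ hb)
  | bad hk => exact .bad hk
  | ask S hS _ ih => exact .ask S hS ih

end Programs

section Probability

variable {N K : ℕ} {Ω : Type*} [MeasurableSpace Ω] {μ : Measure Ω}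
  {v : Fin N → ℝ} {X : ℕ → Finset (Fin N) → Ω → Option (Fin N)}
  {β : Type} {Good : Counts N → Prop} {Q : ℕ → Counts N → β → Prop} {Φ : Counts N → ℝ}

-- Optional stopping for the supermartingale `Φ`, by induction along the program.
theorem measure_cylinder_fail_le (hX : IsFeedback μ K v X) (hv : ∀ i, 0 ≤ v i)
    (hΦ0 : ∀ k, 0 ≤ Φ k) (hΦ : ∀ k S, ∑ x, choiceProb v S x * Φ (k.next S x) ≤ Φ k)
    (hbad : ∀ k, ¬ Good k → 1 ≤ Φ k) {t : ℕ} {k : Counts N} {m : Feedback N → Option β}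
    (hm : Wins K Good Q t k m) (B : ℕ → Set (Finset (Fin N) → Option (Fin N))) :
    μ (cylinder X B t ∩ {ω | ¬ ∃ t' k' b, m (fun t S => X t S ω) = some b ∧ Q t' k' b}) ≤
      μ (cylinder X B t) * ENNReal.ofReal (Φ k) := by
  induction hm generalizing B with
  | @ret t k b hb =>
    have hnever : {ω | ¬ ∃ t' k' b', (some b : Option β) = some b' ∧ Q t' k' b'} = (∅ : Set Ω) :=
      Set.eq_empty_of_forall_notMem fun _ hω => hω ⟨t, k, b, rfl, hb⟩
    rw [hnever, Set.inter_empty, measure_empty]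
    exact zero_le
  | bad hk =>
    exact (measure_mono Set.inter_subset_left).trans
      (le_mul_of_one_le_right' (ENNReal.one_le_ofReal.2 (hbad _ hk)))
  | @ask t k S hS m _ ih =>
    have hchoice : ∀ x, μ (cylinder X (Function.update B t {f | f S = x}) (t + 1) ∩
          {ω | ¬ ∃ t' k' b, m x (fun t S => X t S ω) = some b ∧ Q t' k' b}) ≤
        μ (cylinder X B t) * ENNReal.ofReal (choiceProb v S x * Φ (k.next S x)) := by
      intro x
      rw [ENNReal.ofReal_mul (choiceProb_nonneg hv S x), ← mul_assoc,
        ← measure_cylinder_update hX B t hS x]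
      by_cases hx : ∀ i, x = some i → i ∈ S
      · exact ih x hx _
      · push Not at hx
        obtain ⟨i, rfl, hi⟩ := hx
        refine (measure_mono Set.inter_subset_left).trans ?_
        rw [measure_cylinder_update hX B t hS, choiceProb_some_of_notMem v hi,
          ENNReal.ofReal_zero, mul_zero]
        exact zero_le
    refine (measure_cylinder_inter_le B t S _).trans
      ((Finset.sum_le_sum fun x _ => hchoice x).trans ?_)
    rw [← Finset.mul_sum, ← ENNReal.ofReal_sum_of_nonneg fun x _ =>
      mul_nonneg (choiceProb_nonneg hv S x) (hΦ0 _)]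
    gcongr
    exact hΦ k S

theorem ofReal_one_sub_le_measure [IsProbabilityMeasure μ] (hX : IsFeedback μ K v X)
    (hv : ∀ i, 0 ≤ v i) (hΦ0 : ∀ k, 0 ≤ Φ k)
    (hΦ : ∀ k S, ∑ x, choiceProb v S x * Φ (k.next S x) ≤ Φ k)
    (hbad : ∀ k, ¬ Good k → 1 ≤ Φ k) {k : Counts N} {m : Feedback N → Option β}
    (hm : Wins K Good Q 0 k m) :
    ENNReal.ofReal (1 - Φ k) ≤ μ {ω | ∃ t' k' b, m (fun t S => X t S ω) = some b ∧ Q t' k' b} := by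
  set success := {ω | ∃ t' k' b, m (fun t S => X t S ω) = some b ∧ Q t' k' b}
  have hfail : μ successᶜ ≤ ENNReal.ofReal (Φ k) := by
    have hle := hm.measure_cylinder_fail_le hX hv hΦ0 hΦ hbad fun _ => Set.univ
    simp only [cylinder, Finset.range_zero, Finset.notMem_empty, Set.iInter_of_empty,
      Set.iInter_univ, Set.univ_inter, measure_univ, one_mul] at hle
    exact hle
  rw [ENNReal.ofReal_sub _ (hΦ0 k), ENNReal.ofReal_one, tsub_le_iff_right]
  calc (1 : ENNReal) = μ (success ∪ successᶜ) := by rw [Set.union_compl_self, measure_univ]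
    _ ≤ μ success + μ successᶜ := measure_union_le _ _
    _ ≤ μ success + ENNReal.ofReal (Φ k) := by gcongr

end Probability

end Wins

section ExpWeight

variable {N : ℕ} {v : Fin N → ℝ}

/-- The exponential martingale of item `i` with base `y`: between two no-purchases item `i` is
chosen a geometric number `f` of times, and `𝔼 [y ^ f] = 1 / (1 + v i * (1 - y))`. -/
noncomputable def expWeight (v : Fin N → ℝ) (y : ℝ) (i : Fin N) (k : Counts N) : ℝ :=
  y ^ k.chosen i * (1 + v i * (1 - y)) ^ k.quits i

theorem expWeight_next_none (y : ℝ) (i : Fin N) (k : Counts N) (S : Finset (Fin N)) :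
    expWeight v y i (k.next S none) =
      (if i ∈ S then 1 + v i * (1 - y) else 1) * expWeight v y i k := by
  simp only [expWeight, Counts.next]
  split_ifs
  · rw [pow_succ]; ring
  · rw [add_zero, one_mul]

theorem expWeight_next_some (y : ℝ) (i j : Fin N) (k : Counts N) (S : Finset (Fin N)) :
    expWeight v y i (k.next S (some j)) = (if j = i then y else 1) * expWeight v y i k := by
  simp only [expWeight, Counts.next]
  by_cases hji : j = i
  · rw [hji, Function.update_self, pow_succ, if_pos rfl]; ring
  · rw [Function.update_of_ne (Ne.symm hji), if_neg hji, one_mul]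

theorem sum_choiceProb_some_mul (v : Fin N → ℝ) (S : Finset (Fin N)) (g : Fin N → ℝ) :
    ∑ j, choiceProb v S (some j) * g j = (∑ j ∈ S, v j * g j) / (1 + ∑ j ∈ S, v j) := by
  simp only [choiceProb, ite_mul, zero_mul, Finset.sum_ite_mem, Finset.univ_inter, Finset.sum_div,
    div_mul_eq_mul_div]

theorem sum_choiceProb_mul_expWeight (hv : ∀ i, 0 ≤ v i) (y : ℝ) (i : Fin N) (k : Counts N)
    (S : Finset (Fin N)) :
    ∑ x, choiceProb v S x * expWeight v y i (k.next S x) = expWeight v y i k := by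
  have hpos := one_add_sum_pos hv S
  have hsum : ∑ j ∈ S, v j * (if j = i then y else 1) =
      (∑ j ∈ S, v j) + if i ∈ S then v i * (y - 1) else 0 := by
    rw [← Finset.sum_ite_eq' S i fun j => v j * (y - 1), ← Finset.sum_add_distrib]
    refine Finset.sum_congr rfl fun j _ => ?_
    split_ifs <;> ring
  rw [Fintype.sum_option, expWeight_next_none]
  simp only [expWeight_next_some, ← mul_assoc]
  rw [← Finset.sum_mul, sum_choiceProb_some_mul, hsum]
  simp only [choiceProb]
  split_ifs <;> field_simp <;> ring

end ExpWeight

theorem abs_exp_sub_one_sub_le {x : ℝ} (hx : |x| ≤ 1 / 8) :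
    |Real.exp x - 1 - x| ≤ 3 / 5 * x ^ 2 := by
  have htaylor := Real.exp_bound (x := x) (by linarith) (n := 3) (by norm_num)
  simp only [Finset.sum_range_succ, Finset.sum_range_zero] at htaylor
  norm_num [Nat.factorial] at htaylor
  have hcube : |x| ^ 3 ≤ 1 / 8 * x ^ 2 := by
    rw [← sq_abs x, pow_succ]
    nlinarith [sq_nonneg |x|]
  rw [abs_le] at htaylor ⊢
  constructor <;> nlinarith [sq_nonneg x]

theorem exp_neg_le_one_add_mul {x l : ℝ} (hx0 : 0 ≤ x) (hx1 : x ≤ 1) (hl : |l| ≤ 1 / 32) :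
    Real.exp (-(l * x + 2 * l ^ 2)) ≤ 1 + x * (1 - Real.exp l) := by
  have habs : |-(l * x + 2 * l ^ 2)| ≤ 17 / 16 * |l| := by
    rw [abs_neg]
    calc |l * x + 2 * l ^ 2| ≤ |l * x| + |2 * l ^ 2| := abs_add_le _ _
      _ = |l| * x + 2 * (|l| * |l|) := by
        rw [abs_mul, abs_of_nonneg hx0, abs_of_nonneg (by positivity : 0 ≤ 2 * l ^ 2), ← sq_abs,
          sq]
      _ ≤ 17 / 16 * |l| := by nlinarith [abs_nonneg l]
  have hsq : (-(l * x + 2 * l ^ 2)) ^ 2 ≤ (17 / 16) ^ 2 * l ^ 2 := by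
    rwa [← mul_pow, sq_le_sq, abs_mul, abs_of_pos (by norm_num : (0 : ℝ) < 17 / 16)]
  have hleft := (abs_le.1 (abs_exp_sub_one_sub_le (habs.trans (by linarith)))).2
  have hright := (abs_le.1 (abs_exp_sub_one_sub_le (hl.trans (by norm_num)))).2
  have hmul : x * (Real.exp l - 1 - l) ≤ 1 * (3 / 5 * l ^ 2) :=
    mul_le_mul hx1 hright (by linarith [Real.add_one_le_exp l]) zero_le_one
  linarith [sq_nonneg l]

section ExpWeight

variable {N : ℕ} {v : Fin N → ℝ} {i : Fin N} {l : ℝ}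

theorem exp_le_expWeight (hv0 : 0 ≤ v i) (hv1 : v i ≤ 1) (hl : |l| ≤ 1 / 32) (k : Counts N) :
    Real.exp (l * k.chosen i - k.quits i * (l * v i + 2 * l ^ 2)) ≤
      expWeight v (Real.exp l) i k := by
  calc Real.exp (l * k.chosen i - k.quits i * (l * v i + 2 * l ^ 2))
      = Real.exp l ^ k.chosen i * Real.exp (-(l * v i + 2 * l ^ 2)) ^ k.quits i := by
        rw [← Real.exp_nat_mul, ← Real.exp_nat_mul, ← Real.exp_add]
        ring_nf
    _ ≤ expWeight v (Real.exp l) i k := by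
        unfold expWeight
        gcongr
        exact exp_neg_le_one_add_mul hv0 hv1 hl

end ExpWeight

theorem accuracy_pos (τ : ℕ) : 0 < accuracy τ := by
  unfold accuracy
  positivity

theorem accuracy_le (τ : ℕ) : accuracy τ ≤ 1 / 8 :=
  calc ((1 : ℝ) / 2) ^ (τ + 3) ≤ (1 / 2) ^ 3 :=
        pow_le_pow_of_le_one (by norm_num) (by norm_num) (by omega)
    _ = 1 / 8 := by norm_num

theorem accuracy_succ (τ : ℕ) : accuracy τ = 2 * accuracy (τ + 1) := by
  unfold accuracy
  rw [show τ + 1 + 3 = τ + 3 + 1 by ring, pow_succ]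
  ring

/-- The number whose logarithm determines the schedule in round `τ`. Its inverse bounds the
probability that one tail of one empirical preference is too large in that round. -/
noncomputable def level (N : ℕ) (δ : ℝ) (τ : ℕ) : ℝ := 16 * N * ((τ : ℝ) + 1) ^ 2 / δ

theorem level_pos {N : ℕ} (hN : 1 ≤ N) {δ : ℝ} (hδ : 0 < δ) (τ : ℕ) : 0 < level N δ τ := by
  have hN' : (0 : ℝ) < N := by exact_mod_cast hN
  unfold level
  positivity

theorem level_le_exp {N : ℕ} (hN : 1 ≤ N) {δ : ℝ} (hδ : 0 < δ) (τ : ℕ) :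
    level N δ τ ≤ Real.exp (schedule N δ τ * accuracy τ ^ 2 / 8) := by
  rw [← Real.log_le_iff_le_exp (level_pos hN hδ τ)]
  have hceil : 8 / accuracy τ ^ 2 * Real.log (level N δ τ) ≤ schedule N δ τ := Nat.le_ceil _
  rw [div_mul_eq_mul_div, div_le_iff₀ (pow_pos (accuracy_pos τ) 2)] at hceil
  linarith

/-- The counts agree with the preferences, within the accuracies of the first `L` rounds. The upper
tail is also controlled between two explorations, which bounds the number of pulls. -/
def Accurate {N : ℕ} (v : Fin N → ℝ) (δ : ℝ) (L : ℕ) (k : Counts N) : Prop :=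
  ∀ τ < L, ∀ i,
    (k.quits i ≤ schedule N δ τ → (k.chosen i : ℝ) ≤ schedule N δ τ * (v i + accuracy τ)) ∧
    (k.quits i = schedule N δ τ → schedule N δ τ * (v i - accuracy τ) ≤ (k.chosen i : ℝ))

/-- The exponential weight of both tails of the empirical preference of item `i` in round `τ`. -/
noncomputable def tailWeight {N : ℕ} (v : Fin N → ℝ) (τ : ℕ) (i : Fin N) (k : Counts N) : ℝ :=
  expWeight v (Real.exp (accuracy τ / 4)) i k + expWeight v (Real.exp (-(accuracy τ / 4))) i k

/-- The supermartingale that controls all empirical preferences of the first `L` rounds. -/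
noncomputable def potential {N : ℕ} (v : Fin N → ℝ) (δ : ℝ) (L : ℕ) (k : Counts N) : ℝ :=
  ∑ τ ∈ Finset.range L, ∑ i, tailWeight v τ i k / level N δ τ

theorem abs_accuracy_div_four_le (τ : ℕ) : |accuracy τ / 4| ≤ 1 / 32 := by
  rw [abs_of_pos (by linarith [accuracy_pos τ])]
  linarith [accuracy_le τ]

section Potential

variable {N : ℕ} {v : Fin N → ℝ} {δ : ℝ}

theorem tailWeight_nonneg {i : Fin N} (hv0 : 0 ≤ v i) (hv1 : v i ≤ 1) (τ : ℕ) (k : Counts N) :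
    0 ≤ tailWeight v τ i k := by
  have hl := abs_accuracy_div_four_le τ
  exact add_nonneg ((Real.exp_pos _).le.trans (exp_le_expWeight hv0 hv1 hl k))
    ((Real.exp_pos _).le.trans (exp_le_expWeight hv0 hv1 ((abs_neg _).trans_le hl) k))

theorem exp_le_tailWeight_of_lt {i : Fin N} (hv0 : 0 ≤ v i) (hv1 : v i ≤ 1) {k : Counts N}
    {T τ : ℕ} (hquits : k.quits i ≤ T) (hchosen : T * (v i + accuracy τ) < k.chosen i) :
    Real.exp (T * accuracy τ ^ 2 / 8) ≤ tailWeight v τ i k := by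
  have hl := abs_accuracy_div_four_le τ
  have hε := accuracy_pos τ
  refine le_add_of_le_of_nonneg ?_
    ((Real.exp_pos _).le.trans (exp_le_expWeight hv0 hv1 ((abs_neg _).trans_le hl) k))
  refine (Real.exp_le_exp.2 ?_).trans (exp_le_expWeight hv0 hv1 hl k)
  set l := accuracy τ / 4 with hl_def
  calc T * accuracy τ ^ 2 / 8
      = l * (T * (v i + accuracy τ)) - T * (l * v i + 2 * l ^ 2) := by rw [hl_def]; ring
    _ ≤ l * k.chosen i - k.quits i * (l * v i + 2 * l ^ 2) := by gcongr

theorem exp_le_tailWeight_of_gt {i : Fin N} (hv0 : 0 ≤ v i) (hv1 : v i ≤ 1) {k : Counts N}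
    {T τ : ℕ} (hquits : k.quits i = T) (hchosen : k.chosen i < T * (v i - accuracy τ)) :
    Real.exp (T * accuracy τ ^ 2 / 8) ≤ tailWeight v τ i k := by
  have hl := abs_accuracy_div_four_le τ
  have hε := accuracy_pos τ
  refine le_add_of_nonneg_of_le ((Real.exp_pos _).le.trans (exp_le_expWeight hv0 hv1 hl k)) ?_
  refine (Real.exp_le_exp.2 ?_).trans (exp_le_expWeight hv0 hv1 ((abs_neg _).trans_le hl) k)
  rw [hquits]
  set l := accuracy τ / 4 with hl_def
  calc T * accuracy τ ^ 2 / 8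
      = -(l * (T * (v i - accuracy τ))) - T * (-l * v i + 2 * (-l) ^ 2) := by rw [hl_def]; ring
    _ ≤ -(l * k.chosen i) - T * (-l * v i + 2 * (-l) ^ 2) := by gcongr
    _ = -l * k.chosen i - T * (-l * v i + 2 * (-l) ^ 2) := by ring

theorem tailWeight_div_level_nonneg (hv0 : ∀ i, 0 ≤ v i) (hv1 : ∀ i, v i ≤ 1) (hN : 1 ≤ N)
    (hδ : 0 < δ) (τ : ℕ) (i : Fin N) (k : Counts N) : 0 ≤ tailWeight v τ i k / level N δ τ :=
  div_nonneg (tailWeight_nonneg (hv0 i) (hv1 i) τ k) (level_pos hN hδ τ).le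

theorem potential_nonneg (hv0 : ∀ i, 0 ≤ v i) (hv1 : ∀ i, v i ≤ 1) (hN : 1 ≤ N) (hδ : 0 < δ)
    (L : ℕ) (k : Counts N) : 0 ≤ potential v δ L k :=
  Finset.sum_nonneg fun τ _ => Finset.sum_nonneg fun i _ =>
    tailWeight_div_level_nonneg hv0 hv1 hN hδ τ i k

theorem sum_choiceProb_mul_potential (hv : ∀ i, 0 ≤ v i) (δ : ℝ) (L : ℕ) (k : Counts N)
    (S : Finset (Fin N)) :
    ∑ x, choiceProb v S x * potential v δ L (k.next S x) = potential v δ L k := by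
  simp only [potential, Finset.mul_sum]
  rw [Finset.sum_comm]
  refine Finset.sum_congr rfl fun τ _ => ?_
  rw [Finset.sum_comm]
  refine Finset.sum_congr rfl fun i _ => ?_
  simp only [tailWeight, ← mul_div_assoc, mul_add, ← Finset.sum_div, Finset.sum_add_distrib,
    sum_choiceProb_mul_expWeight hv]

theorem tailWeight_div_level_le_potential (hv0 : ∀ i, 0 ≤ v i) (hv1 : ∀ i, v i ≤ 1) (hN : 1 ≤ N)
    (hδ : 0 < δ) {L τ : ℕ} (hτ : τ < L) (i : Fin N) (k : Counts N) :
    tailWeight v τ i k / level N δ τ ≤ potential v δ L k := by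
  have hterm := fun τ i => tailWeight_div_level_nonneg hv0 hv1 hN hδ τ i k
  calc tailWeight v τ i k / level N δ τ ≤ ∑ i, tailWeight v τ i k / level N δ τ :=
        Finset.single_le_sum (fun i _ => hterm τ i) (Finset.mem_univ i)
    _ ≤ potential v δ L k :=
        Finset.single_le_sum (f := fun τ => ∑ i, tailWeight v τ i k / level N δ τ)
          (fun τ _ => Finset.sum_nonneg fun i _ => hterm τ i) (Finset.mem_range.2 hτ)

theorem one_le_potential (hv0 : ∀ i, 0 ≤ v i) (hv1 : ∀ i, v i ≤ 1) (hN : 1 ≤ N) (hδ : 0 < δ)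
    {L : ℕ} {k : Counts N} (hk : ¬ Accurate v δ L k) : 1 ≤ potential v δ L k := by
  unfold Accurate at hk
  push Not at hk
  obtain ⟨τ, hτ, i, htails⟩ := hk
  refine le_trans ?_ (tailWeight_div_level_le_potential hv0 hv1 hN hδ hτ i k)
  rw [one_le_div (level_pos hN hδ τ)]
  refine (level_le_exp hN hδ τ).trans ?_
  by_cases hupper : k.quits i ≤ schedule N δ τ →
      (k.chosen i : ℝ) ≤ schedule N δ τ * (v i + accuracy τ)
  · obtain ⟨hquits, hchosen⟩ := htails hupper
    exact exp_le_tailWeight_of_gt (hv0 i) (hv1 i) hquits hchosen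
  · push Not at hupper
    exact exp_le_tailWeight_of_lt (hv0 i) (hv1 i) hupper.1 hupper.2

theorem sum_range_one_div_sq_le_two (L : ℕ) :
    ∑ τ ∈ Finset.range L, 1 / ((τ : ℝ) + 1) ^ 2 ≤ 2 := by
  have hIoo : Finset.Ioo 0 (L + 1) = Finset.Ico (0 + 1) (L + 1) := by
    ext
    simp [Nat.succ_le_iff]
  have hle : ∑ i ∈ Finset.Ioo 0 (L + 1), ((i : ℝ) ^ 2)⁻¹ ≤ 2 := by
    simpa using sum_Ioo_inv_sq_le (α := ℝ) 0 (L + 1)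
  rw [hIoo, ← Finset.sum_Ico_add' (fun i : ℕ => ((i : ℝ) ^ 2)⁻¹)] at hle
  simpa using hle

theorem potential_zero_le (hN : 1 ≤ N) (hδ : 0 ≤ δ) (L : ℕ) :
    potential v δ L ⟨fun _ => 0, fun _ => 0⟩ ≤ δ := by
  have hN' : (0 : ℝ) < N := by exact_mod_cast hN
  calc potential v δ L ⟨fun _ => 0, fun _ => 0⟩
      = δ / 8 * ∑ τ ∈ Finset.range L, 1 / ((τ : ℝ) + 1) ^ 2 := by
        rw [Finset.mul_sum]
        refine Finset.sum_congr rfl fun τ _ => ?_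
        simp only [tailWeight, expWeight, pow_zero, mul_one, level, Finset.sum_const,
          Finset.card_univ, Fintype.card_fin, nsmul_eq_mul]
        field_simp
        ring
    _ ≤ δ / 8 * 2 := by gcongr; exact sum_range_one_div_sq_le_two L
    _ ≤ δ := by linarith

end Potential

/-! ### Executions of the algorithm -/

/-- Hoare triples for executions: started with the ledger `s` and the counts `k`, the execution `m`
arrives at counts, a result and a ledger with property `Q`, or at counts that are not `Good`. -/
def Runs {N : ℕ} {α : Type} (K : ℕ) (Good : Counts N → Prop) (m : Feedback N → Exec N α)
    (s : Ledger N) (k : Counts N) (Q : Counts N → α → Ledger N → Prop) : Prop :=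
  Wins K Good (fun t k' (p : α × Ledger N) => p.2.pulls = t ∧ Q k' p.1 p.2) s.pulls k
    fun env => m env s

namespace Runs

variable {N K : ℕ} {α β : Type} {Good : Counts N → Prop} {s : Ledger N} {k : Counts N}

theorem bad {m : Feedback N → Exec N α} {Q : Counts N → α → Ledger N → Prop} (hk : ¬ Good k) :
    Runs K Good m s k Q :=
  Wins.bad hk

theorem mono {m : Feedback N → Exec N α} {Q Q' : Counts N → α → Ledger N → Prop}
    (hm : Runs K Good m s k Q) (hQ : ∀ k' a s', Q k' a s' → Q' k' a s') : Runs K Good m s k Q' :=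
  Wins.mono hm fun _ k' p hp => ⟨hp.1, hQ k' p.1 p.2 hp.2⟩

theorem bind {m : Feedback N → Exec N α} {g : Feedback N → α → Exec N β}
    {Q : Counts N → α → Ledger N → Prop} {Q' : Counts N → β → Ledger N → Prop}
    (hm : Runs K Good m s k Q)
    (hg : ∀ k' a s', Q k' a s' → Runs K Good (fun env => g env a) s' k' Q') :
    Runs K Good (fun env => m env >>= g env) s k Q' := by
  refine Wins.bind (g := fun env p => g env p.1 p.2) hm ?_
  rintro _ k' ⟨a, s'⟩ ⟨rfl, hQ⟩
  exact hg k' a s' hQ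

theorem pure {a : α} {Q : Counts N → α → Ledger N → Prop} (hQ : Q k a s) :
    Runs K Good (fun _ => (Pure.pure a : Exec N α)) s k Q :=
  Wins.ret ⟨rfl, hQ⟩

theorem perform {x : Timed α} {Q : Counts N → α → Ledger N → Prop}
    (hQ : Q k x.val { s with time := s.time + x.cost }) :
    Runs K Good (fun _ => MNL.perform x) s k Q :=
  Wins.ret ⟨rfl, hQ⟩

theorem perform_bind {x : Timed α} {g : Feedback N → α → Exec N β}
    {Q : Counts N → β → Ledger N → Prop}
    (hg : Runs K Good (fun env => g env x.val) { s with time := s.time + x.cost } k Q) :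
    Runs K Good (fun env => MNL.perform x >>= g env) s k Q :=
  hg

theorem get_bind {g : Feedback N → Ledger N → Exec N β} {Q : Counts N → β → Ledger N → Prop}
    (hg : Runs K Good (fun env => g env s) s k Q) :
    Runs K Good (fun env => get >>= g env) s k Q :=
  hg

theorem pull_bind {S : List (Fin N)} (hS : S.length ≤ K)
    {g : Feedback N → Option (Fin N) → Exec N β} {Q : Counts N → β → Ledger N → Prop}
    (hg : ∀ x, (∀ i, x = some i → i ∈ S) → Runs K Good (fun env => g env x)
      { hist := x :: s.hist, time := s.time + (S.length + 1) } (k.next S.toFinset x) Q) :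
    Runs K Good (fun env => pull env S >>= g env) s k Q := by
  refine Wins.ask S.toFinset ((List.toFinset_card_le S).trans hS)
    (m := fun x env => g env x { hist := x :: s.hist, time := s.time + (S.length + 1) }) ?_
  exact fun x hx => hg x fun i hi => List.mem_toFinset.1 (hx i hi)

end Runs

theorem Counts.sum_chosen_next_some {N : ℕ} (k : Counts N) (S : Finset (Fin N)) (x : Fin N) :
    ∑ i, (k.next S (some x)).chosen i = ∑ i, k.chosen i + 1 := by
  simp only [Counts.next]
  rw [Finset.sum_update_of_mem (Finset.mem_univ x), ← Finset.add_sum_erase _ _ (Finset.mem_univ x),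
    Finset.erase_eq]
  ring

/-- The statistics kept by the algorithm when the counts are `k`. -/
def Counts.toStats {N : ℕ} (k : Counts N) : Stats N := ⟨k.chosen, k.quits⟩

/-- What `p` explorations, `e i` of them with item `i`, do to ledger and counts: they end with a
no-purchase each, all other pulls are purchases of explored items, and they take at most `c` steps
per pull and `d` more. -/
structure Explored {N : ℕ} (c : ℕ) (e : Fin N → ℕ) (p d : ℕ) (s : Ledger N) (k : Counts N)
    (s' : Ledger N) (k' : Counts N) : Prop where
  chosen_eq : ∀ i, e i = 0 → k'.chosen i = k.chosen i
  quits_eq : ∀ i, k'.quits i = k.quits i + e i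
  pulls_eq : s'.pulls + ∑ i, k.chosen i = s.pulls + p + ∑ i, k'.chosen i
  le_pulls : s.pulls + p ≤ s'.pulls
  time_le : s'.time + c * s.pulls ≤ s.time + c * s'.pulls + d

namespace Explored

variable {N c p d : ℕ} {e : Fin N → ℕ} {s s₁ s' : Ledger N} {k k₁ k' : Counts N}

theorem charge (c t : ℕ) (s : Ledger N) (k : Counts N) :
    Explored c 0 0 t s k { s with time := s.time + t } k where
  chosen_eq _ _ := rfl
  quits_eq _ := rfl
  pulls_eq := rfl
  le_pulls := le_rfl
  time_le := by simp only [Ledger.pulls]; omega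

theorem trans {p₁ d₁ : ℕ} {e₁ : Fin N → ℕ} (h₁ : Explored c e₁ p₁ d₁ s k s₁ k₁)
    (h : Explored c e p d s₁ k₁ s' k') : Explored c (e₁ + e) (p₁ + p) (d₁ + d) s k s' k' where
  chosen_eq i hi := by
    rw [Pi.add_apply, Nat.add_eq_zero_iff] at hi
    rw [h.chosen_eq i hi.2, h₁.chosen_eq i hi.1]
  quits_eq i := by rw [h.quits_eq, h₁.quits_eq, Pi.add_apply, add_assoc]
  pulls_eq := by linarith [h.pulls_eq, h₁.pulls_eq]
  le_pulls := by linarith [h.le_pulls, h₁.le_pulls]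
  time_le := by linarith [h.time_le, h₁.time_le]

/-- A larger rate leaves room for further steps around the explorations. -/
theorem mono_rate {a b x : ℕ} {s₀ : Ledger N} (h : Explored c e p 0 s k s' k')
    (hs₀ : s = { s₀ with time := s₀.time + a }) (hx : a + b ≤ x * p) :
    Explored (c + x) e p 0 s₀ k { s' with time := s'.time + b } k' where
  chosen_eq := h.chosen_eq
  quits_eq := h.quits_eq
  pulls_eq := by simpa only [hs₀, Ledger.pulls] using h.pulls_eq
  le_pulls := by simpa only [hs₀, Ledger.pulls] using h.le_pulls
  time_le := by
    have htime := h.time_le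
    have hpulls := Nat.mul_le_mul_left x h.le_pulls
    simp only [hs₀, Ledger.pulls, add_mul, mul_add] at htime hpulls ⊢
    linarith

theorem quit {S : List (Fin N)} {t : ℕ} (ht : t ≤ c) (s : Ledger N) (k : Counts N) :
    Explored c (fun i => if i ∈ S then 1 else 0) 1 0 s k
      { hist := none :: s.hist, time := s.time + t } (k.next S.toFinset none) where
  chosen_eq _ _ := rfl
  quits_eq i := by simp only [Counts.next, List.mem_toFinset]
  pulls_eq := rfl
  le_pulls := le_rfl
  time_le := by
    simp only [Ledger.pulls, List.length_cons, mul_add]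
    omega

theorem purchase {S : Finset (Fin N)} {t : ℕ} {x : Fin N} (hx : e x ≠ 0) (ht : t ≤ c)
    (h : Explored c e p d { hist := some x :: s.hist, time := s.time + t }
      (k.next S (some x)) s' k') : Explored c e p d s k s' k' where
  chosen_eq i hi := by
    have hix : i ≠ x := fun hix => hx (hix ▸ hi)
    rw [h.chosen_eq i hi, Counts.next]
    exact Function.update_of_ne hix _ _
  quits_eq := h.quits_eq
  pulls_eq := by
    have hpulls := h.pulls_eq
    rw [Counts.sum_chosen_next_some] at hpulls
    simp only [Ledger.pulls, List.length_cons] at hpulls ⊢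
    omega
  le_pulls := by
    have hpulls := h.le_pulls
    simp only [Ledger.pulls, List.length_cons] at hpulls ⊢
    omega
  time_le := by
    have htime := h.time_le
    simp only [Ledger.pulls, List.length_cons, mul_add] at htime ⊢
    omega

end Explored

section Exploration

variable {N K : ℕ} {Good : Counts N → Prop} {T M fuel : ℕ}

theorem exploreLoop_runs {S : List (Fin N)} (hSK : S.length ≤ K) (hSN : S.length ≤ N)
    (hM : ∀ k : Counts N, Good k → (∀ i, k.quits i ≤ T) → ∑ i, k.chosen i ≤ M)
    (f : Fin N → ℕ) (s : Ledger N) (k : Counts N) (hk : ∀ i, k.quits i ≤ T)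
    (hfuel : M < fuel + ∑ i, k.chosen i) :
    Runs K Good (fun env => exploreLoop env S fuel f) s k fun k' f' s' =>
      (∀ i, k'.chosen i + f i = k.chosen i + f' i) ∧
        Explored (3 * N + 5) (fun i => if i ∈ S then 1 else 0) 1 0 s k s' k' := by
  induction fuel generalizing f s k with
  | zero =>
    refine Runs.bad fun hgood => ?_
    have hle := hM k hgood hk
    omega
  | succ fuel ih =>
    refine Runs.pull_bind hSK fun x hx => ?_
    cases x with
    | none =>
      refine Runs.perform ⟨fun i => rfl, ?_⟩
      simpa only [add_assoc] using .quit (t := S.length + 1 + 1) (by omega) s k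
    | some x =>
      have hxS : x ∈ S := hx x rfl
      refine Runs.perform_bind ((ih _ _ (k.next S.toFinset (some x)) hk ?_).mono ?_)
      · rw [Counts.sum_chosen_next_some]
        omega
      · rintro k' f' s' ⟨hchosen, hexplored⟩
        rw [val_step, if_pos hxS] at hchosen
        refine ⟨fun i => ?_, ?_⟩
        · have hi := hchosen i
          simp only [Counts.next] at hi
          rcases eq_or_ne i x with rfl | hix
          · rw [Function.update_self, Function.update_self] at hi
            omega
          · rwa [Function.update_of_ne hix, Function.update_of_ne hix] at hi
        · simp only [cost_step, add_assoc] at hexplored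
          exact hexplored.purchase (by rw [if_pos hxS]; exact one_ne_zero) (by omega)

/-- The update of the statistics after an exploration that returned `f`, as in `exploreTimes`. -/
def record (f : Fin N → ℕ) (i : Fin N) (st : Stats N) : Timed (Stats N) :=
  step 8 { sum := Function.update st.sum i (st.sum i + f i)
           calls := Function.update st.calls i (st.calls i + 1) }

theorem foldT_record_val (f : Fin N → ℕ) {S : List (Fin N)} (hS : S.Nodup) (st : Stats N) :
    (foldT (record f) st S).val =
      { sum := fun i => st.sum i + if i ∈ S then f i else 0
        calls := fun i => st.calls i + if i ∈ S then 1 else 0 } := by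
  rw [foldT_val]
  induction S with
  | nil => simp
  | cons x S ih =>
    rw [List.nodup_cons] at hS
    rw [List.foldr_cons, ih hS.2]
    simp only [record, val_step, hS.1, if_false, add_zero, Stats.mk.injEq]
    constructor <;> funext i <;> rcases eq_or_ne i x with rfl | hix <;> simp [*]

theorem foldT_record_val_eq_toStats {f : Fin N → ℕ} {S : List (Fin N)} (hS : S.Nodup)
    {k k' : Counts N} (hchosen : ∀ i ∈ S, k'.chosen i = k.chosen i + f i)
    (hother : ∀ i ∉ S, k'.chosen i = k.chosen i)
    (hquits : ∀ i, k'.quits i = k.quits i + if i ∈ S then 1 else 0) :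
    (foldT (record f) k.toStats S).val = k'.toStats := by
  rw [foldT_record_val f hS, Counts.toStats, Stats.mk.injEq]
  refine ⟨funext fun i => ?_, funext fun i => (hquits i).symm⟩
  split_ifs with hi
  · exact (hchosen i hi).symm
  · exact (hother i hi).symm

theorem exploreTimes_runs {S : List (Fin N)} (hSK : S.length ≤ K) (hS : S.Nodup)
    (hM : ∀ k : Counts N, Good k → (∀ i, k.quits i ≤ T) → ∑ i, k.chosen i ≤ M) (hfuel : M < fuel)
    (n : ℕ) (s : Ledger N) (k : Counts N) (hk : ∀ i, k.quits i + (if i ∈ S then n else 0) ≤ T) :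
    Runs K Good (fun env => exploreTimes fuel env S n k.toStats) s k fun k' st' s' =>
      st' = k'.toStats ∧
        Explored (14 * N + 9) (fun i => if i ∈ S then n else 0) n 1 s k s' k' := by
  have hSN : S.length ≤ N := by simpa using hS.length_le_card
  induction n generalizing s k with
  | zero =>
    refine Runs.perform ⟨rfl, ?_⟩
    simp only [ite_self]
    exact .charge _ 1 s k
  | succ n ih =>
    unfold exploreTimes exploreSet
    refine Runs.bind (Runs.perform_bind (exploreLoop_runs hSK hSN hM _ _ k
      (fun i => (Nat.le_add_right _ _).trans (hk i)) (by omega))) ?_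
    rintro k₁ f s₁ ⟨hchosen, hexplored⟩
    refine Runs.perform_bind (Runs.perform_bind ?_)
    suffices Runs K Good (fun env => exploreTimes fuel env S n (foldT (record f) k.toStats S).val)
      { s₁ with time := s₁.time + ((foldT (record f) k.toStats S).cost + 2) } k₁ _ from this
    rw [foldT_record_val_eq_toStats hS (fun i _ => hchosen i)
      (fun i hi => hexplored.chosen_eq i (if_neg hi)) hexplored.quits_eq]
    have hcost := foldT_cost_le (record f) k.toStats (l := S) (c := 8) fun _ _ _ => le_rfl
    have honce := hexplored.mono_rate (x := 11 * N + 4)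
      (b := (foldT (record f) k.toStats S).cost + 2) rfl (by rw [cost_step]; omega)
    rw [show 3 * N + 5 + (11 * N + 4) = 14 * N + 9 by ring] at honce
    refine (ih _ k₁ fun i => ?_).mono ?_
    · have hi := hk i
      rw [hexplored.quits_eq]
      split_ifs at hi ⊢ <;> omega
    · rintro k' st' s' ⟨hst', hrest⟩
      refine ⟨hst', ?_⟩
      convert honce.trans hrest using 1
      · ext i
        simp only [Pi.add_apply]
        split_ifs <;> omega
      · omega

theorem exploreBlocks_runs (hM : ∀ k : Counts N, Good k → (∀ i, k.quits i ≤ T) →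
      ∑ i, k.chosen i ≤ M) (hfuel : M < fuel) (n : ℕ) {Ss : List (List (Fin N))}
    (hSs : ∀ S ∈ Ss, S.length ≤ K) (hnodup : Ss.flatten.Nodup) (s : Ledger N) (k : Counts N)
    (hk : ∀ i, k.quits i + (if i ∈ Ss.flatten then n else 0) ≤ T) :
    Runs K Good (fun env => exploreBlocks fuel env n Ss k.toStats) s k fun k' st' s' =>
      st' = k'.toStats ∧
        Explored (14 * N + 9) (fun i => if i ∈ Ss.flatten then n else 0) (n * Ss.length)
          (3 * Ss.length + 1) s k s' k' := by
  induction Ss generalizing s k with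
  | nil =>
    refine Runs.perform ⟨rfl, ?_⟩
    simp only [List.flatten_nil, List.not_mem_nil, if_false]
    exact .charge _ 1 s k
  | cons S Ss ih =>
    rw [List.flatten_cons, List.nodup_append'] at hnodup
    obtain ⟨hS, hSs_nodup, hdisj⟩ := hnodup
    have hsplit : (fun i => if i ∈ (S :: Ss).flatten then n else 0) =
        (fun i => if i ∈ S then n else 0) + fun i => if i ∈ Ss.flatten then n else 0 := by
      ext i
      rw [List.flatten_cons, Pi.add_apply]
      by_cases hiS : i ∈ S
      · rw [if_pos (List.mem_append_left _ hiS), if_pos hiS, if_neg (hdisj hiS), add_zero]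
      · simp only [List.mem_append, hiS, false_or, if_false, zero_add]
    have hk' : ∀ i, k.quits i + ((if i ∈ S then n else 0) +
        if i ∈ Ss.flatten then n else 0) ≤ T := fun i =>
      (congrArg (k.quits i + ·) (congrFun hsplit i)).ge.trans (hk i)
    refine Runs.bind (exploreTimes_runs (hSs S List.mem_cons_self) hS hM hfuel n s k
      fun i => le_trans (by omega) (hk' i)) ?_
    rintro k₁ st₁ s₁ ⟨rfl, hfirst⟩
    refine Runs.perform_bind ((ih (fun S hS => hSs S (List.mem_cons_of_mem _ hS)) hSs_nodup _ k₁
      fun i => ?_).mono ?_)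
    · rw [hfirst.quits_eq, add_assoc]
      exact hk' i
    · rintro k' st' s' ⟨hst', hrest⟩
      refine ⟨hst', ?_⟩
      rw [hsplit]
      convert (hfirst.trans (.charge _ 2 s₁ k₁)).trans hrest using 1
      · rw [add_zero]
      · rw [List.length_cons]
        ring
      · rw [List.length_cons]
        ring

end Exploration

section Schedule

variable {N : ℕ} {δ : ℝ}

/-- `T_{τ-1}`, the number of explorations that a surviving item has taken part in before round
`τ`. -/
noncomputable def priorCalls (N : ℕ) (δ : ℝ) : ℕ → ℕ
  | 0 => 0
  | τ + 1 => schedule N δ τ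

theorem two_le_log_level (hN : 1 ≤ N) (hδ : 0 < δ) (hδ1 : δ ≤ 1) (τ : ℕ) :
    2 ≤ Real.log (level N δ τ) := by
  rw [Real.le_log_iff_exp_le (level_pos hN hδ τ), level, le_div_iff₀ hδ]
  have hexp : Real.exp 2 ≤ 16 := by
    rw [show (2 : ℝ) = 1 + 1 by norm_num, Real.exp_add]
    nlinarith [Real.exp_one_lt_d9, Real.exp_pos 1]
  have hN' : (1 : ℝ) ≤ N := by exact_mod_cast hN
  have hτ : (1 : ℝ) ≤ ((τ : ℝ) + 1) ^ 2 := one_le_pow₀ (by linarith [τ.cast_nonneg (α := ℝ)])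
  calc Real.exp 2 * δ ≤ 16 * 1 := by gcongr
    _ ≤ 16 * N * ((τ : ℝ) + 1) ^ 2 := by nlinarith

theorem level_mono (hδ : 0 ≤ δ) : Monotone (level N δ) := fun τ τ' hle => by
  unfold level
  gcongr

theorem eight_div_accuracy_succ_sq (τ : ℕ) :
    8 / accuracy (τ + 1) ^ 2 = 4 * (8 / accuracy τ ^ 2) := by
  have hε := (accuracy_pos (τ + 1)).ne'
  rw [accuracy_succ τ]
  field_simp
  norm_num

theorem schedule_lt_succ (hN : 1 ≤ N) (hδ : 0 < δ) (hδ1 : δ ≤ 1) (τ : ℕ) :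
    schedule N δ τ < schedule N δ (τ + 1) := by
  have hlog := two_le_log_level hN hδ hδ1 τ
  have hmono := Real.log_le_log (level_pos hN hδ τ) (level_mono hδ.le τ.le_succ)
  have hε := accuracy_pos τ
  have hone : 1 ≤ 8 / accuracy τ ^ 2 := by
    rw [le_div_iff₀ (by positivity)]
    nlinarith [accuracy_le τ]
  change ⌈8 / accuracy τ ^ 2 * Real.log (level N δ τ)⌉₊ + 1 ≤
    ⌈8 / accuracy (τ + 1) ^ 2 * Real.log (level N δ (τ + 1))⌉₊
  rw [← Nat.ceil_add_one (by positivity), eight_div_accuracy_succ_sq]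
  refine Nat.ceil_mono ?_
  calc 8 / accuracy τ ^ 2 * Real.log (level N δ τ) + 1
      ≤ 4 * (8 / accuracy τ ^ 2) * Real.log (level N δ τ) := by nlinarith
    _ ≤ 4 * (8 / accuracy τ ^ 2) * Real.log (level N δ (τ + 1)) := by gcongr

theorem schedule_mono (hN : 1 ≤ N) (hδ : 0 < δ) (hδ1 : δ ≤ 1) : Monotone (schedule N δ) :=
  monotone_nat_of_le_succ fun τ => (schedule_lt_succ hN hδ hδ1 τ).le

theorem schedule_pos (hN : 1 ≤ N) (hδ : 0 < δ) (hδ1 : δ ≤ 1) (τ : ℕ) : 0 < schedule N δ τ := by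
  refine Nat.ceil_pos.2 (mul_pos ?_ (zero_lt_two.trans_le (two_le_log_level hN hδ hδ1 τ)))
  have hε := accuracy_pos τ
  positivity

theorem priorCalls_add_newCalls (hN : 1 ≤ N) (hδ : 0 < δ) (hδ1 : δ ≤ 1) (τ : ℕ) :
    priorCalls N δ τ + newCalls N δ τ = schedule N δ τ := by
  cases τ with
  | zero => exact zero_add _
  | succ τ => exact Nat.add_sub_cancel' (schedule_lt_succ hN hδ hδ1 τ).le

theorem newCalls_pos (hN : 1 ≤ N) (hδ : 0 < δ) (hδ1 : δ ≤ 1) (τ : ℕ) : 0 < newCalls N δ τ := by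
  cases τ with
  | zero => exact schedule_pos hN hδ hδ1 0
  | succ τ => exact Nat.sub_pos_of_lt (schedule_lt_succ hN hδ hδ1 τ)

end Schedule

section Estimates

variable {N K : ℕ} {r v : Fin N → ℝ} {δ : ℝ} {L τ T : ℕ} {k : Counts N}

/-- The lower confidence bounds `a_i` for the items of `I`; the other items get the value `0`. -/
noncomputable def lowerEstimate (ε : ℝ) (I : List (Fin N)) (st : Stats N) (i : Fin N) : ℝ :=
  if i ∈ I then max 0 ((st.sum i : ℝ) / st.calls i - ε) else 0

/-- The upper confidence bounds `b_i` for the items of `I`; the other items get the value `0`. -/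
noncomputable def upperEstimate (ε : ℝ) (I : List (Fin N)) (st : Stats N) (i : Fin N) : ℝ :=
  if i ∈ I then min ((st.sum i : ℝ) / st.calls i + ε) 1 else 0

theorem Accurate.div_mem_Icc (hN : 1 ≤ N) (hδ : 0 < δ) (hδ1 : δ ≤ 1) (hk : Accurate v δ L k)
    (hτ : τ < L) {i : Fin N} (hi : k.quits i = schedule N δ τ) :
    (k.chosen i : ℝ) / k.quits i ∈ Set.Icc (v i - accuracy τ) (v i + accuracy τ) := by
  have hT : (0 : ℝ) < schedule N δ τ := by exact_mod_cast schedule_pos hN hδ hδ1 τ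
  obtain ⟨hupper, hlower⟩ := hk τ hτ i
  rw [hi, Set.mem_Icc, le_div_iff₀' hT, div_le_iff₀' hT]
  exact ⟨hlower hi, hupper hi.le⟩

theorem Accurate.encloses (h : Regular K r v) (hδ : 0 < δ) (hδ1 : δ ≤ 1) (hk : Accurate v δ L k)
    (hτ : τ < L) {I : List (Fin N)} (hI : best r K v ⊆ I.toFinset)
    (hquits : ∀ i ∈ I, k.quits i = schedule N δ τ) :
    Encloses K r v I.toFinset (lowerEstimate (accuracy τ) I k.toStats)
      (upperEstimate (accuracy τ) I k.toStats) (accuracy τ) := by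
  have hε := accuracy_pos τ
  have hmem : ∀ i ∈ I.toFinset, i ∈ I ∧
      (k.chosen i : ℝ) / k.quits i ∈ Set.Icc (v i - accuracy τ) (v i + accuracy τ) := fun i hi => by
    rw [List.mem_toFinset] at hi
    exact ⟨hi, hk.div_mem_Icc h.one_le_N hδ hδ1 hτ (hquits i hi)⟩
  refine ⟨hI, fun i => ?_, fun i => ?_, fun i hi => ?_, fun i hi => ?_, fun i hi => ?_,
    fun i hi => ?_⟩
  · unfold lowerEstimate
    split_ifs
    exacts [le_max_left _ _, le_rfl]
  · unfold upperEstimate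
    split_ifs
    exacts [le_min (by positivity) zero_le_one, le_rfl]
  all_goals
    obtain ⟨hiI, hlower, hupper⟩ := hmem i hi
    simp only [lowerEstimate, upperEstimate, Counts.toStats, if_pos hiI]
  · exact max_le (h.v_nonneg i) (by linarith)
  · exact le_min (by linarith) (h.v_le_one i)
  · linarith [le_max_right 0 ((k.chosen i : ℝ) / k.quits i - accuracy τ)]
  · linarith [min_le_left ((k.chosen i : ℝ) / k.quits i + accuracy τ) 1]

theorem Accurate.sum_chosen_le (hv : ∀ i, v i ≤ 1) (hk : Accurate v δ L k) (hτ : τ < L)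
    (hquits : ∀ i, k.quits i ≤ schedule N δ τ) :
    ∑ i, k.chosen i ≤ N * (2 * schedule N δ τ) := by
  have hchosen : ∀ i, k.chosen i ≤ 2 * schedule N δ τ := fun i => by
    have hle : (k.chosen i : ℝ) ≤ schedule N δ τ * 2 := ((hk τ hτ i).1 (hquits i)).trans
      (mul_le_mul_of_nonneg_left (by linarith [hv i, accuracy_le τ]) (Nat.cast_nonneg _))
    rw [mul_comm]
    exact_mod_cast hle
  simpa using Finset.sum_le_card_nsmul Finset.univ k.chosen _ fun i _ => hchosen i

theorem Accurate.chosen_add_le (hk : Accurate v δ L k) (hτ : τ < L) {i : Fin N}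
    (hi : k.quits i = schedule N δ τ) (K : ℕ) :
    (k.chosen i : ℝ) + k.quits i / K ≤ schedule N δ τ * (v i + accuracy τ + 1 / K) := by
  rw [hi, mul_add, mul_one_div]
  exact add_le_add_left ((hk τ hτ i).1 hi.le) _

end Estimates

section Decision

variable {N K : ℕ} {r : Fin N → ℝ} {I : List (Fin N)}

/-- The computation of both confidence bounds of all items of `I`, as in `rounds`. -/
noncomputable def estimatesT (ε : ℝ) (I : List (Fin N)) (st : Stats N) :
    Timed ((Fin N → ℝ) × (Fin N → ℝ)) :=
  foldT (fun i (ab : (Fin N → ℝ) × (Fin N → ℝ)) => step 12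
      (Function.update ab.1 i (max 0 ((st.sum i : ℝ) / st.calls i - ε)),
       Function.update ab.2 i (min ((st.sum i : ℝ) / st.calls i + ε) 1)))
    ((fun _ => 0), (fun _ => 0)) I

/-- The test whether all items of `C` have rewards above `R`, as in `rounds`. -/
noncomputable def isAboveT (r : Fin N → ℝ) (R : ℝ) (C : List (Fin N)) : Timed Bool :=
  foldT (fun i t => step 3 (decide (R < r i) && t)) true C

/-- The computations that a round with accuracy `ε` makes after the explorations: the items that
survive, and whether they are returned. -/
noncomputable def decisionT (r : Fin N → ℝ) (K : ℕ) (ε : ℝ) (I : List (Fin N)) (st : Stats N) :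
    Timed (List (Fin N) × Bool) := do
  let ab ← estimatesT ε I st
  let C ← pruneT r K I ab.1 ab.2
  let R ← rewardT r ab.2 C
  let above ← isAboveT r R C
  let done ← step (C.length + 2) (decide (C.length ≤ K) && above)
  return (C, done)

theorem perform_pure {α : Type} (x : α) : (perform (pure x) : Exec N α) = pure x := rfl

theorem perform_bind {α β : Type} (x : Timed α) (f : α → Timed β) :
    (perform (x >>= f) : Exec N β) = perform x >>= fun a => perform (f a) := by
  funext s
  change some ((f x.val).val, { s with time := s.time + (x.cost + (f x.val).cost) }) =
    some ((f x.val).val, { s with time := s.time + x.cost + (f x.val).cost })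
  rw [add_assoc]

theorem rounds_succ (fuel : ℕ) (env : Feedback N)
    (part : List (Option (Fin N)) → List (Fin N) → List (List (Fin N))) (r : Fin N → ℝ) (K : ℕ)
    (δ : ℝ) (j τ : ℕ) (I : List (Fin N)) (st : Stats N) :
    rounds fuel env part r K δ (j + 1) τ I st = (do
      let ε ← perform (step 2 (accuracy τ))
      let n ← perform (step 20 (newCalls N δ τ))
      let s ← get
      let Ss ← perform
        (step (2 * I.length + 2 * (part s.hist I).length + 2) (part s.hist I))
      let st ← exploreBlocks fuel env n Ss st
      let p ← perform (decisionT r K ε I st)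
      if p.2 then return p.1 else rounds fuel env part r K δ j (τ + 1) p.1 st) := by
  simp only [rounds, decisionT, estimatesT, isAboveT, perform_bind, perform_pure, bind_assoc,
    pure_bind]

theorem estimatesT_val (ε : ℝ) (I : List (Fin N)) (st : Stats N) :
    (estimatesT ε I st).val = (lowerEstimate ε I st, upperEstimate ε I st) := by
  rw [estimatesT, foldT_val]
  induction I with
  | nil => simp [lowerEstimate, upperEstimate, funext_iff]
  | cons x I ih =>
    rw [List.foldr_cons, ih, val_step, Prod.mk.injEq]
    constructor <;> funext i <;> rcases eq_or_ne i x with rfl | hix <;>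
      simp [lowerEstimate, upperEstimate, *]

theorem isAboveT_val_eq_true_iff (r : Fin N → ℝ) (R : ℝ) (C : List (Fin N)) :
    (isAboveT r R C).val = true ↔ ∀ i ∈ C, R < r i := by
  rw [isAboveT, foldT_val]
  induction C with
  | nil => simp
  | cons x C ih =>
    rw [List.foldr_cons, val_step, Bool.and_eq_true, decide_eq_true_eq, List.forall_mem_cons, ih]

theorem decisionT_val_fst (r : Fin N → ℝ) (K : ℕ) (ε : ℝ) (I : List (Fin N)) (st : Stats N) :
    (decisionT r K ε I st).val.1 =
      (pruneT r K I (lowerEstimate ε I st) (upperEstimate ε I st)).val := by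
  rw [decisionT, Timed.val_bind, estimatesT_val]
  rfl

theorem decisionT_val_snd_eq_true_iff (r : Fin N → ℝ) (K : ℕ) (ε : ℝ) (hI : I.Nodup)
    (st : Stats N) {C : Finset (Fin N)} (hC : (decisionT r K ε I st).val.1.toFinset = C) :
    (decisionT r K ε I st).val.2 = true ↔
      C.card ≤ K ∧ ∀ i ∈ C, reward r (upperEstimate ε I st) C < r i := by
  have hnodup : (decisionT r K ε I st).val.1.Nodup :=
    decisionT_val_fst r K ε I st ▸ nodup_pruneT hI
  rw [← hC, List.toFinset_card_of_nodup hnodup, ← rewardT_val r _ hnodup]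
  simp only [List.mem_toFinset]
  rw [← isAboveT_val_eq_true_iff, ← decide_eq_true_eq (p := _ ≤ K), ← Bool.and_eq_true,
    decisionT_val_fst, decisionT, Timed.val_bind, estimatesT_val]
  rfl

theorem decisionT_cost_le (hN : 1 ≤ N) (hI : I.Nodup) (r : Fin N → ℝ) (K : ℕ) (ε : ℝ)
    (st : Stats N) : (decisionT r K ε I st).cost ≤
      30 * N + 8 + 750 * (N ^ 2 * (Nat.clog 2 N + 1)) := by
  have hlen : ∀ {l : List (Fin N)}, l.Nodup → l.length ≤ N := fun hl => by
    simpa using hl.length_le_card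
  have hI' := hlen hI
  have hestimates : (estimatesT ε I st).cost ≤ (12 + 2) * I.length + 1 :=
    foldT_cost_le _ _ fun _ _ _ => le_rfl
  simp only [decisionT, Timed.cost_bind, estimatesT_val, cost_step]
  set a := lowerEstimate ε I st
  set b := upperEstimate ε I st
  set C := (pruneT r K I a b).val
  have hC : C.length ≤ N := hlen (nodup_pruneT hI)
  have hprune := pruneT_cost_le hN hI' r K a b
  have hreward := rewardT_cost_le r b C
  have habove : (isAboveT r (rewardT r b C).val C).cost ≤ (3 + 2) * C.length + 1 :=
    foldT_cost_le _ _ fun _ _ _ => le_rfl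
  change _ + (_ + (_ + (_ + (_ + 0)))) ≤ _
  omega

end Decision

section Rounds

variable {N K : ℕ} {r v Z : Fin N → ℝ} {δ : ℝ} {τ : ℕ} {I : List (Fin N)} {k : Counts N}
  {s : Ledger N}

/-- The size `2 K / 2^τ` of the gaps that may still be unresolved when round `τ` begins. -/
noncomputable def resolution (K τ : ℕ) : ℝ := 2 * K / 2 ^ τ

theorem resolution_eq (K τ : ℕ) : resolution K τ = 16 * K * accuracy τ := by
  rw [resolution, accuracy, one_div_pow, pow_add]
  field_simp
  ring

theorem resolution_succ (K τ : ℕ) : resolution K (τ + 1) = 8 * K * accuracy τ := by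
  rw [resolution_eq, accuracy_succ τ]
  ring

theorem Regular.gap_le_resolution_zero (h : Regular K r v) (i : Fin N) :
    gap r K v i ≤ resolution K 0 := by
  have hK : (1 : ℝ) ≤ K := by exact_mod_cast h.one_le_K
  rw [resolution, pow_zero, div_one]
  linarith [h.gap_le_one i]

/-- Round `τ` is entered only if some gap may still be unresolved; this also bounds the
preferences of the best assortment. -/
structure Active (K : ℕ) (r v : Fin N → ℝ) (τ : ℕ) : Prop where
  exists_gap_le : ∃ i, gap r K v i ≤ resolution K τ
  one_add_sum_best_le : 1 + ∑ i ∈ best r K v, v i ≤ H₂ r K v * resolution K τ ^ 2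

theorem Regular.active_zero (h : Regular K r v) : Active K r v 0 := by
  refine ⟨⟨⟨0, h.one_le_N⟩, h.gap_le_resolution_zero _⟩, ?_⟩
  have hK : (1 : ℝ) ≤ K := by exact_mod_cast h.one_le_K
  rw [resolution, pow_zero, div_one]
  exact (h.one_add_sum_le_H₂ _).trans
    (le_mul_of_one_le_right h.H₂_nonneg (one_le_pow₀ (by linarith)))

/-- A bound on the number of steps of a round apart from the pulls. -/
def roundCost (N : ℕ) : ℕ := 820 * (N ^ 2 * (Nat.clog 2 N + 1))

/-- The accounts after `τ` rounds, in which the items of `I` took part in `T` explorations each: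
an item outside the best assortment has been charged at most `Z i`, for its choices and its
`K`-th share of the explorations; rounding up the numbers of blocks costs at most `T` more. -/
structure Tally (K : ℕ) (r v Z : Fin N → ℝ) (T τ : ℕ) (I : List (Fin N)) (k : Counts N)
    (s : Ledger N) : Prop where
  quits_eq : ∀ i ∈ I, k.quits i = T
  quits_le : ∀ i, k.quits i ≤ T
  item_le : ∀ i ∉ best r K v, (k.chosen i : ℝ) + k.quits i / K ≤ Z i
  pulls_le : (s.pulls : ℝ) ≤ ∑ i, ((k.chosen i : ℝ) + k.quits i / K) + T
  le_pulls : τ ≤ s.pulls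
  time_le : s.time ≤ (14 * N + 9) * s.pulls + roundCost N * τ + (4 * N + 2)

/-- What holds when round `τ` begins. -/
structure RoundInv (K : ℕ) (r v : Fin N → ℝ) (δ : ℝ) (Z : Fin N → ℝ) (τ : ℕ) (I : List (Fin N))
    (k : Counts N) (s : Ledger N) : Prop where
  nodup : I.Nodup
  best_subset : best r K v ⊆ I.toFinset
  gap_le : ∀ i ∈ I, i ∉ best r K v → gap r K v i ≤ resolution K τ
  active : Active K r v τ
  tally : Tally K r v Z (priorCalls N δ τ) τ I k s

/-- What holds when the algorithm returns `C` in round `τ`. -/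
structure Returned (K : ℕ) (r v : Fin N → ℝ) (δ : ℝ) (Z : Fin N → ℝ) (τ : ℕ) (C : List (Fin N))
    (s : Ledger N) : Prop where
  eq_best : C.toFinset = best r K v
  active : Active K r v τ
  pulls_le : (s.pulls : ℝ) ≤ (∑ i ∈ Finset.univ \ best r K v, Z i) +
    schedule N δ τ * (∑ i ∈ best r K v, (v i + accuracy τ + 1 / K)) + schedule N δ τ
  le_pulls : τ + 1 ≤ s.pulls
  time_le : s.time ≤ (14 * N + 9) * s.pulls + roundCost N * (τ + 1) + (4 * N + 2)

theorem Explored.pulls_le {T n p c d : ℕ} {k' : Counts N} {s' : Ledger N} (hI : I.Nodup)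
    (hp : (p : ℝ) ≤ I.length / K + 1)
    (h : Explored c (fun i => if i ∈ I then n else 0) (n * p) d s k s' k')
    (hpulls : (s.pulls : ℝ) ≤ ∑ i, ((k.chosen i : ℝ) + k.quits i / K) + T) :
    (s'.pulls : ℝ) ≤ ∑ i, ((k'.chosen i : ℝ) + k'.quits i / K) + (T + n : ℕ) := by
  have hquits : ∑ i, (k'.quits i : ℝ) = ∑ i, (k.quits i : ℝ) + n * I.length := by
    have hsum : ∑ i, (if i ∈ I then n else 0) = n * I.length := by
      rw [← Finset.sum_filter, Finset.sum_const, smul_eq_mul, mul_comm,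
        ← List.toFinset_card_of_nodup hI]
      congr 2
      ext i
      simp
    rw [← Nat.cast_sum, Finset.sum_congr rfl fun i _ => h.quits_eq i, Finset.sum_add_distrib, hsum]
    push_cast
    rfl
  have hpulls_eq : (s'.pulls : ℝ) + ∑ i, (k.chosen i : ℝ) =
      s.pulls + n * p + ∑ i, (k'.chosen i : ℝ) := by exact_mod_cast h.pulls_eq
  have hblocks : (n * p : ℝ) ≤ n * I.length / K + n :=
    calc (n * p : ℝ) ≤ n * (I.length / K + 1) := by gcongr
      _ = n * I.length / K + n := by ring
  simp only [Finset.sum_add_distrib, ← Finset.sum_div] at hpulls ⊢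
  rw [hquits, add_div]
  push_cast
  linarith

theorem Tally.explore {T n p t₀ t₁ : ℕ} {k' : Counts N} {s' : Ledger N}
    (tally : Tally K r v Z T τ I k s) (hI : I.Nodup) (hn : 0 < n) (hp : 0 < p)
    (hp' : (p : ℝ) ≤ I.length / K + 1)
    (h : Explored (14 * N + 9) (fun i => if i ∈ I then n else 0) (n * p) (3 * p + 1)
      { s with time := s.time + t₀ } k s' k')
    (ht : t₀ + (3 * p + 1) + t₁ ≤ roundCost N)
    (hZ : ∀ i ∈ I, i ∉ best r K v → (k'.chosen i : ℝ) + k'.quits i / K ≤ Z i) :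
    Tally K r v Z (T + n) (τ + 1) I k' { s' with time := s'.time + t₁ } where
  quits_eq i hi := by rw [h.quits_eq, if_pos hi, tally.quits_eq i hi]
  quits_le i := by
    have hi := tally.quits_le i
    rw [h.quits_eq]
    split_ifs <;> omega
  item_le i hi := by
    by_cases hiI : i ∈ I
    · exact hZ i hiI hi
    · rw [h.chosen_eq i (if_neg hiI), h.quits_eq, if_neg hiI, add_zero]
      exact tally.item_le i hi
  pulls_le := by
    simpa only [Ledger.pulls] using
      h.pulls_le hI hp' (by simpa only [Ledger.pulls] using tally.pulls_le)
  le_pulls := (Nat.add_le_add tally.le_pulls (Nat.mul_pos hn hp)).trans h.le_pulls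
  time_le := by
    have htime := h.time_le
    have hprior := tally.time_le
    simp only [Ledger.pulls] at htime hprior ⊢
    rw [mul_add, mul_one]
    omega

theorem Tally.subset {T : ℕ} {J : List (Fin N)} (tally : Tally K r v Z T τ I k s)
    (hJ : J ⊆ I) : Tally K r v Z T τ J k s :=
  { tally with quits_eq := fun i hi => tally.quits_eq i (hJ hi) }

theorem RoundInv.returned {L : ℕ} {C : List (Fin N)} {k' : Counts N} {s' : Ledger N}
    (inv : RoundInv K r v δ Z τ I k s) (hτ : τ < L) (hk : Accurate v δ L k')
    (tally : Tally K r v Z (schedule N δ τ) (τ + 1) I k' s') (hC : C.toFinset = best r K v) :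
    Returned K r v δ Z τ C s' := by
  refine ⟨hC, inv.active, tally.pulls_le.trans (add_le_add_left ?_ _), tally.le_pulls,
    tally.time_le⟩
  rw [← Finset.sum_sdiff (Finset.subset_univ (best r K v)), Finset.mul_sum]
  refine add_le_add
    (Finset.sum_le_sum fun i hi => tally.item_le i (Finset.mem_sdiff.1 hi).2)
    (Finset.sum_le_sum fun i hi => hk.chosen_add_le hτ (tally.quits_eq i ?_) K)
  exact List.mem_toFinset.1 (inv.best_subset hi)

theorem RoundInv.of_prune {C : List (Fin N)} {a b : Fin N → ℝ} {k' : Counts N} {s' : Ledger N}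
    (h : Regular K r v) (e : Encloses K r v I.toFinset a b (accuracy τ))
    (tally : Tally K r v Z (schedule N δ τ) (τ + 1) I k' s') (hnodup : C.Nodup)
    (hC : C.toFinset = prune r K I.toFinset a b)
    (hcont : ¬ ((prune r K I.toFinset a b).card ≤ K ∧ ∀ i ∈ prune r K I.toFinset a b,
      reward r b (prune r K I.toFinset a b) < r i)) :
    RoundInv K r v δ Z (τ + 1) C k' s' where
  nodup := hnodup
  best_subset := hC ▸ e.best_subset_prune h
  gap_le i hi hiB := by
    rw [← List.mem_toFinset, hC] at hi
    exact resolution_succ K τ ▸ e.gap_le_of_mem_prune h hi hiB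
  active := by
    constructor <;> rw [resolution_succ]
    exacts [e.exists_gap_le h hcont, e.one_add_sum_best_le h hcont]
  tally := tally.subset fun i hi => by
    rw [← List.mem_toFinset, hC] at hi
    exact List.mem_toFinset.1 (mem_prune.1 hi).1

theorem IsPartitionRule.length_le_div_add_one
    {part : List (Option (Fin N)) → List (Fin N) → List (List (Fin N))}
    (hpart : IsPartitionRule K part) (h : List (Option (Fin N))) (hI : I.Nodup) :
    ((part h I).length : ℝ) ≤ I.length / K + 1 := by
  rw [(hpart h I hI).1]
  exact (Nat.ceil_lt_add_one (by positivity)).le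

theorem IsPartitionRule.length_le_length
    {part : List (Option (Fin N)) → List (Fin N) → List (List (Fin N))}
    (hpart : IsPartitionRule K part) (hK : 1 ≤ K) (h : List (Option (Fin N))) (hI : I.Nodup) :
    (part h I).length ≤ I.length := by
  rw [(hpart h I hI).1, Nat.ceil_le]
  exact div_le_self (by positivity) (by exact_mod_cast hK)

theorem IsPartitionRule.length_pos
    {part : List (Option (Fin N)) → List (Fin N) → List (List (Fin N))}
    (hpart : IsPartitionRule K part) (h : List (Option (Fin N))) (hI : I.Nodup) (hne : I ≠ []) :
    0 < (part h I).length := by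
  refine List.length_pos_of_ne_nil fun hnil => hne ?_
  simpa only [hnil, List.flatten_nil, List.nil_perm] using (hpart h I hI).2.2

theorem RoundInv.ne_nil (inv : RoundInv K r v δ Z τ I k s) (h : Regular K r v) : I ≠ [] := by
  obtain ⟨i, hi⟩ := h.best_nonempty
  exact List.ne_nil_of_mem (List.mem_toFinset.1 (inv.best_subset hi))

theorem RoundInv.explore (inv : RoundInv K r v δ Z τ I k s) (h : Regular K r v) (hδ : 0 < δ)
    (hδ1 : δ ≤ 1) {part : List (Option (Fin N)) → List (Fin N) → List (List (Fin N))}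
    (hpart : IsPartitionRule K part) {L : ℕ} (hτ : τ < L)
    (hZ : ∀ i, gap r K v i ≤ resolution K τ →
      schedule N δ τ * (v i + accuracy τ + 1 / K) ≤ Z i)
    {hist : List (Option (Fin N))} {k' : Counts N} {s' : Ledger N} (hk : Accurate v δ L k')
    (e : Explored (14 * N + 9) (fun i => if i ∈ I then newCalls N δ τ else 0)
      (newCalls N δ τ * (part hist I).length) (3 * (part hist I).length + 1)
      { s with time := s.time + 2 + 20 + (2 * I.length + 2 * (part hist I).length + 2) }
      k s' k') :
    Tally K r v Z (schedule N δ τ) (τ + 1) I k'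
      { s' with time := s'.time + (decisionT r K (accuracy τ) I k'.toStats).cost } := by
  have hI := inv.nodup
  have hsum := priorCalls_add_newCalls h.one_le_N hδ hδ1 τ
  rw [← hsum]
  refine inv.tally.explore hI (newCalls_pos h.one_le_N hδ hδ1 τ)
    (hpart.length_pos _ hI (inv.ne_nil h)) (hpart.length_le_div_add_one _ hI)
    (t₀ := 2 + 20 + (2 * I.length + 2 * (part hist I).length + 2))
    (by simpa only [add_assoc] using e) ?_ fun i hi hiB => ?_
  · have hcost := decisionT_cost_le h.one_le_N hI r K (accuracy τ) k'.toStats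
    have hlen : I.length ≤ N := by simpa using hI.length_le_card
    have hblocks := hpart.length_le_length h.one_le_K hist hI
    have hN : N ≤ N ^ 2 * (Nat.clog 2 N + 1) :=
      (Nat.le_self_pow two_ne_zero N).trans (Nat.le_mul_of_pos_right _ (Nat.succ_pos _))
    have hN1 := h.one_le_N
    rw [roundCost]
    omega
  · refine (hk.chosen_add_le hτ ?_ K).trans (hZ i (inv.gap_le i hi hiB))
    rw [e.quits_eq, if_pos hi, inv.tally.quits_eq i hi, hsum]

theorem RoundInv.decide (inv : RoundInv K r v δ Z τ I k s) (h : Regular K r v) (hδ : 0 < δ)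
    (hδ1 : δ ≤ 1) {L : ℕ} (hτ : τ < L) {k' : Counts N} {s' : Ledger N} (hk : Accurate v δ L k')
    (tally : Tally K r v Z (schedule N δ τ) (τ + 1) I k' s') {C : List (Fin N)} {done : Bool}
    (hdecision : (decisionT r K (accuracy τ) I k'.toStats).val = (C, done)) :
    if done then Returned K r v δ Z τ C s' else RoundInv K r v δ Z (τ + 1) C k' s' := by
  have e := hk.encloses h hδ hδ1 hτ inv.best_subset tally.quits_eq
  have hCval := decisionT_val_fst r K (accuracy τ) I k'.toStats
  have hC := pruneT_val (K := K) h.r_le_one e.nonneg_left e.nonneg_right inv.nodup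
  rw [← hCval] at hC
  have hdone := decisionT_val_snd_eq_true_iff r K (accuracy τ) inv.nodup k'.toStats hC
  have hnodup : (decisionT r K (accuracy τ) I k'.toStats).val.1.Nodup :=
    hCval ▸ nodup_pruneT inv.nodup
  rw [hdecision] at hC hdone hnodup
  split_ifs with hd
  · obtain ⟨hcard, habove⟩ := hdone.1 hd
    exact inv.returned hτ hk tally (hC.trans (e.prune_eq_best h hcard habove))
  · exact .of_prune h e tally hnodup hC (mt hdone.2 hd)

theorem rounds_runs (h : Regular K r v) (hδ : 0 < δ) (hδ1 : δ ≤ 1)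
    {part : List (Option (Fin N)) → List (Fin N) → List (List (Fin N))}
    (hpart : IsPartitionRule K part) {L fuel : ℕ} (hL : ∀ τ, Active K r v τ → τ < L)
    (hfuel : N * (2 * schedule N δ L) < fuel)
    (hZ : ∀ τ i, Active K r v τ → gap r K v i ≤ resolution K τ →
      schedule N δ τ * (v i + accuracy τ + 1 / K) ≤ Z i)
    {j : ℕ} (hj : L ≤ j + τ) (inv : RoundInv K r v δ Z τ I k s) :
    Runs K (Accurate v δ L) (fun env => rounds fuel env part r K δ j τ I k.toStats) s k
      fun _ C s' => ∃ τ', Returned K r v δ Z τ' C s' := by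
  have hτ := hL τ inv.active
  induction j generalizing τ I k s with
  | zero => omega
  | succ j ih =>
    simp only [rounds_succ]
    obtain ⟨-, hblocks, hperm⟩ := hpart s.hist I inv.nodup
    have hchosen : ∀ k', Accurate v δ L k' → (∀ i, k'.quits i ≤ schedule N δ τ) →
        ∑ i, k'.chosen i ≤ N * (2 * schedule N δ L) := fun k' hk' hquits =>
      (hk'.sum_chosen_le h.v_le_one hτ hquits).trans
        (by gcongr; exact schedule_mono h.one_le_N hδ hδ1 hτ.le)
    have hquits : ∀ i, k.quits i + (if i ∈ (part s.hist I).flatten then newCalls N δ τ else 0) ≤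
        schedule N δ τ := fun i => by
      rw [← priorCalls_add_newCalls h.one_le_N hδ hδ1 τ]
      exact Nat.add_le_add (inv.tally.quits_le i) (by split_ifs <;> simp)
    refine Runs.perform_bind (Runs.perform_bind (Runs.get_bind (Runs.perform_bind ?_)))
    refine Runs.bind (exploreBlocks_runs hchosen hfuel _ hblocks
      (hperm.nodup_iff.2 inv.nodup) _ k hquits) ?_
    rintro k' _ s' ⟨rfl, e⟩
    by_cases hk : Accurate v δ L k'
    swap
    · exact Runs.bad hk
    simp only [hperm.mem_iff] at e
    refine Runs.perform_bind ?_
    rcases hdecision : (decisionT r K (accuracy τ) I k'.toStats).val with ⟨C, done⟩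
    have hnext := inv.decide h hδ hδ1 hτ hk
      (inv.explore h hδ hδ1 hpart hτ (fun i => hZ τ i inv.active) hk e) hdecision
    simp only [val_step, hdecision]
    cases done with
    | true => exact Runs.pure ⟨τ, hnext⟩
    | false => exact ih (by omega) hnext (hL _ hnext.active)

end Rounds

/-! ### Pulls and running time -/

theorem add_one_le_of_two_pow_le {n : ℕ} {x : ℝ} (hx : 1 ≤ x) (h : 2 ^ n ≤ 2 * x) :
    (n : ℝ) + 1 ≤ 2 + 3 / 2 * Real.log x := by
  have hlog := Real.log_le_log (by positivity) h
  rw [Real.log_pow, Real.log_mul two_ne_zero (by positivity)] at hlog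
  nlinarith [Real.log_two_gt_d9, Real.log_nonneg hx]

theorem clog_two_le_three_mul_log (N : ℕ) : (Nat.clog 2 N : ℝ) ≤ 3 * Real.log N := by
  rcases Nat.lt_or_ge N 2 with hN | hN
  · rw [Nat.clog_of_right_le_one (by omega), Nat.cast_zero]
    exact mul_nonneg three_pos.le (Real.log_natCast_nonneg N)
  · have hpow : (2 : ℝ) ^ (Nat.clog 2 N - 1) ≤ N := by
      exact_mod_cast (Nat.pow_pred_clog_lt_self one_lt_two hN).le
    have hlog := Real.log_le_log (by positivity) hpow
    rw [Real.log_pow, Nat.cast_pred (Nat.clog_pos one_lt_two hN)] at hlog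
    have hlog_two : Real.log 2 ≤ Real.log N :=
      Real.log_le_log two_pos (by exact_mod_cast hN)
    have hclog : (1 : ℝ) ≤ Nat.clog 2 N := by exact_mod_cast Nat.clog_pos one_lt_two hN
    nlinarith [Real.log_two_gt_d9]

section Bounds

variable {N K τ : ℕ} {r v : Fin N → ℝ} {δ : ℝ}

theorem Regular.le_log_mul_H₂ (h : Regular K r v) : 1.09 ≤ Real.log (K * H₂ r K v) :=
  calc (1.09 : ℝ) ≤ Real.log 3 := by linarith [Real.log_three_gt_d9]
    _ ≤ Real.log (K * H₂ r K v) := Real.log_le_log three_pos h.three_le_mul_H₂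

theorem Active.exists_two_pow_mul_gap_le (ha : Active K r v τ) :
    ∃ i, 2 ^ τ * gap r K v i ≤ 2 * K := by
  obtain ⟨i, hi⟩ := ha.exists_gap_le
  exact ⟨i, (le_div_iff₀' (by positivity)).1 hi⟩

theorem Active.add_one_le_log_mul_H₂ (ha : Active K r v τ) (h : Regular K r v) :
    (τ : ℝ) + 1 ≤ 4 * Real.log (K * H₂ r K v) := by
  obtain ⟨i, hi⟩ := ha.exists_two_pow_mul_gap_le
  have hpow : (2 : ℝ) ^ τ ≤ 2 * (K * H₂ r K v) :=
    calc (2 : ℝ) ^ τ ≤ 2 * K / gap r K v i := (le_div_iff₀ (h.gap_pos i)).2 hi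
      _ = 2 * (K * (1 / gap r K v i)) := by ring
      _ ≤ 2 * (K * H₂ r K v) := by
        gcongr
        exact (h.one_div_gap_le i).trans (h.one_div_gap_sq_le_H₂ i)
  linarith [add_one_le_of_two_pow_le (by linarith [h.three_le_mul_H₂]) hpow, h.le_log_mul_H₂]

theorem Regular.exists_forall_active_lt (h : Regular K r v) :
    ∃ L, ∀ τ, Active K r v τ → τ < L := by
  refine ⟨⌈4 * Real.log (K * H₂ r K v)⌉₊, fun τ ha => ?_⟩
  rw [Nat.lt_ceil]
  linarith [ha.add_one_le_log_mul_H₂ h]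

/-- The logarithmic factor `ln ((N/δ) ln (K H₂))` of `pullBound`. -/
noncomputable def logFactor (r : Fin N → ℝ) (K : ℕ) (v : Fin N → ℝ) (δ : ℝ) : ℝ :=
  Real.log ((N / δ) * Real.log (K * H₂ r K v))

theorem Regular.logFactor_eq (h : Regular K r v) (hδ : 0 < δ) :
    logFactor r K v δ = Real.log (N / δ) + Real.log (Real.log (K * H₂ r K v)) := by
  have hN : (0 : ℝ) < N := by exact_mod_cast h.one_le_N
  exact Real.log_mul (by positivity) (by linarith [h.le_log_mul_H₂])

theorem Regular.log_div_nonneg (h : Regular K r v) (hδ : 0 < δ) (hδ1 : δ ≤ 1) :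
    0 ≤ Real.log (N / δ) := by
  have hN : (1 : ℝ) ≤ N := by exact_mod_cast h.one_le_N
  exact Real.log_nonneg ((one_le_div hδ).2 (hδ1.trans hN))

theorem Regular.le_logFactor (h : Regular K r v) (hδ : 0 < δ) (hδ1 : δ ≤ 1) :
    0.08 ≤ logFactor r K v δ := by
  have hy := h.le_log_mul_H₂
  have hloglog := Real.one_sub_inv_le_log_of_pos (x := Real.log (K * H₂ r K v)) (by linarith)
  have hinv : (Real.log (K * H₂ r K v))⁻¹ ≤ 0.92 :=
    inv_le_of_inv_le₀ (by norm_num) (le_trans (by norm_num) hy)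
  rw [h.logFactor_eq hδ]
  linarith [h.log_div_nonneg hδ hδ1]

theorem Active.log_level_le (ha : Active K r v τ) (h : Regular K r v) (hδ : 0 < δ)
    (hδ1 : δ ≤ 1) : Real.log (level N δ τ) ≤ 5.6 + 2 * logFactor r K v δ := by
  have hN : (0 : ℝ) < N := by exact_mod_cast h.one_le_N
  have hy := h.le_log_mul_H₂
  have hτ := ha.add_one_le_log_mul_H₂ h
  have hfactor := h.logFactor_eq hδ
  set y := Real.log (K * H₂ r K v)
  have hlevel : level N δ τ ≤ 2 ^ 8 * (N / δ) * y ^ 2 :=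
    calc level N δ τ = 16 * (N / δ) * ((τ : ℝ) + 1) ^ 2 := by rw [level]; ring
      _ ≤ 16 * (N / δ) * (4 * y) ^ 2 := by gcongr
      _ = 2 ^ 8 * (N / δ) * y ^ 2 := by ring
  have hlog := Real.log_le_log (level_pos h.one_le_N hδ τ) hlevel
  rw [Real.log_mul (by positivity) (by positivity), Real.log_mul (by positivity) (by positivity),
    Real.log_pow, Real.log_pow] at hlog
  push_cast at hlog
  linarith [Real.log_two_lt_d9, h.log_div_nonneg hδ hδ1]

theorem Active.schedule_mul_accuracy_sq_le (ha : Active K r v τ) (h : Regular K r v)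
    (hδ : 0 < δ) (hδ1 : δ ≤ 1) :
    (schedule N δ τ : ℝ) * accuracy τ ^ 2 ≤ 600 * logFactor r K v δ := by
  have hε := accuracy_pos τ
  have hlog := two_le_log_level h.one_le_N hδ hδ1 τ
  calc (schedule N δ τ : ℝ) * accuracy τ ^ 2
    _ ≤ (8 / accuracy τ ^ 2 * Real.log (level N δ τ) + 1) * accuracy τ ^ 2 := by
        gcongr
        exact (Nat.ceil_lt_add_one (by positivity)).le
    _ = 8 * Real.log (level N δ τ) + accuracy τ ^ 2 := by field_simp
    _ ≤ 8 * (5.6 + 2 * logFactor r K v δ) + 1 := by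
        gcongr
        · exact ha.log_level_le h hδ hδ1
        · exact pow_le_one₀ hε.le (by linarith [accuracy_le τ])
    _ ≤ 600 * logFactor r K v δ := by linarith [h.le_logFactor hδ hδ1]

theorem Active.schedule_mul_resolution_sq_le (ha : Active K r v τ) (h : Regular K r v)
    (hδ : 0 < δ) (hδ1 : δ ≤ 1) :
    (schedule N δ τ : ℝ) * resolution K τ ^ 2 ≤ 153600 * (K ^ 2 * logFactor r K v δ) :=
  calc (schedule N δ τ : ℝ) * resolution K τ ^ 2
    _ = 256 * K ^ 2 * (schedule N δ τ * accuracy τ ^ 2) := by rw [resolution_eq]; ring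
    _ ≤ 256 * K ^ 2 * (600 * logFactor r K v δ) :=
        mul_le_mul_of_nonneg_left (ha.schedule_mul_accuracy_sq_le h hδ hδ1) (by positivity)
    _ = 153600 * (K ^ 2 * logFactor r K v δ) := by ring

theorem Active.schedule_mul_accuracy_mul_resolution_le (ha : Active K r v τ) (h : Regular K r v)
    (hδ : 0 < δ) (hδ1 : δ ≤ 1) :
    (schedule N δ τ : ℝ) * accuracy τ * resolution K τ ≤ 9600 * (K * logFactor r K v δ) :=
  calc (schedule N δ τ : ℝ) * accuracy τ * resolution K τ
    _ = 16 * K * (schedule N δ τ * accuracy τ ^ 2) := by rw [resolution_eq]; ring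
    _ ≤ 16 * K * (600 * logFactor r K v δ) :=
        mul_le_mul_of_nonneg_left (ha.schedule_mul_accuracy_sq_le h hδ hδ1) (by positivity)
    _ = 9600 * (K * logFactor r K v δ) := by ring

/-- A bound on the number of choices of an item outside the best assortment, plus its share of the
explorations. -/
noncomputable def itemBound (r : Fin N → ℝ) (K : ℕ) (v : Fin N → ℝ) (δ : ℝ) (i : Fin N) : ℝ :=
  163200 * (K ^ 2 * logFactor r K v δ) * ((v i + 1 / K) / gap r K v i ^ 2)

theorem Regular.itemBound_nonneg (h : Regular K r v) (hδ : 0 < δ) (hδ1 : δ ≤ 1) (i : Fin N) :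
    0 ≤ itemBound r K v δ i := by
  have hfactor : 0 ≤ logFactor r K v δ := le_trans (by norm_num) (h.le_logFactor hδ hδ1)
  have hv := h.v_nonneg i
  rw [itemBound]
  positivity

theorem Active.schedule_mul_le_itemBound (ha : Active K r v τ) (h : Regular K r v) (hδ : 0 < δ)
    (hδ1 : δ ≤ 1) {i : Fin N} (hi : gap r K v i ≤ resolution K τ) :
    schedule N δ τ * (v i + accuracy τ + 1 / K) ≤ itemBound r K v δ i := by
  have hε := accuracy_pos τ
  have hg := h.gap_pos i
  have hv := h.v_nonneg i
  have hK : (0 : ℝ) < K := by exact_mod_cast h.one_le_K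
  have hfactor : 0 ≤ logFactor r K v δ := le_trans (by norm_num) (h.le_logFactor hδ hδ1)
  have hmain : schedule N δ τ * gap r K v i ^ 2 ≤ 153600 * (K ^ 2 * logFactor r K v δ) :=
    le_trans (by gcongr) (ha.schedule_mul_resolution_sq_le h hδ hδ1)
  have herror : schedule N δ τ * accuracy τ * gap r K v i ^ 2 ≤
      9600 * (K ^ 2 * logFactor r K v δ) * (v i + 1 / K) :=
    calc schedule N δ τ * accuracy τ * gap r K v i ^ 2
      _ ≤ schedule N δ τ * accuracy τ * resolution K τ := by
          gcongr
          exact (pow_le_of_le_one hg.le (h.gap_le_one i) two_ne_zero).trans hi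
      _ ≤ 9600 * (K * logFactor r K v δ) := ha.schedule_mul_accuracy_mul_resolution_le h hδ hδ1
      _ = 9600 * (K ^ 2 * logFactor r K v δ) * (1 / K) := by field_simp
      _ ≤ 9600 * (K ^ 2 * logFactor r K v δ) * (v i + 1 / K) := by
          gcongr
          exact le_add_of_nonneg_left hv
  rw [itemBound, ← mul_div_assoc, le_div_iff₀ (by positivity)]
  calc schedule N δ τ * (v i + accuracy τ + 1 / K) * gap r K v i ^ 2
    _ = schedule N δ τ * gap r K v i ^ 2 * (v i + 1 / K) +
          schedule N δ τ * accuracy τ * gap r K v i ^ 2 := by ring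
    _ ≤ 153600 * (K ^ 2 * logFactor r K v δ) * (v i + 1 / K) +
          9600 * (K ^ 2 * logFactor r K v δ) * (v i + 1 / K) := by gcongr
    _ = 163200 * (K ^ 2 * logFactor r K v δ) * (v i + 1 / K) := by ring

theorem Regular.sum_itemBound_le (h : Regular K r v) (hδ : 0 < δ) (hδ1 : δ ≤ 1)
    (S : Finset (Fin N)) : ∑ i ∈ S, itemBound r K v δ i ≤ 163200 * pullBound r K v δ := by
  have hfactor : 0 ≤ logFactor r K v δ := le_trans (by norm_num) (h.le_logFactor hδ hδ1)
  have hsum : ∑ i, (v i + 1 / K) / gap r K v i ^ 2 ≤ H₂ r K v :=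
    le_add_of_nonneg_right (Real.iSup_nonneg fun i => by positivity)
  calc ∑ i ∈ S, itemBound r K v δ i ≤ ∑ i, itemBound r K v δ i :=
        Finset.sum_le_univ_sum_of_nonneg fun i => h.itemBound_nonneg hδ hδ1 i
    _ = 163200 * (K ^ 2 * logFactor r K v δ) * ∑ i, (v i + 1 / K) / gap r K v i ^ 2 := by
        simp only [itemBound, ← Finset.mul_sum]
    _ ≤ 163200 * (K ^ 2 * logFactor r K v δ) * H₂ r K v := by gcongr
    _ = 163200 * pullBound r K v δ := by rw [pullBound, logFactor]; ring

theorem Active.schedule_mul_sum_best_le (ha : Active K r v τ) (h : Regular K r v) (hδ : 0 < δ)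
    (hδ1 : δ ≤ 1) :
    schedule N δ τ * (1 + ∑ i ∈ best r K v, v i) ≤ 153600 * pullBound r K v δ := by
  have hH := h.H₂_nonneg
  calc schedule N δ τ * (1 + ∑ i ∈ best r K v, v i)
    _ ≤ schedule N δ τ * (H₂ r K v * resolution K τ ^ 2) := by
        gcongr
        exact ha.one_add_sum_best_le
    _ = H₂ r K v * (schedule N δ τ * resolution K τ ^ 2) := by ring
    _ ≤ H₂ r K v * (153600 * (K ^ 2 * logFactor r K v δ)) :=
        mul_le_mul_of_nonneg_left (ha.schedule_mul_resolution_sq_le h hδ hδ1) (by positivity)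
    _ = 153600 * pullBound r K v δ := by rw [pullBound, logFactor]; ring

theorem Active.schedule_mul_accuracy_le (ha : Active K r v τ) (h : Regular K r v) (hδ : 0 < δ)
    (hδ1 : δ ≤ 1) : schedule N δ τ * (K * accuracy τ) ≤ 9600 * pullBound r K v δ := by
  have hε := accuracy_pos τ
  have hH := h.H₂_nonneg
  obtain ⟨i, hi⟩ := ha.exists_gap_le
  have hg := h.gap_pos i
  have hone : 1 ≤ resolution K τ * H₂ r K v :=
    calc (1 : ℝ) = gap r K v i * (1 / gap r K v i) := by field_simp
      _ ≤ resolution K τ * H₂ r K v :=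
        mul_le_mul hi ((h.one_div_gap_le i).trans (h.one_div_gap_sq_le_H₂ i)) (by positivity)
          (hg.le.trans hi)
  calc schedule N δ τ * (K * accuracy τ)
    _ ≤ schedule N δ τ * (K * accuracy τ) * (resolution K τ * H₂ r K v) :=
        le_mul_of_one_le_right (by positivity) hone
    _ = K * H₂ r K v * (schedule N δ τ * accuracy τ * resolution K τ) := by ring
    _ ≤ K * H₂ r K v * (9600 * (K * logFactor r K v δ)) :=
        mul_le_mul_of_nonneg_left (ha.schedule_mul_accuracy_mul_resolution_le h hδ hδ1)
          (by positivity)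
    _ = 9600 * pullBound r K v δ := by rw [pullBound, logFactor]; ring

theorem sum_best_add_le (r v : Fin N → ℝ) (K : ℕ) {ε : ℝ} (hε : 0 ≤ ε) :
    ∑ i ∈ best r K v, (v i + ε + 1 / K) ≤ ∑ i ∈ best r K v, v i + K * ε + 1 := by
  have hcard : ((best r K v).card : ℝ) ≤ K := by exact_mod_cast (isBest_best r K v).1
  rw [Finset.sum_add_distrib, Finset.sum_add_distrib, Finset.sum_const, Finset.sum_const,
    nsmul_eq_mul, nsmul_eq_mul, mul_one_div]
  gcongr
  exact div_le_one_of_le₀ hcard (Nat.cast_nonneg K)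

theorem Returned.pulls_le_pullBound {C : List (Fin N)} {s : Ledger N}
    (hret : Returned K r v δ (itemBound r K v δ) τ C s) (h : Regular K r v) (hδ : 0 < δ)
    (hδ1 : δ ≤ 1) : (s.pulls : ℝ) ≤ 480000 * pullBound r K v δ := by
  have hbest := mul_le_mul_of_nonneg_left (sum_best_add_le r v K (accuracy_pos τ).le)
    (Nat.cast_nonneg (α := ℝ) (schedule N δ τ))
  have hV : 0 ≤ schedule N δ τ * ∑ i ∈ best r K v, v i :=
    mul_nonneg (Nat.cast_nonneg _) (Finset.sum_nonneg fun i _ => h.v_nonneg i)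
  have hpulls := hret.pulls_le
  linarith [h.sum_itemBound_le hδ hδ1 (Finset.univ \ best r K v),
    hret.active.schedule_mul_sum_best_le h hδ hδ1, hret.active.schedule_mul_accuracy_le h hδ hδ1]

theorem Regular.exists_gap_eq_iInf (h : Regular K r v) : ∃ i, gap r K v i = ⨅ j, gap r K v j :=
  have : Nonempty (Fin N) := ⟨⟨0, h.one_le_N⟩⟩
  exists_eq_ciInf_of_finite

theorem iInf_gap_le (r : Fin N → ℝ) (K : ℕ) (v : Fin N → ℝ) (i : Fin N) :
    ⨅ j, gap r K v j ≤ gap r K v i :=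
  ciInf_le (Set.finite_range _).bddBelow i

theorem Regular.three_halves_le_div_iInf_gap (h : Regular K r v) :
    3 / 2 ≤ K / ⨅ i, gap r K v i := by
  obtain ⟨j, hj⟩ := h.exists_gap_eq_iInf
  rw [le_div_iff₀ (hj ▸ h.gap_pos j)]
  rcases h.one_le_K.eq_or_lt with hK | hK
  · obtain ⟨i, hi⟩ := h.exists_gap_le_two_thirds hK.symm
    have hle := (iInf_gap_le r K v i).trans hi
    rw [← hK, Nat.cast_one] at *
    linarith
  · have hK' : (2 : ℝ) ≤ K := by exact_mod_cast hK
    linarith [h.gap_le_one j]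

theorem Active.add_one_le_log_div_iInf_gap (ha : Active K r v τ) (h : Regular K r v) :
    (τ : ℝ) + 1 ≤ 8 * Real.log (K / ⨅ i, gap r K v i) := by
  obtain ⟨i, hi⟩ := ha.exists_two_pow_mul_gap_le
  obtain ⟨j, hj⟩ := h.exists_gap_eq_iInf
  have hx := h.three_halves_le_div_iInf_gap
  have hpow : (2 : ℝ) ^ τ ≤ 2 * (K / ⨅ i, gap r K v i) := by
    rw [← mul_div_assoc, le_div_iff₀ (hj ▸ h.gap_pos j)]
    exact le_trans (by gcongr; exact iInf_gap_le r K v i) hi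
  have hlog : 1 / 3 ≤ Real.log (K / ⨅ i, gap r K v i) :=
    calc (1 / 3 : ℝ) = 1 - (3 / 2)⁻¹ := by norm_num
      _ ≤ Real.log (3 / 2) := Real.one_sub_inv_le_log_of_pos (by norm_num)
      _ ≤ Real.log (K / ⨅ i, gap r K v i) := Real.log_le_log (by norm_num) hx
  linarith [add_one_le_of_two_pow_le (by linarith) hpow]

theorem Returned.time_le_clog {C : List (Fin N)} {s : Ledger N} {Z : Fin N → ℝ} (hN : 1 ≤ N)
    (hret : Returned K r v δ Z τ C s) :
    s.time ≤ 849 * (N * s.pulls) + 1640 * (N ^ 2 * Nat.clog 2 N * (τ + 1)) := by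
  have hround : N ^ 2 * (Nat.clog 2 N + 1) ≤ 2 * (N ^ 2 * Nat.clog 2 N) + 1 := by
    rcases hN.eq_or_lt with rfl | hN
    · simp
    · have := Nat.le_mul_of_pos_right (N ^ 2) (Nat.clog_pos one_lt_two hN)
      linarith
  have hrounds := Nat.mul_le_mul_right (τ + 1) (Nat.mul_le_mul_left 820 hround)
  have htime := hret.time_le
  rw [roundCost] at htime
  have hpulls : s.pulls ≤ N * s.pulls := Nat.le_mul_of_pos_left _ hN
  have hN_pulls : N ≤ N * s.pulls :=
    Nat.le_mul_of_pos_right _ ((Nat.succ_pos τ).trans_le hret.le_pulls)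
  linarith [hret.le_pulls]

theorem Returned.time_le_timeBound {C : List (Fin N)} {s : Ledger N}
    (hret : Returned K r v δ (itemBound r K v δ) τ C s) (h : Regular K r v) (hδ : 0 < δ)
    (hδ1 : δ ≤ 1) : (s.time : ℝ) ≤ 10 ^ 9 * timeBound r K v δ := by
  have hτ := hret.active.add_one_le_log_div_iInf_gap h
  have hpulls := hret.pulls_le_pullBound h hδ hδ1
  have hlogN : 0 ≤ Real.log N := Real.log_natCast_nonneg N
  have hlog_gap : 0 ≤ Real.log (K / ⨅ i, gap r K v i) := by
    have : (0 : ℝ) ≤ τ + 1 := by positivity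
    linarith
  have hpullBound : 0 ≤ pullBound r K v δ := by
    have : (0 : ℝ) ≤ s.pulls := Nat.cast_nonneg _
    linarith
  calc (s.time : ℝ)
    _ ≤ 849 * (N * s.pulls) + 1640 * (N ^ 2 * Nat.clog 2 N * (τ + 1)) := by
        exact_mod_cast hret.time_le_clog h.one_le_N
    _ ≤ 849 * (N * (480000 * pullBound r K v δ)) +
          1640 * (N ^ 2 * (3 * Real.log N) * (8 * Real.log (K / ⨅ i, gap r K v i))) := by
        gcongr
        exact clog_two_le_three_mul_log N
    _ = 407520000 * (N * pullBound r K v δ) +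
          39360 * ((N : ℝ) ^ 2 * Real.log N * Real.log (K / ⨅ i, gap r K v i)) := by ring
    _ ≤ 10 ^ 9 * (N * pullBound r K v δ) +
          10 ^ 9 * ((N : ℝ) ^ 2 * Real.log N * Real.log (K / ⨅ i, gap r K v i)) := by
        gcongr <;> norm_num
    _ = 10 ^ 9 * timeBound r K v δ := by rw [timeBound, mul_add]

theorem Regular.roundInv_zero (h : Regular K r v) (hδ : 0 < δ) (hδ1 : δ ≤ 1) {s : Ledger N}
    (hist : s.hist = []) (htime : s.time ≤ 4 * N + 2) :
    RoundInv K r v δ (itemBound r K v δ) 0 (List.finRange N) ⟨fun _ => 0, fun _ => 0⟩ s where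
  nodup := List.nodup_finRange N
  best_subset i _ := List.mem_toFinset.2 (List.mem_finRange i)
  gap_le i _ _ := h.gap_le_resolution_zero i
  active := h.active_zero
  tally :=
    { quits_eq := fun _ _ => rfl
      quits_le := fun _ => le_rfl
      item_le := fun i _ => by simpa using h.itemBound_nonneg hδ hδ1 i
      pulls_le := by simp [Ledger.pulls, hist]
      le_pulls := Nat.zero_le _
      time_le := htime.trans (Nat.le_add_left _ _) }

theorem algorithm_runs (h : Regular K r v) (hδ : 0 < δ) (hδ1 : δ ≤ 1)
    {part : List (Option (Fin N)) → List (Fin N) → List (List (Fin N))}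
    (hpart : IsPartitionRule K part) {L fuel : ℕ} (hL : ∀ τ, Active K r v τ → τ < L)
    (hLfuel : L ≤ fuel) (hfuel : N * (2 * schedule N δ L) < fuel) :
    Runs K (Accurate v δ L) (fun env => algorithm fuel env part r K δ)
      { hist := [], time := 0 } ⟨fun _ => 0, fun _ => 0⟩
      fun _ C s => ∃ τ, Returned K r v δ (itemBound r K v δ) τ C s := by
  unfold algorithm
  refine Runs.perform_bind (Runs.perform_bind ?_)
  exact rounds_runs h hδ hδ1 hpart hL hfuel
    (fun τ i ha hi => ha.schedule_mul_le_itemBound h hδ hδ1 hi) hLfuel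
    (h.roundInv_zero hδ hδ1 rfl (by simp only [cost_step]; omega))

end Bounds

end MNL

open MNL MeasureTheory in
theorem theorem2 :
    ∃ c : ℝ, 0 < c ∧
      ∀ (N K : ℕ) (_ : 2 ≤ N * K) (r v : Fin N → ℝ)
        (_ : ∀ i, 0 < r i ∧ r i ≤ 1) (_ : ∀ i, 0 < v i ∧ v i ≤ 1)
        (_ : ∀ i, gap r K v i ≠ 0) (δ : ℝ) (_ : 0 < δ)
        (part : List (Option (Fin N)) → List (Fin N) → List (List (Fin N)))
        (_ : IsPartitionRule K part)
        (Ω : Type*) [MeasurableSpace Ω] (μ : Measure Ω) [IsProbabilityMeasure μ]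
        (X : ℕ → Finset (Fin N) → Ω → Option (Fin N)) (_ : IsFeedback μ K v X),
        H₂ r K v ≤ 3 * H₁ r K v ∧
        (∀ (I : List (Fin N)) (a b : Fin N → ℝ), I.Nodup → (∀ i, 0 ≤ a i) → (∀ i, 0 ≤ b i) →
          (pruneT r K I a b).val.toFinset = prune r K I.toFinset a b) ∧
        ENNReal.ofReal (1 - δ) ≤ μ {ω | ∃ (C : List (Fin N)) (s : Ledger N),
          Returns (fun t S => X t S ω) part r K δ C s ∧
          C.toFinset = best r K v ∧
          (s.pulls : ℝ) ≤ c * pullBound r K v δ ∧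
          (s.time : ℝ) ≤ c * timeBound r K v δ} := by
  refine ⟨10 ^ 9, by norm_num, ?_⟩
  intro N K hNK r v hr hv hgap δ hδ part hpart Ω _ μ _ X hX
  have h : Regular K r v := ⟨hNK, fun i => (hr i).1, fun i => (hr i).2, fun i => (hv i).1,
    fun i => (hv i).2, hgap⟩
  refine ⟨h.H₂_le_three_mul_H₁, fun I a b hI ha hb => pruneT_val h.r_le_one ha hb hI, ?_⟩
  rcases lt_or_ge 1 δ with hδ1 | hδ1
  · rw [ENNReal.ofReal_of_nonpos (by linarith)]
    exact zero_le
  obtain ⟨L, hL⟩ := h.exists_forall_active_lt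
  have hruns := algorithm_runs h hδ hδ1 hpart hL
    (fuel := L + N * (2 * schedule N δ L) + 1) (by omega) (by omega)
  have hprob := hruns.ofReal_one_sub_le_measure hX h.v_nonneg
    (potential_nonneg h.v_nonneg h.v_le_one h.one_le_N hδ L)
    (fun k S => (sum_choiceProb_mul_potential h.v_nonneg δ L k S).le)
    (fun _ => one_le_potential h.v_nonneg h.v_le_one h.one_le_N hδ)
  refine (ENNReal.ofReal_le_ofReal (sub_le_sub_left (potential_zero_le h.one_le_N hδ.le L) 1)).trans
    (hprob.trans (measure_mono ?_))
  rintro ω ⟨t, k, ⟨C, s⟩, hrun, -, τ, hret⟩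
  have hpulls := hret.pulls_le_pullBound h hδ hδ1
  refine ⟨C, s, ⟨_, hrun⟩, hret.eq_best, ?_, hret.time_le_timeBound h hδ hδ1⟩
  linarith [Nat.cast_nonneg (α := ℝ) s.pulls]
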